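/- Let $\mathbb K$ be a field of characteristic zero. A Lie bialgebra over $\mathbb K$ is a Lie algebra $\mathfrak a$ over $\mathbb K$ (of arbitrary dimension) with bracket $[\,,]_{\mathfrak a}:\mathfrak a\otimes\mathfrak a\to\mathfrak a$, together with a linear map $\delta_{\mathfrak a}:\mathfrak a\to\mathfrak a\otimes\mathfrak a$ which is antisymmetric, satisfies the co-Jacobi identity, and is a $1$-cocycle: $\delta_{\mathfrak a}([x,y])=x\cdot\delta_{\mathfrak a}(y)-y\cdot\delta_{\mathfrak a}(x)$, where $x\cdot(a\otimes b)=[x,a]\otimes b+a\otimes[x,b]$. Morphisms of Lie bialgebras are the Lie algebra morphisms that commute with the cobrackets. A family of linear maps $\mathfrak a\mapsto\rho_{\mathfrak a}\in\mathrm{Hom}(\mathfrak a^{\otimes n},\mathfrak a^{\otimes m})$, where $\mathfrak a$ runs over all Lie bialgebras over $\mathbb K$, is called universal if it belongs to the smallest class of such families (for varying $n,m$) which contains the identity $\mathrm{id}_{\mathfrak a}$, the bracket $[\,,]_{\mathfrak a}$ and the cobracket $\delta_{\mathfrak a}$, and which is stable under $\mathbb K$-linear combinations, composition, external tensor products, and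 permutations of the tensor factors of the source and of the target. (Linear combinations are taken with coefficients independent of $\mathfrak a$, and all operations are performed simultaneously for all $\mathfrak a$.) Let $\mathcal D$ (resp. $\mathcal C$) be the $\mathbb K$-vector space of all families $\mathfrak a\mapsto\lambda_{\mathfrak a}\in\mathrm{End}(\mathfrak a)$ which are functorial (that is, $f\circ\lambda_{\mathfrak a}=\lambda_{\mathfrak b}\circ f$ for every morphism of Lie bialgebras $f:\mathfrak a\to\mathfrak b$), universal, and such that, for every Lie bialgebra $\mathfrak a$, $\lambda_{\mathfrak a}$ is a derivation, i.e. $\lambda_{\mathfrak a}([x,y])=[\lambda_{\mathfrak a}(x),y]+[x,\lambda_{\mathfrak a}(y)]$ for all $x,y\in\mathfrak a$ (resp. a coderivation, i.e. $\delta_{\mathfrak a}\circ\lambda_{\mathfrak a}=(\lambda_{\mathfrak a}\otimes\mathrm{id}+\mathrm{id}\otimes\lambda_{\mathfrak a})\circ\delta_{\mathfrak a}$). Theorem. $\mathcal D$ and $\mathcal C$ both coincide with the one-dimensional vector space spanned by the assignment $\mathfrak a\mapsto[\,,]_{\mathfrak a}\circ\delta_{\mathfrak a}$. -/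

import Mathlib

open scoped TensorProduct

universe u

namespace LieBialg

noncomputable section

/-- The bracket of a Lie algebra, as a linear map `A ⊗ A → A`. -/
def bracket (K : Type u) [Field K] (A : Type u) [LieRing A] [LieAlgebra K A] :
    A ⊗[K] A →ₗ[K] A :=
  (LieModule.toModuleHom K A A : A ⊗[K] A →ₗ[K] A)

/-- The cyclic permutation `x ⊗ (y ⊗ z) ↦ y ⊗ (z ⊗ x)` of `A ⊗ (A ⊗ A)`. -/
def cyc (K : Type u) [Field K] (A : Type u) [AddCommGroup A] [Module K A] :
    A ⊗[K] (A ⊗[K] A) →ₗ[K] A ⊗[K] (A ⊗[K] A) :=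
  (TensorProduct.assoc K A A A).toLinearMap ∘ₗ (TensorProduct.comm K A (A ⊗[K] A)).toLinearMap

end

/-- A Lie bialgebra over the field `K` (of arbitrary dimension): a Lie algebra `A` with a linear
map `δ : A → A ⊗ A` which is antisymmetric, satisfies the co-Jacobi identity, and is a 1-cocycle
for the adjoint action of `A` on `A ⊗ A`, namely `x • (a ⊗ b) = [x, a] ⊗ b + a ⊗ [x, b]`. -/
structure LBA (K : Type u) [Field K] : Type (u + 1) where
  carrier : Type u
  [lieRing : LieRing carrier]
  [lieAlgebra : LieAlgebra K carrier]
  cobracket : carrier →ₗ[K] carrier ⊗[K] carrier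
  antisymm : ∀ x, TensorProduct.comm K carrier carrier (cobracket x) = -cobracket x
  coJacobi : ∀ x,
    cobracket.lTensor carrier (cobracket x)
      + cyc K carrier (cobracket.lTensor carrier (cobracket x))
      + cyc K carrier (cyc K carrier (cobracket.lTensor carrier (cobracket x))) = 0
  cocycle : ∀ x y, cobracket ⁅x, y⁆ = ⁅x, cobracket y⁆ - ⁅y, cobracket x⁆

instance (K : Type u) [Field K] : CoeSort (LBA K) (Type u) := ⟨LBA.carrier⟩

instance {K : Type u} [Field K] (A : LBA K) : LieRing A := A.lieRing

instance {K : Type u} [Field K] (A : LBA K) : LieAlgebra K A := A.lieAlgebra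

/-- Morphisms of Lie bialgebras: Lie algebra morphisms compatible with the cobrackets. -/
def IsMorphism {K : Type u} [Field K] {A B : LBA K} (f : A →ₗ⁅K⁆ B) : Prop :=
  TensorProduct.map (f : A →ₗ[K] B) (f : A →ₗ[K] B) ∘ₗ A.cobracket
    = B.cobracket ∘ₗ (f : A →ₗ[K] B)

noncomputable section

/-- The canonical isomorphism `A^{⊗1} ≃ A`. -/
def powOne {K : Type u} [Field K] (A : LBA K) : (⨂[K]^1 A) ≃ₗ[K] A :=
  PiTensorProduct.subsingletonEquiv (0 : Fin 1)

/-- The canonical isomorphism `A^{⊗2} ≃ A ⊗ A`. -/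
def powTwo {K : Type u} [Field K] (A : LBA K) : (⨂[K]^2 A) ≃ₗ[K] A ⊗[K] A :=
  (TensorPower.mulEquiv (R := K) (M := A) (n := 1) (m := 1)).symm ≪≫ₗ
    TensorProduct.congr (powOne A) (powOne A)

/-- Families of linear maps `A^{⊗n} → A^{⊗m}`, one for each Lie bialgebra `A`. -/
abbrev Family (K : Type u) [Field K] (n m : ℕ) : Type (u + 1) :=
  ∀ A : LBA K, (⨂[K]^n A) →ₗ[K] (⨂[K]^m A)

/-- The universal families: the smallest class of families which contains the identity of `A`,
the bracket and the cobracket, and is stable under linear combinations, composition, external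
tensor products, and the permutations of the tensor factors of the source and the target. -/
inductive Universal (K : Type u) [Field K] : ∀ n m : ℕ, Family K n m → Prop
  | ident : Universal K 1 1 fun _ => LinearMap.id
  | bracket : Universal K 2 1 fun A =>
      (powOne A).symm.toLinearMap ∘ₗ LieBialg.bracket K A ∘ₗ (powTwo A).toLinearMap
  | cobracket : Universal K 1 2 fun A =>
      (powTwo A).symm.toLinearMap ∘ₗ A.cobracket ∘ₗ (powOne A).toLinearMap
  | add {n m : ℕ} {f g : Family K n m} :
      Universal K n m f → Universal K n m g → Universal K n m fun A => f A + g A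
  | smul {n m : ℕ} (c : K) {f : Family K n m} :
      Universal K n m f → Universal K n m fun A => c • f A
  | comp {n m p : ℕ} {g : Family K m p} {f : Family K n m} :
      Universal K m p g → Universal K n m f → Universal K n p fun A => g A ∘ₗ f A
  | tensor {n m n' m' : ℕ} {f : Family K n m} {g : Family K n' m'} :
      Universal K n m f → Universal K n' m' g →
        Universal K (n + n') (m + m') fun A =>
          TensorPower.mulEquiv.toLinearMap ∘ₗ TensorProduct.map (f A) (g A) ∘ₗ
            TensorPower.mulEquiv.symm.toLinearMap
  | permSource {n m : ℕ} (σ : Equiv.Perm (Fin n)) {f : Family K n m} :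
      Universal K n m f → Universal K n m fun A =>
        f A ∘ₗ (PiTensorProduct.reindex K (fun _ : Fin n => (A : Type u)) σ).toLinearMap
  | permTarget {n m : ℕ} (σ : Equiv.Perm (Fin m)) {f : Family K n m} :
      Universal K n m f → Universal K n m fun A =>
        (PiTensorProduct.reindex K (fun _ : Fin m => (A : Type u)) σ).toLinearMap ∘ₗ f A

/-- Families of endomorphisms `A ↦ l_A ∈ End(A)`, indexed by all Lie bialgebras. -/
abbrev EndFamily (K : Type u) [Field K] : Type (u + 1) := ∀ A : LBA K, A →ₗ[K] A

/-- Functoriality: compatibility with every morphism of Lie bialgebras. -/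
def IsFunctorial {K : Type u} [Field K] (l : EndFamily K) : Prop :=
  ∀ (A B : LBA K) (f : A →ₗ⁅K⁆ B), IsMorphism f → ∀ x : A, f (l A x) = l B (f x)

/-- A family of endomorphisms is universal if it is so as a family of maps `A^{⊗1} → A^{⊗1}`. -/
def IsUniversal {K : Type u} [Field K] (l : EndFamily K) : Prop :=
  Universal K 1 1 fun A => (powOne A).symm.toLinearMap ∘ₗ l A ∘ₗ (powOne A).toLinearMap

def IsDerivation {K : Type u} [Field K] (A : LBA K) (d : A →ₗ[K] A) : Prop :=
  ∀ x y : A, d ⁅x, y⁆ = ⁅d x, y⁆ + ⁅x, d y⁆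

def IsCoderivation {K : Type u} [Field K] (A : LBA K) (d : A →ₗ[K] A) : Prop :=
  A.cobracket ∘ₗ d
    = (TensorProduct.map d LinearMap.id + TensorProduct.map LinearMap.id d) ∘ₗ A.cobracket

theorem isUniversal_zero {K : Type u} [Field K] : IsUniversal (0 : EndFamily K) := by
  have h := Universal.smul (0 : K) (Universal.ident (K := K))
  have e : (fun A : LBA K => (0 : K) • (LinearMap.id : (⨂[K]^1 A) →ₗ[K] (⨂[K]^1 A)))
      = fun A => (powOne A).symm.toLinearMap ∘ₗ (0 : EndFamily K) A ∘ₗ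
          (powOne A).toLinearMap := by
    funext A
    simp
  rw [e] at h
  exact h

theorem isUniversal_add {K : Type u} [Field K] {l l' : EndFamily K}
    (h : IsUniversal l) (h' : IsUniversal l') : IsUniversal (l + l') := by
  have h2 := Universal.add h h'
  simp only [← LinearMap.comp_add, ← LinearMap.add_comp] at h2
  exact h2

theorem isUniversal_smul {K : Type u} [Field K] (c : K) {l : EndFamily K}
    (h : IsUniversal l) : IsUniversal (c • l) := by
  have h2 := Universal.smul c h
  have e : (fun A : LBA K => c • ((powOne A).symm.toLinearMap ∘ₗ l A ∘ₗ (powOne A).toLinearMap))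
      = fun A => (powOne A).symm.toLinearMap ∘ₗ (c • l) A ∘ₗ (powOne A).toLinearMap := by
    funext A
    simp only [Pi.smul_apply, LinearMap.comp_smul, LinearMap.smul_comp]
  rw [e] at h2
  exact h2

/-- The vector space of universal derivations of Lie bialgebras. -/
def universalDerivations (K : Type u) [Field K] : Submodule K (EndFamily K) where
  carrier := {l | IsFunctorial l ∧ IsUniversal l ∧ ∀ A, IsDerivation A (l A)}
  zero_mem' := by
    refine ⟨fun A B f _ x => ?_, isUniversal_zero, fun A x y => ?_⟩ <;> simp
  add_mem' := by
    rintro l l' ⟨h1, h2, h3⟩ ⟨h1', h2', h3'⟩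
    refine ⟨fun A B f hf x => ?_, isUniversal_add h2 h2', fun A x y => ?_⟩
    · simp [h1 A B f hf, h1' A B f hf]
    · have a := h3 A x y
      have b := h3' A x y
      simp only [Pi.add_apply, LinearMap.add_apply, a, b, add_lie, lie_add]
      abel
  smul_mem' := by
    rintro c l ⟨h1, h2, h3⟩
    refine ⟨fun A B f hf x => ?_, isUniversal_smul c h2, fun A x y => ?_⟩
    · simp [h1 A B f hf]
    · have a := h3 A x y
      simp [a]

/-- The vector space of universal coderivations of Lie bialgebras. -/
def universalCoderivations (K : Type u) [Field K] : Submodule K (EndFamily K) where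
  carrier := {l | IsFunctorial l ∧ IsUniversal l ∧ ∀ A, IsCoderivation A (l A)}
  zero_mem' := by
    refine ⟨fun A B f _ x => ?_, isUniversal_zero, fun A => ?_⟩ <;> simp [IsCoderivation]
  add_mem' := by
    rintro l l' ⟨h1, h2, h3⟩ ⟨h1', h2', h3'⟩
    refine ⟨fun A B f hf x => ?_, isUniversal_add h2 h2', fun A => ?_⟩
    · simp [h1 A B f hf, h1' A B f hf]
    · have a := h3 A
      have b := h3' A
      unfold IsCoderivation at a b ⊢
      simp only [Pi.add_apply, LinearMap.comp_add, a, b, TensorProduct.map_add_left,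
        TensorProduct.map_add_right, LinearMap.add_comp]
      abel
  smul_mem' := by
    rintro c l ⟨h1, h2, h3⟩
    refine ⟨fun A B f hf x => ?_, isUniversal_smul c h2, fun A => ?_⟩
    · simp [h1 A B f hf]
    · have a := h3 A
      unfold IsCoderivation at a ⊢
      simp only [Pi.smul_apply, LinearMap.comp_smul, a, TensorProduct.map_smul_left,
        TensorProduct.map_smul_right, LinearMap.smul_comp, LinearMap.add_comp, smul_add]

/-- The assignment `A ↦ [,]_A ∘ δ_A`. -/
def bracketCobracket (K : Type u) [Field K] : EndFamily K :=
  fun A => bracket K A ∘ₗ A.cobracket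

end

end LieBialg

/-! All structure maps are made to act on the tensor algebra of a Lie bialgebra, as transpositions,
brackets and cobrackets of neighbouring factors. The cocycle identity moves every cobracket to the
right of every bracket (`SwapRelations.mem_mul`). By co-Jacobi, a tree of cobrackets can be
rewritten as nested cobrackets followed by permutations, with any chosen leg as the innermost one
(`LegRelations.exists_legs`); in the opposite ring the same statement treats brackets.

Let an endomorphism `E` be inserted in turn on each of the `k + 1` strands between cobrackets and
brackets, the marked strand always being put last. This gives a single expression `combEnd k q E`:
nested cobracket, then `q` permuting the first `k` factors and `E` on the last one, then nested
bracket. For `E = id` the sum over strands is `k + 1` times the original map. If `E` is a derivation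
and a coderivation, the sum is the composite of the original map with `E`. Hence
(`IsUniversal.exists_combEnd`) a universal endomorphism is the sum of the maps `(k + 1)⁻¹ • combEnd
k (q k) id`, and `combEnd k (q k) id ∘ E = (k + 1) • combEnd k (q k) E`.

Rescaling the cobracket separates the degrees `k`. In degree 0 the map is a scalar, which must be
zero; in degree 1 it is a multiple of bracket after cobracket. It remains to prove that `q k` acts
by zero for `k ≥ 2`.

The test object `wordLBA` is the free Lie algebra on the words in an alphabet, with antisymmetrized
deconcatenation as cobracket. Counting a distinguished letter `∗` is a biderivation `E`. A
representation by triangular 2×2 matrices over an arbitrary algebra `R` turns nested brackets ending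
in the image of `E` into ordinary products, so `q` becomes a multilinear function `f` of `k`
elements of `R`. The derivation property at `[w, v∗]` then says that the sum over `w = αxβ` of
`(-1)^|β| f(α ⧢ βʳᵉᵛ ⧢ v) x` vanishes, up to values of `f` at words containing a commutator of a
letter of `w` and a letter of `v` (`WordLBA.map_tens_lie`, `WordLBA.IsTest.splitSum`).

These relations force `f = 0` (`Shuffle.Relations.eq_zero`). Letters carry colours, and letters of
different colours commute. By descending induction on the number of colours, and then on the number
of words shuffled together, the relation for a word `x u 1`, the unit having a new colour, reduces
to `f(x u) = f(u 1) x`. Repetition replaces all letters by units, and `f(1, …, 1)` is the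
augmentation of `q`, which another test shows to be zero. With `R` the tensor algebra of `G`, the
vanishing of `f` says that `q` kills the tensors of degree `k`.

For coderivations, `wordLBA` has a pairing with itself for which bracket and cobracket are adjoint.
Transposition reverses words in transpositions, so a coderivation given by `q` makes `star q` pass
the same tests (`isTest_star_of_isCoderivation`), and duality of tensor algebras carries the
vanishing of `star q` back to `q`. That bracket after cobracket is a derivation and a coderivation
is a direct computation. -/

namespace LieBialg

noncomputable section

/-! ### Linear maps on a tensor algebra defined by recursion on the first letters. -/

namespace Tens

variable {K : Type u} [Field K] {G : Type u} [AddCommGroup G] [Module K G]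
  {H : Type u} [AddCommGroup H] [Module K H]
  {M : Type u} [AddCommGroup M] [Module K M]

local notation "𝐓" => TensorAlgebra K

/-- A subspace of the tensor algebra containing `1` and stable under left multiplication by
vectors is everything. -/
theorem eq_top_of_cons (N : Submodule K (𝐓 G)) (h1 : 1 ∈ N)
    (hc : ∀ (a : G), ∀ t ∈ N, TensorAlgebra.ι K a * t ∈ N) : N = ⊤ := by
  -- The elements whose left multiplication preserves `N` form a subalgebra containing the vectors,
  -- hence everything; apply them to `1`.
  let S : Subalgebra K (𝐓 G) :=
    { carrier := {t | ∀ s ∈ N, t * s ∈ N}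
      mul_mem' := fun {a b} ha hb s hs => by rw [mul_assoc]; exact ha _ (hb _ hs)
      add_mem' := fun {a b} ha hb s hs => by rw [add_mul]; exact N.add_mem (ha s hs) (hb s hs)
      algebraMap_mem' := fun r s hs => by
        rw [← Algebra.smul_def]; exact N.smul_mem r hs }
  have hS : S = ⊤ := by
    rw [eq_top_iff, ← TensorAlgebra.adjoin_range_ι, Algebra.adjoin_le_iff]
    rintro _ ⟨a, rfl⟩
    exact fun s hs => hc a s hs
  rw [eq_top_iff]
  intro t _
  have ht : t ∈ S := hS ▸ Algebra.mem_top
  simpa using ht 1 h1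

theorem ext_words {f g : 𝐓 G →ₗ[K] M} (h1 : f 1 = g 1)
    (hc : ∀ (a : G) (t), f t = g t →
      f (TensorAlgebra.ι K a * t) = g (TensorAlgebra.ι K a * t)) : f = g := by
  have := eq_top_of_cons (LinearMap.eqLocus f g) h1 hc
  exact LinearMap.ext fun t => (this ▸ Submodule.mem_top : t ∈ LinearMap.eqLocus f g)

theorem ext_head {f g : 𝐓 G →ₗ[K] M} (h1 : f 1 = g 1)
    (hc : ∀ (a : G) (t), f (TensorAlgebra.ι K a * t) = g (TensorAlgebra.ι K a * t)) : f = g :=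
  ext_words h1 fun a t _ => hc a t

/-- The representation of `T G` on `T G × M` used to define linear maps by their values on
products `a * t`. -/
def headAux (φ : G →ₗ[K] 𝐓 G →ₗ[K] M) : 𝐓 G →ₐ[K] Module.End K (𝐓 G × M) :=
  TensorAlgebra.lift K
    { toFun := fun a => LinearMap.prod
        (LinearMap.mulLeft K (TensorAlgebra.ι K a) ∘ₗ LinearMap.fst K _ _)
        (φ a ∘ₗ LinearMap.fst K _ _)
      map_add' := fun a b => by ext <;> simp [add_mul]
      map_smul' := fun r a => by ext <;> simp }

/-- The linear map on the tensor algebra with `1 ↦ 0` and `a * t ↦ φ a t`. -/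
def headRec (φ : G →ₗ[K] 𝐓 G →ₗ[K] M) : 𝐓 G →ₗ[K] M where
  toFun t := (headAux φ t (1, 0)).2
  map_add' s t := by simp
  map_smul' r t := by simp

/-- The first component remembers the word already read, so the second component can evaluate `φ a`
at the whole tail. -/
theorem headAux_fst (φ : G →ₗ[K] 𝐓 G →ₗ[K] M) (t : 𝐓 G) (x : 𝐓 G × M) :
    (headAux φ t x).1 = t * x.1 := by
  induction t using TensorAlgebra.induction generalizing x with
  | algebraMap r => rw [AlgHom.commutes]; simp [Algebra.smul_def]
  | ι a => simp [headAux]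
  | mul s t hs ht => rw [map_mul, Module.End.mul_apply, hs, ht, mul_assoc]
  | add s t hs ht => simp [hs, ht, add_mul]

@[simp] theorem headRec_one (φ : G →ₗ[K] 𝐓 G →ₗ[K] M) : headRec φ 1 = 0 := by
  simp [headRec]

@[simp] theorem headRec_cons (φ : G →ₗ[K] 𝐓 G →ₗ[K] M) (a : G) (t : 𝐓 G) :
    headRec φ (TensorAlgebra.ι K a * t) = φ a t := by
  have h := headAux_fst φ t (1, 0)
  simp only [mul_one] at h
  simp only [headRec, LinearMap.coe_mk, AddHom.coe_mk, map_mul, Module.End.mul_apply]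
  simp [headAux] at h ⊢
  rw [h]

/-- `headRec` as a linear function of its datum. -/
def headRecₗ : (G →ₗ[K] 𝐓 G →ₗ[K] M) →ₗ[K] (𝐓 G →ₗ[K] M) where
  toFun := headRec
  map_add' φ ψ := ext_head (by simp) (by simp)
  map_smul' r φ := ext_head (by simp) (by simp)

/-- The linear map with `1, a ↦ 0` and `a * (b * t) ↦ ψ a b t`. -/
def head2 (ψ : G →ₗ[K] G →ₗ[K] 𝐓 G →ₗ[K] M) : 𝐓 G →ₗ[K] M :=
  headRec (headRecₗ ∘ₗ ψ)

@[simp] theorem head2_one (ψ : G →ₗ[K] G →ₗ[K] 𝐓 G →ₗ[K] M) : head2 ψ 1 = 0 := by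
  simp [head2]

theorem head2_cons (ψ : G →ₗ[K] G →ₗ[K] 𝐓 G →ₗ[K] M) (a : G) (t : 𝐓 G) :
    head2 ψ (TensorAlgebra.ι K a * t) = headRec (ψ a) t := by
  simp [head2, headRecₗ]

@[simp] theorem head2_ι (ψ : G →ₗ[K] G →ₗ[K] 𝐓 G →ₗ[K] M) (a : G) :
    head2 ψ (TensorAlgebra.ι K a) = 0 := by
  rw [← mul_one (TensorAlgebra.ι K a), head2_cons, headRec_one]

@[simp] theorem head2_cons_cons (ψ : G →ₗ[K] G →ₗ[K] 𝐓 G →ₗ[K] M) (a b : G) (t : 𝐓 G) :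
    head2 ψ (TensorAlgebra.ι K a * (TensorAlgebra.ι K b * t)) = ψ a b t := by
  rw [head2_cons, headRec_cons]

theorem ext_head2 {f g : 𝐓 G →ₗ[K] M} (h1 : f 1 = g 1)
    (h2 : ∀ a, f (TensorAlgebra.ι K a) = g (TensorAlgebra.ι K a))
    (hc : ∀ (a b : G) (t), f (TensorAlgebra.ι K a * (TensorAlgebra.ι K b * t))
      = g (TensorAlgebra.ι K a * (TensorAlgebra.ι K b * t))) : f = g := by
  refine ext_head h1 fun a t => ?_
  have : f ∘ₗ LinearMap.mulLeft K (TensorAlgebra.ι K a)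
      = g ∘ₗ LinearMap.mulLeft K (TensorAlgebra.ι K a) :=
    ext_head (by simpa using h2 a) (by simpa using hc a)
  simpa using LinearMap.congr_fun this t

/-- `f` acting on all tensor factors but the first. -/
def lift (f : Module.End K (𝐓 G)) : Module.End K (𝐓 G) :=
  headRec (LinearMap.compl₂ (LinearMap.mul K (𝐓 G) ∘ₗ TensorAlgebra.ι K) f)

@[simp] theorem lift_one (f : Module.End K (𝐓 G)) : lift f 1 = 0 := headRec_one _

@[simp] theorem lift_cons (f : Module.End K (𝐓 G)) (a : G) (t : 𝐓 G) :
    lift f (TensorAlgebra.ι K a * t) = TensorAlgebra.ι K a * f t := by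
  simp [lift]

@[simp] theorem lift_ι (f : Module.End K (𝐓 G)) (a : G) :
    lift f (TensorAlgebra.ι K a) = TensorAlgebra.ι K a * f 1 := by
  rw [← mul_one (TensorAlgebra.ι K a), lift_cons, mul_one]

theorem lift_mul (f g : Module.End K (𝐓 G)) : lift (f * g) = lift f * lift g :=
  ext_head (by simp) (by simp)

theorem lift_add (f g : Module.End K (𝐓 G)) : lift (f + g) = lift f + lift g :=
  ext_head (by simp) (by simp [mul_add])

theorem lift_sub (f g : Module.End K (𝐓 G)) : lift (f - g) = lift f - lift g :=
  ext_head (by simp) (by simp [mul_sub])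

theorem lift_neg (f : Module.End K (𝐓 G)) : lift (-f) = -lift f :=
  ext_head (by simp) (by simp)

theorem neg_op_mul (f g : Module.End K (𝐓 G)) : -f * g = -(f * g) := rfl

theorem op_mul_neg (f g : Module.End K (𝐓 G)) : f * -g = -(f * g) :=
  LinearMap.ext fun x => map_neg f (g x)

theorem lift_smul (r : K) (f : Module.End K (𝐓 G)) : lift (r • f) = r • lift f :=
  ext_head (by simp) (by simp)

/-- The product `a ⊗ b ↦ a * b` into the tensor algebra. -/
def mul₂ : G ⊗[K] G →ₗ[K] 𝐓 G :=
  LinearMap.mul' K (𝐓 G) ∘ₗ TensorProduct.map (TensorAlgebra.ι K) (TensorAlgebra.ι K)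

@[simp] theorem mul₂_tmul (a b : G) :
    mul₂ (a ⊗ₜ[K] b) = TensorAlgebra.ι K a * TensorAlgebra.ι K b := by simp [mul₂]

/-! ### Transposition, product and coproduct on the first factors, and their relations. -/

/-- The exchange of the first two tensor factors. -/
def tau₀ : Module.End K (𝐓 G) :=
  head2 (LinearMap.compr₂ (LinearMap.mk₂ K
    (fun a b : G => TensorAlgebra.ι K b * TensorAlgebra.ι K a)
    (by simp [mul_add]) (by simp) (by simp [add_mul]) (by simp)) (LinearMap.mul K (𝐓 G)))

@[simp] theorem tau₀_one : tau₀ (1 : 𝐓 G) = 0 := by simp [tau₀]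
@[simp] theorem tau₀_ι (a : G) : tau₀ (TensorAlgebra.ι K a) = 0 := by simp [tau₀]
@[simp] theorem tau₀_cons (a b : G) (t : 𝐓 G) :
    tau₀ (TensorAlgebra.ι K a * (TensorAlgebra.ι K b * t))
      = TensorAlgebra.ι K b * (TensorAlgebra.ι K a * t) := by simp [tau₀, mul_assoc]

@[simp] theorem tau₀_two (a b : G) :
    tau₀ (TensorAlgebra.ι K a * TensorAlgebra.ι K b)
      = TensorAlgebra.ι K b * TensorAlgebra.ι K a := by
  rw [← mul_one (TensorAlgebra.ι K b), tau₀_cons, mul_one, mul_one]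

/-- A product applied to the first two tensor factors. -/
def mu₀ (β : G →ₗ[K] G →ₗ[K] G) : Module.End K (𝐓 G) :=
  head2 (LinearMap.compr₂ β (LinearMap.mul K (𝐓 G) ∘ₗ TensorAlgebra.ι K))

section
variable (β : G →ₗ[K] G →ₗ[K] G)
@[simp] theorem mu₀_one : mu₀ β (1 : 𝐓 G) = 0 := by simp [mu₀]
@[simp] theorem mu₀_ι (a : G) : mu₀ β (TensorAlgebra.ι K a) = 0 := by simp [mu₀]
@[simp] theorem mu₀_cons (a b : G) (t : 𝐓 G) :
    mu₀ β (TensorAlgebra.ι K a * (TensorAlgebra.ι K b * t))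
      = TensorAlgebra.ι K (β a b) * t := by simp [mu₀]
@[simp] theorem mu₀_two (a b : G) :
    mu₀ β (TensorAlgebra.ι K a * TensorAlgebra.ι K b) = TensorAlgebra.ι K (β a b) := by
  rw [← mul_one (TensorAlgebra.ι K b), mu₀_cons, mul_one]
end

/-- A coproduct applied to the first tensor factor. -/
def del₀ (d : G →ₗ[K] G ⊗[K] G) : Module.End K (𝐓 G) :=
  headRec (LinearMap.mul K (𝐓 G) ∘ₗ mul₂ ∘ₗ d)

section
variable (d : G →ₗ[K] G ⊗[K] G)
@[simp] theorem del₀_one : del₀ d (1 : 𝐓 G) = 0 := by simp [del₀]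
@[simp] theorem del₀_cons (a : G) (t : 𝐓 G) :
    del₀ d (TensorAlgebra.ι K a * t) = mul₂ (d a) * t := by simp [del₀]
@[simp] theorem del₀_ι (a : G) : del₀ d (TensorAlgebra.ι K a) = mul₂ (d a) := by
  rw [← mul_one (TensorAlgebra.ι K a), del₀_cons, mul_one]
end

/-- Transport of `mul₂ x * t` through a linear map. -/
theorem mul₂_ext {f g : 𝐓 G →ₗ[K] M} (x : G ⊗[K] G) (t : 𝐓 G)
    (h : ∀ a b, f (TensorAlgebra.ι K a * (TensorAlgebra.ι K b * t))
      = g (TensorAlgebra.ι K a * (TensorAlgebra.ι K b * t))) :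
    f (mul₂ x * t) = g (mul₂ x * t) := by
  induction x with
  | zero => simp
  | add x y hx hy => simp [add_mul, hx, hy]
  | tmul a b => simpa [mul_assoc] using h a b

theorem lift_lift_mul₂ (f : Module.End K (𝐓 G)) (x : G ⊗[K] G) (t : 𝐓 G) :
    lift (lift f) (mul₂ x * t) = mul₂ x * f t := by
  induction x with
  | zero => simp
  | add x y hx hy => simp [add_mul, hx, hy]
  | tmul a b => simp [mul_assoc]

theorem tau₀_mul₂ (x : G ⊗[K] G) (t : 𝐓 G) :
    tau₀ (mul₂ x * t) = mul₂ (TensorProduct.comm K G G x) * t := by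
  induction x with
  | zero => simp
  | add x y hx hy => simp [add_mul, hx, hy]
  | tmul a b => simp [mul_assoc]

theorem tau₀_braid : (tau₀ : Module.End K (𝐓 G)) * lift tau₀ * tau₀
    = lift tau₀ * tau₀ * lift tau₀ := by
  refine ext_head2 (by simp) (by simp) fun a b t => ?_
  -- `ext_head2` exposes two letters; the relation involves three, so the tail is split once more.
  have : (tau₀ * lift tau₀ * tau₀ : Module.End K (𝐓 G)) ∘ₗ
      LinearMap.mulLeft K (TensorAlgebra.ι K a * TensorAlgebra.ι K b) =
      (lift tau₀ * tau₀ * lift tau₀ : Module.End K (𝐓 G)) ∘ₗ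
      LinearMap.mulLeft K (TensorAlgebra.ι K a * TensorAlgebra.ι K b) :=
    ext_head (by simp) (by simp [mul_assoc])
  simpa [mul_assoc] using LinearMap.congr_fun this t

theorem tau₀_lift_lift (f : Module.End K (𝐓 G)) :
    tau₀ * lift (lift f) = lift (lift f) * tau₀ :=
  ext_head2 (by simp) (by simp) (by simp)

section
variable (β : G →ₗ[K] G →ₗ[K] G) (d : G →ₗ[K] G ⊗[K] G)

theorem mu₀_lift_lift (f : Module.End K (𝐓 G)) :
    mu₀ β * lift (lift f) = lift f * mu₀ β :=
  ext_head2 (by simp) (by simp) (by simp)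

theorem del₀_lift (f : Module.End K (𝐓 G)) :
    del₀ d * lift f = lift (lift f) * del₀ d := by
  refine ext_head (by simp) fun a t => ?_
  simp [lift_lift_mul₂]

/-- Naturality of the exchange: a strand may be doubled before or after it crosses another one. -/
theorem del₀_tau₀ : del₀ d * tau₀ = lift tau₀ * tau₀ * lift (del₀ d) := by
  refine ext_head2 (by simp) (by simp) fun a b t => ?_
  simp only [Module.End.mul_apply, tau₀_cons, del₀_cons, lift_cons]
  induction d b with
  | zero => simp
  | add x y hx hy => simp only [map_add, add_mul, mul_add, hx, hy]
  | tmul x y => simp [mul_assoc]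

theorem lift_del₀_tau₀ : lift (del₀ d) * tau₀ = tau₀ * lift tau₀ * del₀ d := by
  refine ext_head2 (by simp) ?_ fun a b t => ?_
  · intro a
    simp only [Module.End.mul_apply, tau₀_ι, map_zero, del₀_ι]
    induction d a with
    | zero => simp
    | add x y hx hy => simp only [map_add]; rw [← hx, ← hy, add_zero]
    | tmul x y => simp
  · simp only [Module.End.mul_apply, tau₀_cons, del₀_cons, lift_cons]
    induction d a with
    | zero => simp
    | add x y hx hy => simp only [map_add, add_mul, mul_add, hx, hy]
    | tmul x y => simp [mul_assoc]

theorem tau₀_mu₀ : tau₀ * mu₀ β = lift (mu₀ β) * tau₀ * lift tau₀ := by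
  refine ext_head2 (by simp) (by simp) fun a b t => ?_
  have : (tau₀ * mu₀ β : Module.End K (𝐓 G)) ∘ₗ
      LinearMap.mulLeft K (TensorAlgebra.ι K a * TensorAlgebra.ι K b) =
      (lift (mu₀ β) * tau₀ * lift tau₀ : Module.End K (𝐓 G)) ∘ₗ
      LinearMap.mulLeft K (TensorAlgebra.ι K a * TensorAlgebra.ι K b) :=
    ext_head (by simp) (by simp [mul_assoc])
  simpa [mul_assoc] using LinearMap.congr_fun this t

theorem tau₀_lift_mu₀ : tau₀ * lift (mu₀ β) = mu₀ β * lift tau₀ * tau₀ := by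
  refine ext_head2 (by simp) (by simp) fun a b t => ?_
  have : (tau₀ * lift (mu₀ β) : Module.End K (𝐓 G)) ∘ₗ
      LinearMap.mulLeft K (TensorAlgebra.ι K a * TensorAlgebra.ι K b) =
      (mu₀ β * lift tau₀ * tau₀ : Module.End K (𝐓 G)) ∘ₗ
      LinearMap.mulLeft K (TensorAlgebra.ι K a * TensorAlgebra.ι K b) :=
    ext_head (by simp) (by simp [mul_assoc])
  simpa [mul_assoc] using LinearMap.congr_fun this t

variable {β d}

theorem mu₀_tau₀ (hβ : ∀ a b, β b a = -β a b) : mu₀ β * tau₀ = -mu₀ β :=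
  ext_head2 (by simp) (by simp) fun a b t => by
    simp only [Module.End.mul_apply, tau₀_cons, mu₀_cons, LinearMap.neg_apply, hβ a b, map_neg,
      neg_mul]

theorem tau₀_del₀ (hd : ∀ a, TensorProduct.comm K G G (d a) = -d a) :
    tau₀ * del₀ d = -del₀ d :=
  ext_head (by simp) (by simp [tau₀_mul₂, hd])

theorem mu₀_mu₀ (hβ : ∀ a b c, β (β a b) c = β a (β b c) - β b (β a c)) :
    mu₀ β * mu₀ β = mu₀ β * lift (mu₀ β) * (1 - tau₀) := by
  refine ext_head2 (by simp) (by simp) fun a b t => ?_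
  have : (mu₀ β * mu₀ β : Module.End K (𝐓 G)) ∘ₗ
      LinearMap.mulLeft K (TensorAlgebra.ι K a * TensorAlgebra.ι K b) =
      (mu₀ β * lift (mu₀ β) * (1 - tau₀) : Module.End K (𝐓 G)) ∘ₗ
      LinearMap.mulLeft K (TensorAlgebra.ι K a * TensorAlgebra.ι K b) :=
    ext_head (by simp) (by simp [mul_assoc, hβ, sub_mul])
  simpa [mul_assoc] using LinearMap.congr_fun this t

/-- The action of the first tensor factor on the product of the next two. -/
def adj (β : G →ₗ[K] G →ₗ[K] G) : Module.End K (𝐓 G) := mu₀ β + lift (mu₀ β) * tau₀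

theorem del₀_mu₀ (h : ∀ a b, mul₂ (d (β a b)) =
      adj β (TensorAlgebra.ι K a * mul₂ (d b))
      - adj β (TensorAlgebra.ι K b * mul₂ (d a))) :
    del₀ d * mu₀ β = adj β * lift (del₀ d) * (1 - tau₀) := by
  have key : ∀ (a : G) (x : G ⊗[K] G) (t : 𝐓 G),
      adj β (TensorAlgebra.ι K a * (mul₂ x * t))
        = adj β (TensorAlgebra.ι K a * mul₂ x) * t := by
    intro a x t
    induction x with
    | zero => simp
    | add x y hx hy => simp only [map_add, add_mul, mul_add, hx, hy]
    | tmul x y => simp [adj, mul_assoc, add_mul]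
  refine ext_head2 (by simp) (by simp) fun a b t => ?_
  simp only [Module.End.mul_apply, mu₀_cons, del₀_cons, LinearMap.sub_apply, Module.End.one_apply,
    tau₀_cons, map_sub, lift_cons, key, h, sub_mul]

/-- `lift tau₀` kills short tensors, so it is an involution only in degrees at least 3; the image of
the double coproduct has such degrees. -/
theorem lift_tau₀_lift_tau₀_lift_del₀_del₀ :
    lift tau₀ * (lift tau₀ * (tau₀ * (lift (del₀ d) * del₀ d))) = tau₀ * (lift (del₀ d) * del₀ d) := by
  refine ext_head (by simp) fun a t => ?_
  simp only [Module.End.mul_apply, del₀_cons]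
  induction d a with
  | zero => simp
  | add x y hx hy => simp only [map_add, add_mul, hx, hy]
  | tmul x y =>
    simp only [mul₂_tmul, mul_assoc, lift_cons, del₀_cons]
    induction d y with
    | zero => simp
    | add x y hx hy => simp only [map_add, add_mul, mul_add, hx, hy]
    | tmul x y => simp [mul_assoc]

/-- Let `z` be the coproduct iterated on the second leg. In the cyclic sum of co-Jacobi,
antisymmetry identifies one rotation of `z` with `-tau₀ z` and the other with minus the coproduct
iterated on the first leg. -/
theorem del₀_del₀ (hd : ∀ a, TensorProduct.comm K G G (d a) = -d a)
    (h : ∀ a, d.lTensor G (d a) + cyc K G (d.lTensor G (d a))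
      + cyc K G (cyc K G (d.lTensor G (d a))) = 0) :
    del₀ d * del₀ d = (1 - tau₀) * (lift (del₀ d) * del₀ d) := by
  let m₃ : G ⊗[K] (G ⊗[K] G) →ₗ[K] 𝐓 G :=
    LinearMap.mul' K (𝐓 G) ∘ₗ TensorProduct.map (TensorAlgebra.ι K) mul₂
  have hm : ∀ (z : G ⊗[K] (G ⊗[K] G)) (t : 𝐓 G),
      lift tau₀ (tau₀ (m₃ z * t)) = m₃ (cyc K G z) * t := by
    intro z t
    induction z with
    | zero => simp
    | add x y hx hy => simp only [map_add, add_mul, hx, hy]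
    | tmul x y =>
      induction y with
      | zero => simp
      | add y z hy hz => simp only [map_add, add_mul, TensorProduct.tmul_add, hy, hz]
      | tmul y z => simp [m₃, cyc, mul_assoc]
  have hdd : ∀ (x : G ⊗[K] G) (t : 𝐓 G),
      lift (del₀ d) (mul₂ x * t) = m₃ (d.lTensor G x) * t := by
    intro x t
    induction x with
    | zero => simp
    | add x y hx hy => simp only [map_add, add_mul, hx, hy]
    | tmul x y => simp [m₃, mul_assoc]
  have hJ : (lift (del₀ d) * del₀ d) + lift tau₀ * (tau₀ * (lift (del₀ d) * del₀ d))
      + lift tau₀ * (tau₀ * (lift tau₀ * (tau₀ * (lift (del₀ d) * del₀ d)))) = 0 := by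
    refine ext_head (by simp) fun a t => ?_
    simp only [LinearMap.add_apply, Module.End.mul_apply, del₀_cons, hdd, hm, ← add_mul,
      ← map_add, h]
    simp
  have ht := tau₀_del₀ hd
  have h1 : lift tau₀ * (lift (del₀ d) * del₀ d) = -(lift (del₀ d) * del₀ d) := by
    rw [← mul_assoc, ← lift_mul, ht, lift_neg, neg_op_mul]
  have h2 : lift tau₀ * (tau₀ * (lift tau₀ * (tau₀ * (lift (del₀ d) * del₀ d))))
      = -(tau₀ * (lift (del₀ d) * del₀ d)) := by
    have hb : tau₀ * (lift tau₀ * (tau₀ * (lift (del₀ d) * del₀ d)))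
        = lift tau₀ * (tau₀ * (lift tau₀ * (lift (del₀ d) * del₀ d))) := by
      simpa only [mul_assoc] using congrArg (· * (lift (del₀ d) * del₀ d)) (tau₀_braid (K := K) (G := G))
    rw [hb, h1, op_mul_neg, op_mul_neg, op_mul_neg, lift_tau₀_lift_tau₀_lift_del₀_del₀]
  have h3 : del₀ d * del₀ d = -(lift tau₀ * (tau₀ * (lift (del₀ d) * del₀ d))) := by
    rw [← neg_neg (del₀ d * del₀ d), ← op_mul_neg, ← ht, ← mul_assoc, del₀_tau₀]
    simp only [mul_assoc]
  rw [h2] at hJ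
  rw [h3]
  refine LinearMap.ext fun x => ?_
  have := LinearMap.congr_fun hJ x
  simp only [LinearMap.add_apply, LinearMap.neg_apply, LinearMap.zero_apply] at this
  simp only [LinearMap.neg_apply, Module.End.mul_apply (1 - tau₀), LinearMap.sub_apply,
    Module.End.one_apply]
  simp only [Module.End.mul_apply] at this ⊢
  rw [← sub_eq_zero, ← neg_eq_zero, ← this]
  abel

/-- The projection to the component of degree `n` of the tensor algebra. -/
def proj : ℕ → Module.End K (𝐓 G)
  | 0 => Algebra.linearMap K (𝐓 G) ∘ₗ TensorAlgebra.algebraMapInv.toLinearMap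
  | n + 1 => lift (proj n)

@[simp] theorem proj_zero_one : proj 0 (1 : 𝐓 G) = 1 := by simp [proj]
@[simp] theorem proj_zero_cons (a : G) (t : 𝐓 G) :
    proj 0 (TensorAlgebra.ι K a * t) = 0 := by simp [proj, TensorAlgebra.algebraMapInv]
theorem proj_succ (n : ℕ) : (proj (n + 1) : Module.End K (𝐓 G)) = lift (proj n) := rfl
@[simp] theorem proj_succ_one (n : ℕ) : proj (n + 1) (1 : 𝐓 G) = 0 := by simp [proj]
@[simp] theorem proj_succ_cons (n : ℕ) (a : G) (t : 𝐓 G) :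
    proj (n + 1) (TensorAlgebra.ι K a * t) = TensorAlgebra.ι K a * proj n t := by simp [proj]
@[simp] theorem proj_succ_ι (n : ℕ) (a : G) :
    proj (n + 1) (TensorAlgebra.ι K a) = TensorAlgebra.ι K a * proj n 1 := by simp [proj]

end

end Tens

end

end LieBialg

/-! ### Normal form of iterated cobrackets with a marked leg. -/

namespace LieBialg

/-- Induction on words by their leftmost generator; all the normal forms below are proved in this
way. -/
theorem adjoin_le_of_left {K S : Type*} [CommSemiring K] [Semiring S] [Algebra K S] {s : Set S}
    (N : Submodule K S) (h1 : (1 : S) ∈ N) (hl : ∀ a ∈ s, ∀ x ∈ N, a * x ∈ N) {x : S}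
    (hx : x ∈ Algebra.adjoin K s) : x ∈ N := by
  have : Algebra.adjoin K s ≤
      { carrier := {y | ∀ z ∈ N, y * z ∈ N}
        mul_mem' := fun {a b} ha hb z hz => by rw [mul_assoc]; exact ha _ (hb _ hz)
        add_mem' := fun {a b} ha hb z hz => by rw [add_mul]; exact N.add_mem (ha z hz) (hb z hz)
        algebraMap_mem' := fun r z hz => by
          rw [← Algebra.smul_def]; exact N.smul_mem r hz } :=
    Algebra.adjoin_le fun a ha z hz => hl a ha z hz
  simpa using this hx 1 h1

/-- The relations between degree projections `π`, adjacent transpositions `t` and cobrackets `d`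
acting on the tensor powers of a Lie coalgebra. -/
structure LegRelations {S : Type*} [Ring S] (π t d : ℕ → S) : Prop where
  t_π : ∀ i n, t i * π n = π n * t i
  t_π_zero : ∀ {i n}, n ≤ i + 1 → t i * π n = 0
  d_π : ∀ i n, d i * π n = π (n + 1) * d i
  d_π_zero : ∀ {i n}, n ≤ i → d i * π n = 0
  π_π : ∀ n, π n * π n = π n
  π_π_zero : ∀ {n m}, n ≠ m → π n * π m = 0
  t_t : ∀ {i n}, i + 1 < n → t i * (t i * π n) = π n
  t_comm : ∀ {i j}, i + 2 ≤ j → t i * t j = t j * t i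
  braid : ∀ i, t i * (t (i + 1) * t i) = t (i + 1) * (t i * t (i + 1))
  d_t_of_lt : ∀ {i j}, i < j → d i * t j = t (j + 1) * d i
  d_t_of_gt : ∀ {i j}, j + 2 ≤ i → d i * t j = t j * d i
  d_t_self : ∀ i, d i * t i = t (i + 1) * (t i * d (i + 1))
  d_succ_t : ∀ i, d (i + 1) * t i = t i * (t (i + 1) * d i)
  t_d : ∀ i, t i * d i = -d i
  d_d : ∀ i, d i * d i = (1 - t i) * (d (i + 1) * d i)
  d_d_of_lt : ∀ {i j}, i < j → d i * d j = d (j + 1) * d i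

namespace LegRelations

variable {K S : Type*} [Field K] [Ring S] [Algebra K S]

/-- The iterated cobracket `d (k - 1) * ⋯ * d 0`. -/
def cobr (d : ℕ → S) : ℕ → S
  | 0 => 1
  | k + 1 => d k * cobr d k

/-- The cycle `t j * ⋯ * t (j + m - 1)`. -/
def cycle (t : ℕ → S) (j : ℕ) : ℕ → S
  | 0 => 1
  | m + 1 => t j * cycle (fun i => t (i + 1)) j m

theorem cycle_succ (t : ℕ → S) (j m : ℕ) :
    cycle t j (m + 1) = t j * cycle t (j + 1) m := by
  have : ∀ (m : ℕ) (t : ℕ → S) (j : ℕ), cycle (fun i => t (i + 1)) j m = cycle t (j + 1) m := by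
    intro m
    induction m with
    | zero => intros; rfl
    | succ m ih => intro t j; simp only [cycle]; rw [ih (fun i => t (i + 1))]
  rw [cycle, this]

variable (K) in
/-- The algebra generated by the transpositions of the first `k` tensor factors. -/
def legs (t : ℕ → S) (k : ℕ) : Subalgebra K S := Algebra.adjoin K {x | ∃ i, i + 1 < k ∧ x = t i}

variable {π t d : ℕ → S}

theorem t_mem_legs {i k : ℕ} (h : i + 1 < k) : t i ∈ legs K t k :=
  Algebra.subset_adjoin ⟨i, h, rfl⟩

theorem cycle_mem_legs (j m : ℕ) : cycle t j m ∈ legs K t (j + m + 1) := by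
  induction m generalizing j with
  | zero => exact one_mem _
  | succ m ih =>
    rw [cycle_succ]
    exact mul_mem (t_mem_legs (by omega)) (by convert ih (j + 1) using 2; omega)

variable (R : LegRelations π t d)
include R

theorem t_cycle_of_lt {i j : ℕ} (h : i + 2 ≤ j) (m : ℕ) :
    t i * cycle t j m = cycle t j m * t i := by
  induction m generalizing j with
  | zero => simp [cycle]
  | succ m ih =>
    rw [cycle_succ, ← mul_assoc, R.t_comm h, mul_assoc, ih (by omega), mul_assoc]

theorem t_cycle {i j m : ℕ} (h : j ≤ i) (h' : i + 1 < j + m) :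
    t (i + 1) * cycle t j m = cycle t j m * t i := by
  induction m generalizing j with
  | zero => omega
  | succ m ih =>
    rcases h.eq_or_lt with rfl | h
    · obtain ⟨m, rfl⟩ : ∃ m', m = m' + 1 := ⟨m - 1, by omega⟩
      rw [cycle_succ, cycle_succ, mul_assoc, mul_assoc, ← R.t_cycle_of_lt le_rfl]
      simp only [← mul_assoc]
      congr 1
      simpa [mul_assoc] using (R.braid j).symm
    · rw [cycle_succ, ← mul_assoc, ← R.t_comm (by omega), mul_assoc, ih (by omega) (by omega),
        mul_assoc]

theorem d_cycle_of_lt {i j : ℕ} (h : i < j) (m : ℕ) :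
    d i * cycle t j m = cycle t (j + 1) m * d i := by
  induction m generalizing j with
  | zero => simp [cycle]
  | succ m ih =>
    rw [cycle_succ, ← mul_assoc, R.d_t_of_lt h, mul_assoc, ih (by omega), cycle_succ, mul_assoc]

/-- The strand doubled here is the one that the cycle carries from position `i + m` to position `i`,
so the cycle has to be applied twice. -/
theorem d_cycle_self (i m : ℕ) :
    d i * cycle t i m = cycle t (i + 1) m * (cycle t i m * d (i + m)) := by
  induction m generalizing i with
  | zero => simp [cycle]
  | succ m ih =>
    rw [cycle_succ t i, ← mul_assoc, R.d_t_self, mul_assoc, mul_assoc, ih (i + 1),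
      cycle_succ t (i + 1), ← mul_assoc (t i), R.t_cycle_of_lt le_rfl]
    simp only [mul_assoc]
    rw [show i + 1 + m = i + (m + 1) by omega]

/-- A strand crossed by the marked strand is doubled; the cycle then crosses one strand more. -/
theorem d_cycle_of_gt {i j m : ℕ} (h : j ≤ i) (h' : i + 1 ≤ j + m) :
    d (i + 1) * cycle t j m = cycle t j (m + 1) * d i := by
  induction m generalizing j with
  | zero => omega
  | succ m ih =>
    rcases h.eq_or_lt with rfl | h
    · rw [cycle_succ, ← mul_assoc, R.d_succ_t, mul_assoc, mul_assoc, R.d_cycle_of_lt (by omega),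
        cycle_succ, cycle_succ]
      simp only [mul_assoc]
    · rw [cycle_succ, ← mul_assoc, R.d_t_of_gt (by omega), mul_assoc, ih (by omega) (by omega),
        cycle_succ t j (m + 1), mul_assoc]

/-- Co-Jacobi at leg `i`: splitting a leg other than the innermost one gives a commutator of nested
cobrackets. -/
theorem d_cobr_self {i : ℕ} : ∀ {k : ℕ}, i < k → d i * cobr d k = (1 - t i) * cobr d (k + 1) := by
  intro k hk
  induction k with
  | zero => omega
  | succ k ih =>
    rcases (Nat.lt_succ_iff.1 hk).eq_or_lt with rfl | h
    · simp only [cobr]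
      rw [← mul_assoc, R.d_d]
      simp only [mul_assoc]
    · rw [cobr, ← mul_assoc, R.d_d_of_lt h, mul_assoc, ih h, cobr.eq_2 d (k + 1), ← mul_assoc,
        ← mul_assoc]
      congr 1
      rw [mul_sub, sub_mul, R.d_t_of_gt (by omega), mul_one, one_mul]

/-- Dual to the fact that nested Lie monomials with a fixed innermost letter span: splitting any leg
of a permuted nested cobracket is again of this form, and only the first `k + 1` legs get permuted.
-/
theorem d_legs_cobr {k : ℕ} {P : S} (hP : P ∈ legs K t k) {i : ℕ} (hi : i ≤ k) :
    ∃ P' ∈ legs K t (k + 1), d i * (P * cobr d k) = P' * cobr d (k + 1) := by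
  let M : Submodule K S := (legs K t (k + 1)).toSubmodule.map
    (LinearMap.mulRight K (cobr d (k + 1)))
  let N : Submodule K S := ⨅ i ∈ Set.Iic k,
    M.comap (LinearMap.mulLeft K (d i) ∘ₗ LinearMap.mulRight K (cobr d k))
  have hM : ∀ x ∈ legs K t (k + 1), ∀ y ∈ M, x * y ∈ M := by
    rintro x hx _ ⟨z, hz, rfl⟩
    exact ⟨x * z, Subalgebra.mul_mem _ hx hz, by simp [mul_assoc]⟩
  have hN : ∀ x, x ∈ N ↔ ∀ i ≤ k, d i * (x * cobr d k) ∈ M := by simp [N]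
  have key : P ∈ N := by
    refine adjoin_le_of_left N ?_ ?_ hP
    · rw [hN]
      intro i hi
      rw [one_mul]
      rcases hi.eq_or_lt with rfl | h
      · exact ⟨1, one_mem (legs K t _), by simp [cobr]⟩
      · rw [R.d_cobr_self h]
        exact ⟨1 - t i, sub_mem (one_mem (legs K t _)) (t_mem_legs (by omega)), rfl⟩
    · rintro _ ⟨l, hl, rfl⟩ x hx
      rw [hN] at hx ⊢
      intro i hi
      rw [mul_assoc, ← mul_assoc (d i)]
      rcases lt_trichotomy i l with h | rfl | h
      · rw [R.d_t_of_lt h, mul_assoc]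
        exact hM _ (t_mem_legs (by omega)) _ (hx i hi)
      · rw [R.d_t_self, mul_assoc, mul_assoc]
        exact hM _ (t_mem_legs (by omega)) _ (hM _ (t_mem_legs (by omega)) _ (hx _ (by omega)))
      · rcases (Nat.succ_le_of_lt h).eq_or_lt with rfl | h
        · rw [R.d_succ_t, mul_assoc, mul_assoc]
          exact hM _ (t_mem_legs (by omega)) _ (hM _ (t_mem_legs (by omega)) _ (hx _ (by omega)))
        · rw [R.d_t_of_gt h, mul_assoc]
          exact hM _ (t_mem_legs (by omega)) _ (hx i hi)
  obtain ⟨P', h1, h2⟩ := (hN P).1 key i hi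
  exact ⟨P', h1, h2.symm⟩

theorem cycle_π (j m n : ℕ) : cycle t j m * π n = π n * cycle t j m := by
  induction m generalizing j with
  | zero => simp [cycle]
  | succ m ih => rw [cycle_succ, mul_assoc, ih, ← mul_assoc, R.t_π, mul_assoc]

theorem legs_π {k : ℕ} {P : S} (hP : P ∈ legs K t k) (n : ℕ) : P * π n = π n * P := by
  refine Algebra.adjoin_induction ?_ ?_ ?_ ?_ hP
  · rintro _ ⟨i, _, rfl⟩
    exact R.t_π i n
  · exact fun r => Algebra.commutes r _
  · intro x y _ _ hx hy
    rw [add_mul, mul_add, hx, hy]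
  · intro x y _ _ hx hy
    rw [mul_assoc, hy, ← mul_assoc, hx, mul_assoc]

theorem cobr_π (k n : ℕ) : cobr d k * π n = π (n + k) * cobr d k := by
  induction k with
  | zero => simp [cobr]
  | succ k ih => rw [cobr, mul_assoc, ih, ← mul_assoc, R.d_π, mul_assoc, add_assoc]

/-- Every composite of transpositions and cobrackets, from one to `j + m + 1` factors, is a
permutation applied to the iterated cobracket; the permutation can be chosen to send the last
factor to the `j`-th one. -/
theorem exists_legs {D : S} (hD : D ∈ Algebra.adjoin K (Set.range t ∪ Set.range d)) (j m : ℕ) :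
    ∃ P ∈ legs K t (j + m),
      π (j + m + 1) * (D * π 1) = cycle t j m * (P * (cobr d (j + m) * π 1)) := by
  let M (j m : ℕ) : Submodule K S := (legs K t (j + m)).toSubmodule.map
    (LinearMap.mulLeft K (cycle t j m) ∘ₗ LinearMap.mulRight K (cobr d (j + m) * π 1))
  let N : Submodule K S := ⨅ j, ⨅ m,
    (M j m).comap (LinearMap.mulLeft K (π (j + m + 1)) ∘ₗ LinearMap.mulRight K (π 1))
  have hM : ∀ j m x, x ∈ M j m ↔ ∃ P ∈ legs K t (j + m),
      x = cycle t j m * (P * (cobr d (j + m) * π 1)) := by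
    intro j m x
    constructor
    · rintro ⟨P, h1, h2⟩
      exact ⟨P, h1, h2.symm⟩
    · rintro ⟨P, h1, h2⟩
      exact ⟨P, h1, h2.symm⟩
  have hN : ∀ x, x ∈ N ↔ ∀ j m, π (j + m + 1) * (x * π 1) ∈ M j m := by simp [N]
  suffices hDN : D ∈ N from (hM j m _).1 ((hN D).1 hDN j m)
  refine adjoin_le_of_left N ?_ ?_ hD
  · rw [hN]
    intro j m
    rw [hM, one_mul]
    rcases Nat.eq_zero_or_pos (j + m) with h | h
    · obtain ⟨rfl, rfl⟩ : j = 0 ∧ m = 0 := by omega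
      exact ⟨1, one_mem _, by simp [cycle, cobr, R.π_π]⟩
    · exact ⟨0, zero_mem _, by rw [R.π_π_zero (by omega)]; simp⟩
  · intro a ha x hx
    rw [hN] at hx ⊢
    simp only [hM] at hx ⊢
    rcases ha with ⟨i, rfl⟩ | ⟨i, rfl⟩
    · intro j m
      have e : π (j + m + 1) * (t i * x * π 1) = t i * (π (j + m + 1) * (x * π 1)) := by
        rw [mul_assoc, ← mul_assoc, ← R.t_π, mul_assoc]
      rw [e]
      rcases lt_or_ge i (j + m) with hi | hi
      swap
      · refine ⟨0, zero_mem _, ?_⟩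
        rw [← mul_assoc, R.t_π_zero (by omega)]
        simp
      rcases lt_trichotomy i j with h | rfl | h
      · rcases (Nat.succ_le_of_lt h).eq_or_lt with rfl | h
        · obtain ⟨P, hP, hx⟩ := hx i (m + 1)
          rw [show i + (m + 1) = i.succ + m by omega] at hx hP
          refine ⟨P, hP, ?_⟩
          have h1 : i.succ + m + 1 = 1 + (i.succ + m) := by omega
          -- The projection is brought in because `t i * t i` is the identity only in degrees above
          -- `i + 1`.
          have h2 : cobr d (i.succ + m) * π 1 = π (i.succ + m + 1) * (cobr d (i.succ + m) * π 1) := by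
            rw [h1, ← mul_assoc, ← R.cobr_π, mul_assoc, R.π_π]
          rw [hx, cycle_succ, h2, ← mul_assoc P, R.legs_π hP]
          simp only [mul_assoc]
          rw [← mul_assoc (cycle _ _ _) (π _), R.cycle_π, mul_assoc, ← mul_assoc (t i) (π _),
            ← mul_assoc (t i) (t i * π _), R.t_t (by omega)]
        · obtain ⟨P, hP, hx⟩ := hx j m
          refine ⟨t i * P, mul_mem (t_mem_legs (by omega)) hP, ?_⟩
          rw [hx, ← mul_assoc, R.t_cycle_of_lt h]
          simp only [mul_assoc]
      · obtain ⟨m, rfl⟩ : ∃ m', m = m' + 1 := ⟨m - 1, by omega⟩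
        obtain ⟨P, hP, hx⟩ := hx (i + 1) m
        rw [show i + 1 + m = i + (m + 1) by omega] at hx hP
        refine ⟨P, hP, ?_⟩
        rw [hx, cycle_succ t i m, mul_assoc]
      · obtain ⟨i, rfl⟩ : ∃ i', i = i' + 1 := ⟨i - 1, by omega⟩
        obtain ⟨P, hP, hx⟩ := hx j m
        refine ⟨t i * P, mul_mem (t_mem_legs (by omega)) hP, ?_⟩
        rw [hx, ← mul_assoc, R.t_cycle (by omega) (by omega)]
        simp only [mul_assoc]
    · have e : ∀ k, π (k + 1) * (d i * x * π 1) = d i * (π k * (x * π 1)) := by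
        intro k
        rw [mul_assoc, ← mul_assoc, ← R.d_π, mul_assoc]
      -- The cobracket splits leg `i` and the marked leg is not its first half; for `j = i + 1` the
      -- marked leg is the second half.
      have main : ∀ j m, j ≠ i → ∃ P ∈ legs K t (j + m),
          π (j + m + 1) * (d i * x * π 1) = cycle t j m * (P * (cobr d (j + m) * π 1)) := by
        intro j m hji
        rw [e]
        rcases lt_or_ge i (j + m) with hi | hi
        swap
        · exact ⟨0, zero_mem _, by rw [← mul_assoc, R.d_π_zero hi]; simp⟩
        rcases lt_or_gt_of_ne hji with h | h
        · obtain ⟨m, rfl⟩ : ∃ m', m = m' + 1 := ⟨m - 1, by omega⟩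
          obtain ⟨i, rfl⟩ : ∃ i', i = i' + 1 := ⟨i - 1, by omega⟩
          obtain ⟨P, hP, hx⟩ := hx j m
          obtain ⟨P', hP', hd⟩ := R.d_legs_cobr (K := K) hP (i := i) (by omega)
          refine ⟨P', hP', ?_⟩
          rw [show j + (m + 1) = j + m + 1 by omega, hx, ← mul_assoc (d _),
            R.d_cycle_of_gt (by omega) (by omega), mul_assoc, ← mul_assoc P, ← mul_assoc (d i), hd,
            mul_assoc]
        · rcases (Nat.succ_le_of_lt h).eq_or_lt with rfl | h
          · obtain ⟨P, hP, hx⟩ := hx i m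
            obtain ⟨P', hP', hd⟩ := R.d_legs_cobr (K := K) hP (i := i + m) le_rfl
            refine ⟨cycle t i m * P', mul_mem ?_ ?_, ?_⟩
            · convert cycle_mem_legs (K := K) (t := t) i m using 2; omega
            · convert hP' using 2; omega
            rw [show i.succ + m = i + m + 1 by omega, hx, ← mul_assoc (d _),
              R.d_cycle_self, ← mul_assoc P]
            simp only [mul_assoc]
            rw [← mul_assoc P, ← mul_assoc (d (i + m)), hd]
            simp only [mul_assoc]
          · obtain ⟨j, rfl⟩ : ∃ j', j = j' + 1 := ⟨j - 1, by omega⟩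
            obtain ⟨P, hP, hx⟩ := hx j m
            obtain ⟨P', hP', hd⟩ := R.d_legs_cobr (K := K) hP (i := i) (by omega)
            rw [show j + 1 + m = j + m + 1 by omega]
            refine ⟨P', hP', ?_⟩
            rw [hx, ← mul_assoc (d _), R.d_cycle_of_lt (by omega), mul_assoc, ← mul_assoc P,
              ← mul_assoc (d i), hd, mul_assoc]
      intro j m
      rcases eq_or_ne j i with rfl | h
      swap
      · exact main j m h
      rcases m with _ | m
      · exact ⟨0, zero_mem _, by rw [e, ← mul_assoc, R.d_π_zero (by omega)]; simp⟩
      · obtain ⟨P, hP, hx⟩ := main (j + 1) m (by omega)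
        rw [show j + 1 + m = j + (m + 1) by omega] at hx hP
        refine ⟨-P, neg_mem hP, ?_⟩
        -- If the marked leg is the first half of the split leg, antisymmetry exchanges the two
        -- halves and reduces to `main`.
        have : d j = -(t j * d j) := by rw [R.t_d, neg_neg]
        rw [this]
        simp only [neg_mul, mul_neg]
        rw [cycle_succ, mul_assoc (t j) (cycle _ _ _), ← hx, mul_assoc (t j)]
        simp only [← mul_assoc]
        rw [R.t_π]

end LegRelations

end LieBialg

/-! ### Operators at an arbitrary position of the tensor algebra, and their leg relations. -/

namespace LieBialg

noncomputable section

namespace Tens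

variable {K : Type u} [Field K] {G : Type u} [AddCommGroup G] [Module K G]

local notation "𝐓" => TensorAlgebra K

/-- `f` acting on all tensor factors but the first `i`. -/
def shift : ℕ → Module.End K (𝐓 G) → Module.End K (𝐓 G)
  | 0, f => f
  | i + 1, f => lift (shift i f)

@[simp] theorem shift_zero (f : Module.End K (𝐓 G)) : shift 0 f = f := rfl

theorem shift_succ (i : ℕ) (f : Module.End K (𝐓 G)) : shift (i + 1) f = lift (shift i f) := rfl

theorem shift_mul (i : ℕ) (f g : Module.End K (𝐓 G)) :
    shift i (f * g) = shift i f * shift i g := by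
  induction i with
  | zero => rfl
  | succ i ih => rw [shift_succ, ih, lift_mul]; rfl

theorem shift_neg (i : ℕ) (f : Module.End K (𝐓 G)) : shift i (-f) = -shift i f := by
  induction i with
  | zero => rfl
  | succ i ih => rw [shift_succ, ih, lift_neg]; rfl

theorem shift_sub (i : ℕ) (f g : Module.End K (𝐓 G)) :
    shift i (f - g) = shift i f - shift i g := by
  induction i with
  | zero => rfl
  | succ i ih => rw [shift_succ, ih, lift_sub]; rfl

theorem shift_add (i : ℕ) (f g : Module.End K (𝐓 G)) :
    shift i (f + g) = shift i f + shift i g := by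
  induction i with
  | zero => rfl
  | succ i ih => rw [shift_succ, ih, lift_add]; rfl

theorem shift_shift (i j : ℕ) (f : Module.End K (𝐓 G)) :
    shift i (shift j f) = shift (i + j) f := by
  induction i with
  | zero => simp
  | succ i ih => rw [shift_succ, ih, add_right_comm]; rfl

theorem shift_proj (i n : ℕ) : shift i (proj n : Module.End K (𝐓 G)) = proj (i + n) := by
  induction i with
  | zero => simp
  | succ i ih => rw [shift_succ, ih, add_right_comm]; rfl

theorem lift_zero : lift (0 : Module.End K (𝐓 G)) = 0 := ext_head (by simp) (by simp)

theorem mul_proj_zero {f : Module.End K (𝐓 G)} (h : f 1 = 0) : f * proj 0 = 0 :=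
  ext_head (by simp [h]) (by simp)

theorem proj_zero_mul_lift (f : Module.End K (𝐓 G)) : proj 0 * lift f = 0 :=
  ext_head (by simp) (by simp)

theorem shift_one {f : Module.End K (𝐓 G)} (h : f 1 = 0) (i : ℕ) : shift i f 1 = 0 := by
  cases i <;> simp [h, shift_succ]

/-- If `f` vanishes in degrees `≤ c` then its `i`-th shift vanishes in degrees `≤ i + c`. -/
theorem shift_mul_proj {f : Module.End K (𝐓 G)} {c : ℕ} (h : ∀ n ≤ c, f * proj n = 0)
    (h1 : f 1 = 0) {i n : ℕ} (hn : n ≤ i + c) : shift i f * proj n = 0 := by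
  induction i generalizing n with
  | zero => exact h n (by omega)
  | succ i ih =>
    rcases n with _ | n
    · exact mul_proj_zero (shift_one h1 _)
    · rw [shift_succ, proj_succ, ← lift_mul, ih (by omega), lift_zero]

theorem proj_mul_shift {f : Module.End K (𝐓 G)} {c : ℕ} (h : ∀ n ≤ c, proj n * f = 0)
    {i n : ℕ} (hn : n ≤ i + c) : proj n * shift i f = 0 := by
  induction i generalizing n with
  | zero => exact h n (by omega)
  | succ i ih =>
    rcases n with _ | n
    · exact proj_zero_mul_lift _
    · rw [shift_succ, proj_succ, ← lift_mul, ih (by omega), lift_zero]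

/-- The transposition of the factors `i` and `i + 1`. -/
def tau (i : ℕ) : Module.End K (𝐓 G) := shift i tau₀

theorem tau₀_proj_le (n : ℕ) (hn : n ≤ 1) : tau₀ * (proj n : Module.End K (𝐓 G)) = 0 := by
  obtain rfl | rfl : n = 0 ∨ n = 1 := by omega
  · exact mul_proj_zero (by simp)
  · refine ext_head2 ?_ ?_ ?_ <;> simp

theorem proj_tau₀_le (n : ℕ) (hn : n ≤ 1) : proj n * (tau₀ : Module.End K (𝐓 G)) = 0 := by
  obtain rfl | rfl : n = 0 ∨ n = 1 := by omega
  · refine ext_head2 ?_ ?_ ?_ <;> simp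
  · refine ext_head2 ?_ ?_ ?_ <;> simp

theorem tau_proj_zero {i n : ℕ} (h : n ≤ i + 1) : tau i * (proj n : Module.End K (𝐓 G)) = 0 :=
  shift_mul_proj tau₀_proj_le (by simp) h

theorem proj_tau_zero {i n : ℕ} (h : n ≤ i + 1) : (proj n : Module.End K (𝐓 G)) * tau i = 0 :=
  proj_mul_shift proj_tau₀_le h

theorem tau_proj (i n : ℕ) : tau i * (proj n : Module.End K (𝐓 G)) = proj n * tau i := by
  rcases le_or_gt n (i + 1) with h | h
  · rw [tau_proj_zero h, proj_tau_zero h]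
  · obtain ⟨c, rfl⟩ : ∃ c, n = i + (c + 2) := ⟨n - i - 2, by omega⟩
    rw [← shift_proj, tau, ← shift_mul, ← shift_mul]
    exact congrArg _ (tau₀_lift_lift (proj c))

theorem tau_tau_proj {i n : ℕ} (h : i + 1 < n) :
    tau i * (tau i * (proj n : Module.End K (𝐓 G))) = proj n := by
  obtain ⟨c, rfl⟩ : ∃ c, n = i + (c + 2) := ⟨n - i - 2, by omega⟩
  rw [← shift_proj, tau, ← shift_mul, ← shift_mul]
  refine congrArg _ (ext_head2 ?_ ?_ ?_) <;> simp

theorem shift_comm {f g : Module.End K (𝐓 G)} {e : ℕ} (i : ℕ) {j c : ℕ}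
    {g' : Module.End K (𝐓 G)} (hj : j = i + c)
    (h : f * shift c g = shift e g' * f) :
    shift i f * shift j g = shift (i + e) g' * shift i f := by
  subst hj
  rw [← shift_shift, ← shift_mul, h, shift_mul, shift_shift]

theorem tau_comm {i j : ℕ} (h : i + 2 ≤ j) :
    tau i * tau j = tau j * (tau i : Module.End K (𝐓 G)) := by
  obtain ⟨c, rfl⟩ : ∃ c, j = i + (c + 2) := ⟨j - i - 2, by omega⟩
  exact shift_comm i rfl (tau₀_lift_lift _)

theorem tau_braid (i : ℕ) : tau i * (tau (i + 1) * tau i)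
    = tau (i + 1) * (tau i * (tau (i + 1) : Module.End K (𝐓 G))) := by
  rw [tau, tau, ← shift_shift i 1, ← shift_mul, ← shift_mul, ← shift_mul, ← shift_mul]
  exact congrArg _ tau₀_braid

theorem proj_proj (n : ℕ) : proj n * proj n = (proj n : Module.End K (𝐓 G)) := by
  induction n with
  | zero => exact ext_head (by simp) (by simp)
  | succ n ih => rw [proj_succ, ← lift_mul, ih]

theorem proj_proj_zero {n m : ℕ} (h : n ≠ m) : proj n * proj m = (0 : Module.End K (𝐓 G)) := by
  induction n generalizing m with
  | zero =>
    obtain ⟨m, rfl⟩ : ∃ k, m = k + 1 := ⟨m - 1, by omega⟩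
    exact proj_zero_mul_lift _
  | succ n ih =>
    rcases m with _ | m
    · exact mul_proj_zero (by simp)
    · rw [proj_succ, proj_succ, ← lift_mul, ih (by omega), lift_zero]

section
variable (β : G →ₗ[K] G →ₗ[K] G) (d : G →ₗ[K] G ⊗[K] G)

/-- A product applied to the factors `i` and `i + 1`. -/
def mu (i : ℕ) : Module.End K (𝐓 G) := shift i (mu₀ β)

/-- A coproduct applied to the `i`-th factor. -/
def del (i : ℕ) : Module.End K (𝐓 G) := shift i (del₀ d)

theorem del_proj_zero {i n : ℕ} (h : n ≤ i) : del d i * proj n = 0 := by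
  refine shift_mul_proj (c := 0) ?_ (by simp) h
  intro n hn
  obtain rfl : n = 0 := by omega
  exact mul_proj_zero (by simp)

theorem proj_del_zero {i n : ℕ} (h : n ≤ i + 1) : proj n * del d i = 0 := by
  refine proj_mul_shift (c := 1) ?_ h
  have : ∀ n ≤ 1, ∀ (x : G ⊗[K] G) (t : 𝐓 G), proj n (mul₂ x * t) = 0 := by
    intro n hn x t
    induction x with
    | zero => simp
    | add x y hx hy => simp [add_mul, hx, hy]
    | tmul a b =>
      obtain rfl | rfl : n = 0 ∨ n = 1 := by omega
      · simp [mul_assoc]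
      · simp [mul_assoc]
  exact fun n hn => ext_head (by simp) (by simp [this n hn])

theorem del_proj (i n : ℕ) : del d i * proj n = proj (n + 1) * del d i := by
  rcases le_or_gt n i with h | h
  · rw [del_proj_zero d h, proj_del_zero d (by omega)]
  · obtain ⟨c, rfl⟩ : ∃ c, n = i + (c + 1) := ⟨n - i - 1, by omega⟩
    rw [add_assoc, ← shift_proj i (c + 1), ← shift_proj i (c + 1 + 1), del, ← shift_mul, ← shift_mul]
    exact congrArg _ (del₀_lift d (proj c))

theorem mu_proj_zero {i n : ℕ} (h : n ≤ i + 1) : mu β i * proj n = 0 := by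
  refine shift_mul_proj (c := 1) ?_ (by simp) h
  intro n hn
  obtain rfl | rfl : n = 0 ∨ n = 1 := by omega
  · exact mul_proj_zero (by simp)
  · refine ext_head2 ?_ ?_ ?_ <;> simp

theorem proj_mu_zero {i n : ℕ} (h : n ≤ i) : proj n * mu β i = 0 := by
  refine proj_mul_shift (c := 0) ?_ h
  intro n hn
  obtain rfl : n = 0 := by omega
  refine ext_head2 ?_ ?_ ?_ <;> simp

theorem proj_mu (i n : ℕ) : proj n * mu β i = mu β i * proj (n + 1) := by
  rcases le_or_gt n i with h | h
  · rw [proj_mu_zero β h, mu_proj_zero β (by omega)]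
  · obtain ⟨c, rfl⟩ : ∃ c, n = i + (c + 1) := ⟨n - i - 1, by omega⟩
    rw [add_assoc, ← shift_proj i (c + 1), ← shift_proj i (c + 1 + 1), mu, ← shift_mul, ← shift_mul]
    exact congrArg _ (mu₀_lift_lift β (proj c)).symm

theorem del_shift_of_lt {i j : ℕ} (h : i < j) (f : Module.End K (𝐓 G)) :
    del d i * shift j f = shift (j + 1) f * del d i := by
  obtain ⟨c, rfl⟩ : ∃ c, j = i + (c + 1) := ⟨j - i - 1, by omega⟩
  exact shift_comm (e := c + 2) (g' := f) i rfl (del₀_lift d (shift c f))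

theorem shift_mu_of_lt {i j : ℕ} (h : i < j) (f : Module.End K (𝐓 G)) :
    shift j f * mu β i = mu β i * shift (j + 1) f := by
  obtain ⟨c, rfl⟩ : ∃ c, j = i + (c + 1) := ⟨j - i - 1, by omega⟩
  exact (shift_comm i (add_assoc _ _ _) (mu₀_lift_lift β _)).symm

theorem shift_tau_comm {i j : ℕ} (h : i + 2 ≤ j) (f : Module.End K (𝐓 G)) :
    shift j f * tau i = tau i * shift j f := by
  obtain ⟨c, rfl⟩ : ∃ c, j = i + (c + 2) := ⟨j - i - 2, by omega⟩
  exact (shift_comm i rfl (tau₀_lift_lift _)).symm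

theorem del_tau_self (i : ℕ) : del d i * tau i = tau (i + 1) * (tau i * del d (i + 1)) := by
  rw [del, del, tau, tau, ← shift_shift i 1, ← shift_shift i 1, ← shift_mul, ← shift_mul,
    ← shift_mul]
  exact congrArg _ (del₀_tau₀ d)

theorem del_succ_tau (i : ℕ) : del d (i + 1) * tau i = tau i * (tau (i + 1) * del d i) := by
  rw [del, del, tau, tau, ← shift_shift i 1, ← shift_shift i 1, ← shift_mul, ← shift_mul,
    ← shift_mul]
  exact congrArg _ (lift_del₀_tau₀ d)

theorem tau_mu_self (i : ℕ) : tau i * mu β i = mu β (i + 1) * tau i * tau (i + 1) := by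
  rw [mu, mu, tau, tau, ← shift_shift i 1, ← shift_shift i 1, ← shift_mul, ← shift_mul,
    ← shift_mul]
  exact congrArg _ (tau₀_mu₀ β)

theorem tau_mu_succ (i : ℕ) : tau i * mu β (i + 1) = mu β i * tau (i + 1) * tau i := by
  rw [mu, mu, tau, tau, ← shift_shift i 1, ← shift_shift i 1, ← shift_mul, ← shift_mul,
    ← shift_mul]
  exact congrArg _ (tau₀_lift_mu₀ β)

variable {β d}

theorem legRelations_del (hd : ∀ a, TensorProduct.comm K G G (d a) = -d a)
    (h : ∀ a, d.lTensor G (d a) + cyc K G (d.lTensor G (d a))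
      + cyc K G (cyc K G (d.lTensor G (d a))) = 0) :
    LegRelations (proj : ℕ → Module.End K (𝐓 G)) tau (del d) where
  t_π := tau_proj
  t_π_zero := tau_proj_zero
  d_π := del_proj d
  d_π_zero := del_proj_zero d
  π_π := proj_proj
  π_π_zero := proj_proj_zero
  t_t := tau_tau_proj
  t_comm := tau_comm
  braid := tau_braid
  d_t_of_lt h := del_shift_of_lt d h _
  d_t_of_gt h := shift_tau_comm h _
  d_t_self := del_tau_self d
  d_succ_t := del_succ_tau d
  t_d i := by
    refine (shift_mul i tau₀ (del₀ d)).symm.trans ?_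
    rw [tau₀_del₀ hd, shift_neg]; rfl
  d_d i := by
    have e : (1 - tau₀) * (lift (del₀ d) * del₀ d)
        = lift (del₀ d) * del₀ d - tau₀ * (lift (del₀ d) * del₀ d) := rfl
    refine (shift_mul i (del₀ d) (del₀ d)).symm.trans
      ((congrArg (shift i) ((del₀_del₀ hd h).trans e)).trans ?_)
    rw [shift_sub, shift_mul, shift_mul, shift_mul]
    rw [show shift i (lift (del₀ d)) = del d (i + 1) from shift_shift i 1 _]
    rfl
  d_d_of_lt h := del_shift_of_lt d h _

/-- Brackets compose in the order opposite to cobrackets. In the opposite ring Jacobi takes the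
shape of co-Jacobi, so one normal form theorem serves both sides. -/
theorem legRelations_mu (hβ : ∀ a b, β b a = -β a b)
    (h : ∀ a b c, β (β a b) c = β a (β b c) - β b (β a c)) :
    LegRelations (fun n => MulOpposite.op (proj n : Module.End K (𝐓 G)))
      (fun i => MulOpposite.op (tau i)) (fun i => MulOpposite.op (mu β i)) where
  t_π i n := congrArg MulOpposite.op (tau_proj i n).symm
  t_π_zero h := congrArg MulOpposite.op (proj_tau_zero h)
  d_π i n := congrArg MulOpposite.op (proj_mu β i n)
  d_π_zero h := congrArg MulOpposite.op (proj_mu_zero β h)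
  π_π n := congrArg MulOpposite.op (proj_proj n)
  π_π_zero h := congrArg MulOpposite.op (proj_proj_zero h.symm)
  t_t {i n} h := congrArg MulOpposite.op (by
    change proj n * tau i * tau i = proj n
    rw [← tau_proj, mul_assoc, ← tau_proj, tau_tau_proj h])
  t_comm h := congrArg MulOpposite.op (tau_comm h).symm
  braid i := congrArg MulOpposite.op ((mul_assoc _ _ _).trans ((tau_braid i).trans (mul_assoc _ _ _).symm))
  d_t_of_lt h := congrArg MulOpposite.op (shift_mu_of_lt β h _)
  d_t_of_gt h := congrArg MulOpposite.op (shift_tau_comm h _).symm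
  d_t_self i := congrArg MulOpposite.op (tau_mu_self β i)
  d_succ_t i := congrArg MulOpposite.op (tau_mu_succ β i)
  t_d i := congrArg MulOpposite.op (by
    refine (shift_mul i (mu₀ β) tau₀).symm.trans ?_
    rw [mu₀_tau₀ hβ, shift_neg]; rfl)
  d_d i := congrArg MulOpposite.op (by
    have e : mu₀ β * lift (mu₀ β) * (1 - tau₀)
        = mu₀ β * lift (mu₀ β) - mu₀ β * lift (mu₀ β) * tau₀ :=
      LinearMap.ext fun x => map_sub (mu₀ β * lift (mu₀ β)) x (tau₀ x)
    have e' : mu β i * mu β (i + 1) * (1 - tau i)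
        = mu β i * mu β (i + 1) - mu β i * mu β (i + 1) * tau i :=
      LinearMap.ext fun x => map_sub (mu β i * mu β (i + 1)) x (tau i x)
    refine (shift_mul i (mu₀ β) (mu₀ β)).symm.trans
      ((congrArg (shift i) ((mu₀_mu₀ h).trans e)).trans ?_)
    refine Eq.trans ?_ e'.symm
    rw [shift_sub, shift_mul, shift_mul, shift_mul]
    rw [show shift i (lift (mu₀ β)) = mu β (i + 1) from shift_shift i 1 _]
    rfl)
  d_d_of_lt h := congrArg MulOpposite.op (shift_mu_of_lt β h _)

end
end Tens
end
end LieBialg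

/-! ### Families of operators over all Lie bialgebras; brackets to the left of cobrackets. -/

namespace LieBialg

noncomputable section

namespace LBA

variable {K : Type u} [Field K] (A : LBA K)

/-- The bracket of a Lie bialgebra, as a bilinear map. -/
def br : A →ₗ[K] A →ₗ[K] A := (LieModule.toEnd K A A : A →ₗ[K] Module.End K A)

@[simp] theorem br_apply (x y : A) : A.br x y = ⁅x, y⁆ := rfl

theorem br_antisymm (x y : A) : A.br y x = -A.br x y := by simp

theorem br_jacobi (x y z : A) : A.br (A.br x y) z = A.br x (A.br y z) - A.br y (A.br x z) := by
  simp

end LBA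

namespace Tens

variable {K : Type u} [Field K] (A : LBA K)

theorem legRelations_cobracket :
    LegRelations (proj : ℕ → Module.End K (TensorAlgebra K A)) tau (del A.cobracket) :=
  legRelations_del A.antisymm A.coJacobi

theorem legRelations_bracket :
    LegRelations (fun n => MulOpposite.op (proj n : Module.End K (TensorAlgebra K A)))
      (fun i => MulOpposite.op (tau i)) (fun i => MulOpposite.op (mu A.br i)) :=
  legRelations_mu A.br_antisymm A.br_jacobi

theorem adj_mul₂ (x : A) (z : A ⊗[K] A) :
    adj A.br (TensorAlgebra.ι K x * mul₂ z) = mul₂ ⁅x, z⁆ := by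
  induction z with
  | zero => simp
  | add y z hy hz => simp only [map_add, mul_add, hy, hz, lie_add]
  | tmul y z => simp [adj, TensorProduct.LieModule.lie_tmul_right]

theorem del₀_mu₀_lba : del₀ A.cobracket * mu₀ A.br
    = adj A.br * lift (del₀ A.cobracket) * (1 - tau₀) :=
  del₀_mu₀ fun a b => by rw [adj_mul₂, adj_mul₂, LBA.br_apply, A.cocycle, map_sub]

/-- The cocycle identity. The exchange of the two arguments is moved past the cobracket by
`lift_del₀_tau₀`, so that cobrackets stand rightmost in every term. -/
theorem del_mu_self (i : ℕ) : del A.cobracket i * mu A.br i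
    = (mu A.br i + mu A.br (i + 1) * tau i) *
      (del A.cobracket (i + 1) - tau i * (tau (i + 1) * del A.cobracket i)) := by
  have e : del₀ A.cobracket * mu₀ A.br = (mu₀ A.br + lift (mu₀ A.br) * tau₀) *
      (lift (del₀ A.cobracket) - tau₀ * (lift tau₀ * del₀ A.cobracket)) := by
    rw [del₀_mu₀_lba, ← mul_assoc tau₀, ← lift_del₀_tau₀]
    refine LinearMap.ext fun x => congrArg (adj A.br) ?_
    exact map_sub (lift (del₀ A.cobracket)) x (tau₀ x)
  have := congrArg (shift i) e
  rw [shift_mul, shift_mul, shift_add, shift_sub, shift_mul, shift_mul, shift_mul] at this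
  rw [show shift i (lift (mu₀ A.br)) = mu A.br (i + 1) from shift_shift i 1 _,
    show shift i (lift (del₀ A.cobracket)) = del A.cobracket (i + 1) from shift_shift i 1 _,
    show shift i (lift (tau₀ : Module.End K (TensorAlgebra K A))) = tau (i + 1)
      from shift_shift i 1 _] at this
  exact this

end Tens

/-- The relations of the operators `t`, `m`, `d` (transpositions, brackets, cobrackets) which allow
to move all cobrackets to the right of all brackets. -/
structure SwapRelations {S : Type*} [Ring S] (t m d : ℕ → S) : Prop where
  d_t_of_lt : ∀ {i j}, i < j → d i * t j = t (j + 1) * d i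
  d_t_of_gt : ∀ {i j}, j + 2 ≤ i → d i * t j = t j * d i
  d_t_self : ∀ i, d i * t i = t (i + 1) * (t i * d (i + 1))
  d_succ_t : ∀ i, d (i + 1) * t i = t i * (t (i + 1) * d i)
  d_m_of_lt : ∀ {i j}, i < j → d i * m j = m (j + 1) * d i
  d_m_of_gt : ∀ {i j}, j < i → d i * m j = m j * d (i + 1)
  d_m_self : ∀ i, d i * m i = (m i + m (i + 1) * t i) * (d (i + 1) - t i * (t (i + 1) * d i))

namespace SwapRelations

variable {K S : Type*} [Field K] [Ring S] [Algebra K S] {t m d : ℕ → S}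

/-- Every relation leaves exactly one cobracket in each term, so the span of the `d i` suffices on
the right and the induction on `U` closes. -/
theorem d_mul (R : SwapRelations t m d) {U : S}
    (hU : U ∈ Algebra.adjoin K (Set.range t ∪ Set.range m)) (i : ℕ) :
    d i * U ∈ (Algebra.adjoin K (Set.range t ∪ Set.range m)).toSubmodule *
      Submodule.span K (Set.range d) := by
  set B := Algebra.adjoin K (Set.range t ∪ Set.range m) with hB
  set M := B.toSubmodule * Submodule.span K (Set.range d) with hM
  have ht : ∀ i, t i ∈ B := fun i => Algebra.subset_adjoin (Or.inl ⟨i, rfl⟩)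
  have hm : ∀ i, m i ∈ B := fun i => Algebra.subset_adjoin (Or.inr ⟨i, rfl⟩)
  have hBM : ∀ x ∈ B, ∀ y ∈ M, x * y ∈ M := by
    intro x hx y hy
    have : x * y ∈ B.toSubmodule * M := Submodule.mul_mem_mul hx hy
    rwa [hM, ← mul_assoc, (Subalgebra.isIdempotentElem_toSubmodule _).eq] at this
  let N : Submodule K S := ⨅ i, M.comap (LinearMap.mulLeft K (d i))
  have hN : ∀ x, x ∈ N ↔ ∀ i, d i * x ∈ M := by simp [N]
  refine (hN U).1 (adjoin_le_of_left N ?_ ?_ hU) i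
  · rw [hN]
    intro i
    rw [mul_one, ← one_mul (d i)]
    exact Submodule.mul_mem_mul (one_mem B) (Submodule.subset_span ⟨i, rfl⟩)
  · intro a ha x hx
    rw [hN] at hx ⊢
    intro i
    rw [← mul_assoc]
    rcases ha with ⟨j, rfl⟩ | ⟨j, rfl⟩
    · rcases lt_trichotomy i j with h | rfl | h
      · rw [R.d_t_of_lt h, mul_assoc]
        exact hBM _ (ht _) _ (hx _)
      · rw [R.d_t_self, mul_assoc, mul_assoc]
        exact hBM _ (ht _) _ (hBM _ (ht _) _ (hx _))
      · rcases (Nat.succ_le_of_lt h).eq_or_lt with rfl | h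
        · rw [R.d_succ_t, mul_assoc, mul_assoc]
          exact hBM _ (ht _) _ (hBM _ (ht _) _ (hx _))
        · rw [R.d_t_of_gt h, mul_assoc]
          exact hBM _ (ht _) _ (hx _)
    · rcases lt_trichotomy i j with h | rfl | h
      · rw [R.d_m_of_lt h, mul_assoc]
        exact hBM _ (hm _) _ (hx _)
      · rw [R.d_m_self, mul_assoc, sub_mul, mul_assoc, mul_assoc]
        exact hBM _ (add_mem (hm _) (mul_mem (hm _) (ht _))) _
          (M.sub_mem (hx _) (hBM _ (ht _) _ (hBM _ (ht _) _ (hx _))))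
      · rw [R.d_m_of_gt h, mul_assoc]
        exact hBM _ (hm _) _ (hx _)

/-- All brackets can be moved to the left of all cobrackets. -/
theorem mem_mul (R : SwapRelations t m d) {F : S}
    (hF : F ∈ Algebra.adjoin K (Set.range t ∪ Set.range m ∪ Set.range d)) :
    F ∈ (Algebra.adjoin K (Set.range t ∪ Set.range m)).toSubmodule *
      (Algebra.adjoin K (Set.range t ∪ Set.range d)).toSubmodule := by
  set B := Algebra.adjoin K (Set.range t ∪ Set.range m) with hB
  set D := Algebra.adjoin K (Set.range t ∪ Set.range d) with hD
  refine adjoin_le_of_left _ ?_ ?_ hF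
  · rw [← one_mul (1 : S)]
    exact Submodule.mul_mem_mul (one_mem B) (one_mem D)
  · rintro a (ha | ⟨i, rfl⟩) x hx
    · have : a * x ∈ B.toSubmodule * (B.toSubmodule * D.toSubmodule) :=
        Submodule.mul_mem_mul (Algebra.subset_adjoin ha) hx
      rwa [← mul_assoc, (Subalgebra.isIdempotentElem_toSubmodule _).eq] at this
    · refine Submodule.mul_induction_on hx ?_ ?_
      · intro U hU V hV
        rw [← mul_assoc]
        have h1 : d i * U * V ∈ B.toSubmodule * Submodule.span K (Set.range d) * D.toSubmodule :=
          Submodule.mul_mem_mul (R.d_mul hU i) hV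
        rw [mul_assoc] at h1
        have h2 : Submodule.span K (Set.range d) ≤ D.toSubmodule :=
          Submodule.span_le.2 (Set.subset_union_right.trans Algebra.subset_adjoin)
        have h3 : Submodule.span K (Set.range d) * D.toSubmodule ≤ D.toSubmodule :=
          (mul_le_mul_left h2 _).trans (Subalgebra.isIdempotentElem_toSubmodule _).eq.le
        exact mul_le_mul_right h3 _ h1
      · intro x y hx hy
        rw [mul_add]
        exact add_mem hx hy

end SwapRelations

/-- Families of endomorphisms of the tensor algebras of all Lie bialgebras. -/
def Fam (K : Type u) [Field K] : Type (u + 1) :=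
  ∀ A : LBA K, Module.End K (TensorAlgebra K A)

namespace Fam

variable {K : Type u} [Field K]

instance : Ring (Fam K) :=
  inferInstanceAs (Ring (∀ A : LBA K, Module.End K (TensorAlgebra K A)))

instance : Algebra K (Fam K) :=
  inferInstanceAs (Algebra K (∀ A : LBA K, Module.End K (TensorAlgebra K A)))

/-- The value at a Lie bialgebra. -/
def ev (A : LBA K) : Fam K →ₐ[K] Module.End K (TensorAlgebra K A) :=
  Pi.evalAlgHom K (fun A : LBA K => Module.End K (TensorAlgebra K A)) A

theorem ext {F F' : Fam K} (h : ∀ A, ev A F = ev A F') : F = F' := funext h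

def π (n : ℕ) : Fam K := fun _ => Tens.proj n
def t (i : ℕ) : Fam K := fun _ => Tens.tau i
def d (i : ℕ) : Fam K := fun A => Tens.del A.cobracket i
def m (i : ℕ) : Fam K := fun A => Tens.mu A.br i

@[simp] theorem ev_π (A : LBA K) (n : ℕ) : ev A (π n) = Tens.proj n := rfl
@[simp] theorem ev_t (A : LBA K) (n : ℕ) : ev A (t n) = Tens.tau n := rfl
@[simp] theorem ev_d (A : LBA K) (n : ℕ) : ev A (d n) = Tens.del A.cobracket n := rfl
@[simp] theorem ev_m (A : LBA K) (n : ℕ) : ev A (m n) = Tens.mu A.br n := rfl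

theorem legRelations_d : LegRelations (π : ℕ → Fam K) t d where
  t_π i n := funext fun A => (Tens.legRelations_cobracket A).t_π i n
  t_π_zero h := funext fun A => (Tens.legRelations_cobracket A).t_π_zero h
  d_π i n := funext fun A => (Tens.legRelations_cobracket A).d_π i n
  d_π_zero h := funext fun A => (Tens.legRelations_cobracket A).d_π_zero h
  π_π n := funext fun A => (Tens.legRelations_cobracket A).π_π n
  π_π_zero h := funext fun A => (Tens.legRelations_cobracket A).π_π_zero h
  t_t h := funext fun A => (Tens.legRelations_cobracket A).t_t h
  t_comm h := funext fun A => (Tens.legRelations_cobracket A).t_comm h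
  braid i := funext fun A => (Tens.legRelations_cobracket A).braid i
  d_t_of_lt h := funext fun A => (Tens.legRelations_cobracket A).d_t_of_lt h
  d_t_of_gt h := funext fun A => (Tens.legRelations_cobracket A).d_t_of_gt h
  d_t_self i := funext fun A => (Tens.legRelations_cobracket A).d_t_self i
  d_succ_t i := funext fun A => (Tens.legRelations_cobracket A).d_succ_t i
  t_d i := funext fun A => (Tens.legRelations_cobracket A).t_d i
  d_d i := funext fun A => (Tens.legRelations_cobracket A).d_d i
  d_d_of_lt h := funext fun A => (Tens.legRelations_cobracket A).d_d_of_lt h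

theorem op_ext {F F' : Fam K}
    (h : ∀ A, MulOpposite.op (ev A F) = MulOpposite.op (ev A F')) :
    MulOpposite.op F = MulOpposite.op F' :=
  congrArg _ (funext fun A => MulOpposite.op_injective (h A))

theorem legRelations_m : LegRelations (fun n => MulOpposite.op (π n : Fam K))
    (fun n => MulOpposite.op (t n)) (fun n => MulOpposite.op (m n)) where
  t_π i n := op_ext fun A => (Tens.legRelations_bracket A).t_π i n
  t_π_zero h := op_ext fun A => (Tens.legRelations_bracket A).t_π_zero h
  d_π i n := op_ext fun A => (Tens.legRelations_bracket A).d_π i n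
  d_π_zero h := op_ext fun A => (Tens.legRelations_bracket A).d_π_zero h
  π_π n := op_ext fun A => (Tens.legRelations_bracket A).π_π n
  π_π_zero h := op_ext fun A => (Tens.legRelations_bracket A).π_π_zero h
  t_t h := op_ext fun A => (Tens.legRelations_bracket A).t_t h
  t_comm h := op_ext fun A => (Tens.legRelations_bracket A).t_comm h
  braid i := op_ext fun A => (Tens.legRelations_bracket A).braid i
  d_t_of_lt h := op_ext fun A => (Tens.legRelations_bracket A).d_t_of_lt h
  d_t_of_gt h := op_ext fun A => (Tens.legRelations_bracket A).d_t_of_gt h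
  d_t_self i := op_ext fun A => (Tens.legRelations_bracket A).d_t_self i
  d_succ_t i := op_ext fun A => (Tens.legRelations_bracket A).d_succ_t i
  t_d i := op_ext fun A => (Tens.legRelations_bracket A).t_d i
  d_d i := op_ext fun A => (Tens.legRelations_bracket A).d_d i
  d_d_of_lt h := op_ext fun A => (Tens.legRelations_bracket A).d_d_of_lt h

theorem swapRelations : SwapRelations (t : ℕ → Fam K) m d where
  d_t_of_lt := legRelations_d.d_t_of_lt
  d_t_of_gt := legRelations_d.d_t_of_gt
  d_t_self := legRelations_d.d_t_self
  d_succ_t := legRelations_d.d_succ_t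
  d_m_of_lt h := funext fun A => Tens.del_shift_of_lt A.cobracket h _
  d_m_of_gt h := funext fun A => Tens.shift_mu_of_lt A.br h _
  d_m_self i := funext fun A => Tens.del_mu_self A i

end Fam

end

end LieBialg

/-! ### Universal families as words in transpositions, brackets and cobrackets. -/

namespace LieBialg

noncomputable section

namespace Fam

variable {K : Type u} [Field K]

open TensorPower (toTensorAlgebra)

variable (K) in
/-- The algebra generated by all transpositions, brackets and cobrackets. -/
def words : Subalgebra K (Fam K) := Algebra.adjoin K (Set.range t ∪ Set.range m ∪ Set.range d)

theorem t_mem_words (i : ℕ) : t i ∈ words K := Algebra.subset_adjoin (Or.inl (Or.inl ⟨i, rfl⟩))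
theorem m_mem_words (i : ℕ) : m i ∈ words K := Algebra.subset_adjoin (Or.inl (Or.inr ⟨i, rfl⟩))
theorem d_mem_words (i : ℕ) : d i ∈ words K := Algebra.subset_adjoin (Or.inr ⟨i, rfl⟩)

/-- Raising all indices of a word by one lets it act past the first letter; this provides the
external tensor products. -/
theorem exists_lift {F : Fam K} (hF : F ∈ words K) :
    ∃ F' ∈ words K, ∀ (A : LBA K) (a : A) (s : TensorAlgebra K A),
      ev A F' (TensorAlgebra.ι K a * s) = TensorAlgebra.ι K a * ev A F s := by
  refine Algebra.adjoin_induction ?_ ?_ ?_ ?_ hF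
  · rintro _ ((⟨i, rfl⟩ | ⟨i, rfl⟩) | ⟨i, rfl⟩)
    · exact ⟨t (i + 1), t_mem_words _, fun A a s => Tens.lift_cons _ _ _⟩
    · exact ⟨m (i + 1), m_mem_words _, fun A a s => Tens.lift_cons _ _ _⟩
    · exact ⟨d (i + 1), d_mem_words _, fun A a s => Tens.lift_cons _ _ _⟩
  · intro r
    refine ⟨algebraMap K _ r, Subalgebra.algebraMap_mem _ _, fun A a s => ?_⟩
    rw [AlgHom.commutes, Module.algebraMap_end_apply, Module.algebraMap_end_apply, mul_smul_comm]
  · rintro x y _ _ ⟨x', hx, ex⟩ ⟨y', hy, ey⟩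
    refine ⟨x' + y', add_mem hx hy, fun A a s => ?_⟩
    rw [map_add, map_add, LinearMap.add_apply, LinearMap.add_apply, ex, ey, mul_add]
  · rintro x y _ _ ⟨x', hx, ex⟩ ⟨y', hy, ey⟩
    refine ⟨x' * y', mul_mem hx hy, fun A a s => ?_⟩
    rw [map_mul (ev A), map_mul (ev A), Module.End.mul_apply, Module.End.mul_apply, ey, ex]

theorem toTensorAlgebra_cons {A : LBA K} {n : ℕ} (v : Fin (n + 1) → A) :
    toTensorAlgebra (PiTensorProduct.tprod K v)
      = TensorAlgebra.ι K (v 0) * toTensorAlgebra (PiTensorProduct.tprod K fun i => v i.succ) := by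
  simp [TensorAlgebra.tprod_apply, List.ofFn_succ]

theorem tensorPower_induction {A : LBA K} {n : ℕ} {p : (⨂[K]^n A) → Prop}
    (h : ∀ v : Fin n → A, p (PiTensorProduct.tprod K v))
    (hs : ∀ (r : K) x, p x → p (r • x)) (ha : ∀ x y, p x → p y → p (x + y)) (x : ⨂[K]^n A) :
    p x :=
  PiTensorProduct.induction_on x (fun r v => hs r _ (h v)) ha

theorem exists_shift {F : Fam K} (hF : F ∈ words K) (n : ℕ) :
    ∃ F' ∈ words K, ∀ (A : LBA K) (x : ⨂[K]^n A) (s : TensorAlgebra K A),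
      ev A F' (toTensorAlgebra x * s) = toTensorAlgebra x * ev A F s := by
  induction n with
  | zero =>
    refine ⟨F, hF, fun A x s => ?_⟩
    induction x using tensorPower_induction with
    | h v => simp [TensorAlgebra.tprod_apply]
    | hs r x hx => simp [hx]
    | ha x y hx hy => simp [add_mul, hx, hy]
  | succ n ih =>
    obtain ⟨F₁, h1, e1⟩ := ih
    obtain ⟨F₂, h2, e2⟩ := exists_lift h1
    refine ⟨F₂, h2, fun A x s => ?_⟩
    induction x using tensorPower_induction with
    | h v => rw [toTensorAlgebra_cons, mul_assoc, e2, e1, mul_assoc]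
    | hs r x hx => simp only [map_smul, smul_mul_assoc, hx]
    | ha x y hx hy => simp only [map_add, add_mul, hx, hy]

/-- The families represented by an element of `words K`. -/
def Represented {n m : ℕ} (f : Family K n m) : Prop :=
  ∃ F ∈ words K, ∀ (A : LBA K) (x : ⨂[K]^n A) (s : TensorAlgebra K A),
    ev A F (toTensorAlgebra x * s) = toTensorAlgebra (f A x) * s

theorem Represented.comp {n m p : ℕ} {g : Family K m p} {f : Family K n m}
    (hg : Represented g) (hf : Represented f) : Represented fun A => g A ∘ₗ f A := by
  obtain ⟨F, hF, eF⟩ := hf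
  obtain ⟨F', hF', eF'⟩ := hg
  refine ⟨F' * F, mul_mem hF' hF, fun A x s => ?_⟩
  rw [map_mul (ev A), Module.End.mul_apply, eF, eF', LinearMap.comp_apply]

theorem tau_tprod {A : LBA K} {n : ℕ} (i : Fin n) (v : Fin (n + 1) → A) (s : TensorAlgebra K A) :
    Tens.tau i (toTensorAlgebra (PiTensorProduct.tprod K v) * s) =
      toTensorAlgebra (PiTensorProduct.tprod K
        fun j => v (Equiv.swap i.castSucc i.succ j)) * s := by
  induction n with
  | zero => exact i.elim0
  | succ n ih =>
    cases i using Fin.cases with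
    | zero =>
      rw [toTensorAlgebra_cons, toTensorAlgebra_cons, toTensorAlgebra_cons, toTensorAlgebra_cons]
      simp only [Fin.val_zero, mul_assoc]
      refine (Tens.tau₀_cons _ _ _).trans ?_
      have : ∀ j : Fin n, Equiv.swap (0 : Fin (n + 2)) 1 j.succ.succ = j.succ.succ := fun j =>
        Equiv.swap_apply_of_ne_of_ne (Fin.succ_ne_zero _)
          (fun h => Fin.succ_ne_zero j (Fin.succ_injective _ h))
      simp [this]
    | succ i =>
      rw [toTensorAlgebra_cons v, toTensorAlgebra_cons fun j => v (Equiv.swap _ _ j), mul_assoc,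
        mul_assoc]
      refine (Tens.lift_cons _ _ _).trans ?_
      refine congrArg₂ _ ?_ ((ih i _).trans ?_)
      · rw [Equiv.swap_apply_of_ne_of_ne]
        · exact (Fin.succ_ne_zero i.castSucc).symm
        · exact (Fin.succ_ne_zero _).symm
      · have : ∀ j, Equiv.swap i.succ.castSucc i.succ.succ j.succ
            = (Equiv.swap i.castSucc i.succ j).succ := fun j => by
          rw [← Fin.succ_castSucc]
          exact ((Fin.succ_injective _).swap_apply _ _ _)
        simp only [this]

/-- Adjacent transpositions generate the symmetric group. -/
theorem exists_perm {n : ℕ} (σ : Equiv.Perm (Fin n)) :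
    ∃ F ∈ words K, ∀ (A : LBA K) (v : Fin n → A) (s : TensorAlgebra K A),
      ev A F (toTensorAlgebra (PiTensorProduct.tprod K v) * s)
        = toTensorAlgebra (PiTensorProduct.tprod K fun j => v (σ.symm j)) * s := by
  rcases n with _ | n
  · exact ⟨1, one_mem _, fun A v s => by rw [Subsingleton.elim σ 1]; rfl⟩
  · have hσ : σ ∈ Submonoid.closure
        (Set.range fun i : Fin n ↦ Equiv.swap i.castSucc i.succ) := by
      rw [Equiv.Perm.mclosure_swap_castSucc_succ]; trivial
    induction hσ using Submonoid.closure_induction with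
    | mem σ h =>
      obtain ⟨i, rfl⟩ := h
      refine ⟨t i, t_mem_words _, fun A v s => ?_⟩
      rw [Equiv.symm_swap]
      exact tau_tprod i v s
    | one => exact ⟨1, one_mem _, fun A v s => rfl⟩
    | mul σ τ _ _ hσ hτ =>
      obtain ⟨F, hF, eF⟩ := hσ
      obtain ⟨F', hF', eF'⟩ := hτ
      refine ⟨F * F', mul_mem hF hF', fun A v s => ?_⟩
      rw [map_mul (ev A), Module.End.mul_apply, eF', eF]
      rfl

theorem reindex_tprod_const {M : Type u} [AddCommGroup M] [Module K M] {n : ℕ}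
    (σ : Equiv.Perm (Fin n)) (v : Fin n → M) :
    PiTensorProduct.reindex K (fun _ : Fin n => M) σ (PiTensorProduct.tprod K v)
      = PiTensorProduct.tprod K fun j => v (σ.symm j) :=
  PiTensorProduct.reindex_tprod σ v

theorem represented_reindex {n : ℕ} (σ : Equiv.Perm (Fin n)) :
    Represented fun A : LBA K =>
      (PiTensorProduct.reindex K (fun _ : Fin n => (A : Type u)) σ).toLinearMap := by
  obtain ⟨F, hF, e⟩ := exists_perm (K := K) σ
  refine ⟨F, hF, fun A x s => ?_⟩
  induction x using tensorPower_induction with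
  | h v =>
    rw [e, ← reindex_tprod_const]
    rfl
  | hs r x hx => rw [map_smul, smul_mul_assoc, map_smul, hx, map_smul, map_smul, smul_mul_assoc]
  | ha x y hx hy => rw [map_add, add_mul, map_add, hx, hy, map_add, map_add, add_mul]

theorem toTensorAlgebra_powOne_symm {A : LBA K} (a : A) :
    toTensorAlgebra ((powOne A).symm a) = TensorAlgebra.ι K a := by
  simp [powOne, TensorAlgebra.tprod_apply]

theorem toTensorAlgebra_mulEquiv {A : LBA K} {i j : ℕ} (a : ⨂[K]^i A) (b : ⨂[K]^j A) :
    toTensorAlgebra (R := K) (M := A) (TensorPower.mulEquiv (a ⊗ₜ[K] b))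
      = toTensorAlgebra a * toTensorAlgebra b :=
  TensorPower.toTensorAlgebra_gMul a b

theorem toTensorAlgebra_powTwo_symm {A : LBA K} (z : A ⊗[K] A) :
    toTensorAlgebra ((powTwo A).symm z) = Tens.mul₂ z := by
  induction z with
  | zero => simp
  | add x y hx hy => simp only [map_add, hx, hy]
  | tmul a b =>
    have : (powTwo A).symm (a ⊗ₜ[K] b)
        = TensorPower.mulEquiv ((powOne A).symm a ⊗ₜ[K] (powOne A).symm b) := by
      simp [powTwo]
    rw [this, Tens.mul₂_tmul, ← toTensorAlgebra_powOne_symm, ← toTensorAlgebra_powOne_symm]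
    exact toTensorAlgebra_mulEquiv ((powOne A).symm a) ((powOne A).symm b)

theorem _root_.LieBialg.Universal.represented {n m : ℕ} {f : Family K n m}
    (hf : Universal K n m f) : Represented f := by
  induction hf with
  | ident => exact ⟨1, one_mem _, fun A x s => by rw [map_one]; rfl⟩
  | bracket =>
    refine ⟨Fam.m 0, m_mem_words _, fun A x s => ?_⟩
    obtain ⟨y, rfl⟩ := (powTwo A).symm.surjective x
    simp only [LinearMap.comp_apply, LinearEquiv.coe_coe, LinearEquiv.apply_symm_apply,
      toTensorAlgebra_powOne_symm, toTensorAlgebra_powTwo_symm]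
    induction y with
    | zero => simp
    | add x y hx hy => simp only [map_add, add_mul, hx, hy]
    | tmul a b =>
      rw [Tens.mul₂_tmul, mul_assoc]
      exact Tens.mu₀_cons _ _ _ _
  | cobracket =>
    refine ⟨d 0, d_mem_words _, fun A x s => ?_⟩
    obtain ⟨y, rfl⟩ := (powOne A).symm.surjective x
    simp only [LinearMap.comp_apply, LinearEquiv.coe_coe, LinearEquiv.apply_symm_apply,
      toTensorAlgebra_powOne_symm, toTensorAlgebra_powTwo_symm]
    exact Tens.del₀_cons _ _ _
  | add _ _ hf hg =>
    obtain ⟨F, hF, eF⟩ := hf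
    obtain ⟨F', hF', eF'⟩ := hg
    refine ⟨F + F', add_mem hF hF', fun A x s => ?_⟩
    rw [map_add, LinearMap.add_apply, eF, eF', LinearMap.add_apply, map_add, add_mul]
  | smul c _ hf =>
    obtain ⟨F, hF, eF⟩ := hf
    refine ⟨c • F, Subalgebra.smul_mem _ hF c, fun A x s => ?_⟩
    rw [map_smul, LinearMap.smul_apply, eF, LinearMap.smul_apply, map_smul, smul_mul_assoc]
  | comp _ _ hg hf => exact hg.comp hf
  -- The tail `s` in `Represented` is arbitrary so that it can absorb the second tensor factor:
  -- `F''` acts beyond the first `n` letters, and `F` then acts on these.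
  | @tensor n m n' m' f g _ _ hf hg =>
    obtain ⟨F, hF, eF⟩ := hf
    obtain ⟨F', hF', eF'⟩ := hg
    obtain ⟨F'', hF'', eF''⟩ := exists_shift hF' n
    refine ⟨F * F'', mul_mem hF hF'', fun A x s => ?_⟩
    obtain ⟨y, rfl⟩ := TensorPower.mulEquiv.surjective x
    simp only [LinearMap.comp_apply, LinearEquiv.coe_coe, LinearEquiv.symm_apply_apply, map_mul (ev A),
      Module.End.mul_apply]
    induction y with
    | zero => simp
    | add x y hx hy => simp only [map_add, add_mul, hx, hy]
    | tmul a b =>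
      rw [TensorProduct.map_tmul, toTensorAlgebra_mulEquiv, toTensorAlgebra_mulEquiv, mul_assoc, eF'', eF', eF, mul_assoc]
  | permSource σ _ hf => exact hf.comp (represented_reindex σ)
  | permTarget σ _ hf => exact (represented_reindex σ).comp hf

/-- A universal family of endomorphisms is the degree one part of an element of `words K`. -/
theorem _root_.LieBialg.IsUniversal.exists_words {l : EndFamily K} (hl : IsUniversal l) :
    ∃ F ∈ words K, ∀ (A : LBA K) (a : A),
      ev A F (TensorAlgebra.ι K a) = TensorAlgebra.ι K (l A a) := by
  obtain ⟨F, hF, e⟩ := Universal.represented hl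
  refine ⟨F, hF, fun A a => ?_⟩
  have := e A ((powOne A).symm a) 1
  simpa [toTensorAlgebra_powOne_symm] using this

end Fam

end

end LieBialg

/-! ### Derivations of the tensor algebra, and endomorphisms inserted between cobrackets and
brackets. -/

namespace LieBialg

noncomputable section

namespace Tens

variable {K : Type u} [Field K] {G : Type u} [AddCommGroup G] [Module K G]

local notation "𝐓" => TensorAlgebra K

/-- The endomorphism `E` acting on the first tensor factor. -/
def head (E : Module.End K G) : Module.End K (𝐓 G) :=
  headRec (LinearMap.mul K (𝐓 G) ∘ₗ TensorAlgebra.ι K ∘ₗ E)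

@[simp] theorem head_one (E : Module.End K G) : head E (1 : 𝐓 G) = 0 := by simp [head]
@[simp] theorem head_cons (E : Module.End K G) (a : G) (t : 𝐓 G) :
    head E (TensorAlgebra.ι K a * t) = TensorAlgebra.ι K (E a) * t := by simp [head]
@[simp] theorem head_ι (E : Module.End K G) (a : G) :
    head E (TensorAlgebra.ι K a) = TensorAlgebra.ι K (E a) := by
  rw [← mul_one (TensorAlgebra.ι K a), head_cons, mul_one]

/-- The representation of the tensor algebra on pairs used to define `der`. -/
def derAux (E : Module.End K G) : 𝐓 G →ₐ[K] Module.End K (𝐓 G × 𝐓 G) :=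
  TensorAlgebra.lift K
    { toFun := fun a => LinearMap.prod
        (LinearMap.mulLeft K (TensorAlgebra.ι K a) ∘ₗ LinearMap.fst K _ _)
        (LinearMap.mulLeft K (TensorAlgebra.ι K (E a)) ∘ₗ LinearMap.fst K _ _ +
          LinearMap.mulLeft K (TensorAlgebra.ι K a) ∘ₗ LinearMap.snd K _ _)
      map_add' := fun a b => by ext <;> simp [add_mul]
      map_smul' := fun r a => by ext <;> simp }

theorem derAux_fst (E : Module.End K G) (t : 𝐓 G) (x : 𝐓 G × 𝐓 G) :
    (derAux E t x).1 = t * x.1 := by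
  induction t using TensorAlgebra.induction generalizing x with
  | algebraMap r => rw [AlgHom.commutes]; simp [Algebra.smul_def]
  | ι a => simp [derAux]
  | mul s t hs ht => rw [map_mul, Module.End.mul_apply, hs, ht, mul_assoc]
  | add s t hs ht => simp [hs, ht, add_mul]

/-- The derivation of the tensor algebra extending `E`. -/
def der (E : Module.End K G) : Module.End K (𝐓 G) where
  toFun t := (derAux E t (1, 0)).2
  map_add' s t := by simp
  map_smul' r t := by simp

@[simp] theorem der_one (E : Module.End K G) : der E (1 : 𝐓 G) = 0 := by simp [der]
@[simp] theorem der_cons (E : Module.End K G) (a : G) (t : 𝐓 G) :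
    der E (TensorAlgebra.ι K a * t)
      = TensorAlgebra.ι K (E a) * t + TensorAlgebra.ι K a * der E t := by
  have h := derAux_fst E t (1, 0)
  simp only [mul_one] at h
  simp only [der, LinearMap.coe_mk, AddHom.coe_mk, map_mul, Module.End.mul_apply]
  simp [derAux] at h ⊢
  exact Or.inl h
@[simp] theorem der_ι (E : Module.End K G) (a : G) :
    der E (TensorAlgebra.ι K a) = TensorAlgebra.ι K (E a) := by
  rw [← mul_one (TensorAlgebra.ι K a), der_cons, der_one, mul_one, mul_zero, add_zero]

theorem der_eq (E : Module.End K G) : der E = head E + lift (der E) :=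
  ext_head (by simp) (by simp)

theorem head_lift (E : Module.End K G) (f : Module.End K (𝐓 G)) :
    head E * lift f = lift f * head E :=
  ext_head (by simp) (by simp)

/-- By `der_eq`, the derivation is its action on the first letter plus a lift of itself, and the
former commutes with every lift. -/
theorem der_shift (E : Module.End K G) {f : Module.End K (𝐓 G)} (h : der E * f = f * der E)
    (i : ℕ) : der E * shift i f = shift i f * der E := by
  induction i with
  | zero => exact h
  | succ i ih =>
    have h1 := congrArg lift ih
    rw [lift_mul, lift_mul] at h1
    refine LinearMap.ext fun x => ?_
    have h2 := LinearMap.congr_fun h1 x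
    have h3 := LinearMap.congr_fun (head_lift E (shift i f)) x
    simp only [Module.End.mul_apply] at h2 h3 ⊢
    rw [der_eq, LinearMap.add_apply, LinearMap.add_apply, map_add, shift_succ, h2, h3]

theorem der_tau₀ (E : Module.End K G) : der E * tau₀ = tau₀ * der E :=
  ext_head2 (by simp) (by simp) (by
    intro a b t
    simp only [Module.End.mul_apply, tau₀_cons, der_cons, map_add, mul_add]
    abel)

theorem der_mu₀ {β : G →ₗ[K] G →ₗ[K] G} {E : Module.End K G}
    (hE : ∀ a b, E (β a b) = β (E a) b + β a (E b)) : der E * mu₀ β = mu₀ β * der E :=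
  ext_head2 (by simp) (by simp) (by
    intro a b t
    simp only [Module.End.mul_apply, mu₀_cons, der_cons, map_add, mul_add, hE, add_mul]
    abel)

theorem der_mul₂ (E : Module.End K G) (x : G ⊗[K] G) (t : 𝐓 G) :
    der E (mul₂ x * t) = mul₂ ((TensorProduct.map E LinearMap.id
      + TensorProduct.map LinearMap.id E : Module.End K (G ⊗[K] G)) x) * t + mul₂ x * der E t := by
  induction x with
  | zero => simp
  | add x y hx hy => simp only [map_add, add_mul, hx, hy]; abel
  | tmul a b => simp [mul_assoc, add_mul, mul_add, add_assoc]

theorem der_del₀ {d : G →ₗ[K] G ⊗[K] G} {E : Module.End K G}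
    (hE : d ∘ₗ E = (TensorProduct.map E LinearMap.id + TensorProduct.map LinearMap.id E) ∘ₗ d) :
    der E * del₀ d = del₀ d * der E :=
  ext_head (by simp) (by
    intro a t
    have := LinearMap.congr_fun hE a
    simp only [LinearMap.comp_apply] at this
    simp only [Module.End.mul_apply, del₀_cons, der_cons, map_add, der_mul₂, this])

theorem lift_sum {ι : Type*} (s : Finset ι) (f : ι → Module.End K (𝐓 G)) :
    lift (∑ i ∈ s, f i) = ∑ i ∈ s, lift (f i) := by
  classical
  induction s using Finset.induction_on with
  | empty => simp [lift_zero]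
  | insert a s ha ih => rw [Finset.sum_insert ha, Finset.sum_insert ha, lift_add, ih]

/-- In degree `n` the derivation applies `E` to each factor in turn; this is the sum over strands
behind the factor `k + 1`. -/
theorem der_proj (E : Module.End K G) (n : ℕ) :
    der E * proj n = ∑ j ∈ Finset.range n, shift j (head E) * proj n := by
  induction n with
  | zero => exact mul_proj_zero (by simp)
  | succ n ih =>
    rw [Finset.sum_range_succ']
    have h1 : ∀ j, shift (j + 1) (head E) * proj (n + 1) = lift (shift j (head E) * proj n) :=
      fun j => (lift_mul _ _).symm
    simp only [h1]
    rw [← lift_sum, ← ih, lift_mul]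
    refine LinearMap.ext fun x => ?_
    have := LinearMap.congr_fun (der_eq E) (proj (n + 1) x)
    rw [LinearMap.add_apply] at this
    exact this.trans (add_comm _ _)

theorem shift_head_tau (E : Module.End K G) (j : ℕ) :
    shift j (head E) * tau j = tau j * shift (j + 1) (head E) := by
  rw [tau, ← shift_shift j 1, ← shift_mul, ← shift_mul]
  exact congrArg _ (ext_head2 (by simp [shift]) (by simp [shift]) (by simp [shift]))

theorem shift_head_cycle (E : Module.End K G) (j m : ℕ) :
    shift j (head E) * LegRelations.cycle tau j m
      = LegRelations.cycle tau j m * shift (j + m) (head E) := by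
  induction m generalizing j with
  | zero => rfl
  | succ m ih =>
    rw [LegRelations.cycle_succ, ← mul_assoc, shift_head_tau, mul_assoc, ih, mul_assoc,
      show j + 1 + m = j + (m + 1) by omega]

/-- The action of words in adjacent transpositions on the tensor algebra. -/
def perm : FreeAlgebra K ℕ →ₐ[K] Module.End K (𝐓 G) := FreeAlgebra.lift K tau

@[simp] theorem perm_ι (i : ℕ) : perm (FreeAlgebra.ι K i) = (tau i : Module.End K (𝐓 G)) :=
  FreeAlgebra.lift_ι_apply _ _

variable (K) in
/-- Words in the transpositions of the first `k` tensor factors. -/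
def permAlg (k : ℕ) : Subalgebra K (FreeAlgebra K ℕ) :=
  Algebra.adjoin K {x | ∃ i, i + 1 < k ∧ x = FreeAlgebra.ι K i}

theorem shift_perm {k : ℕ} {q : FreeAlgebra K ℕ} (hq : q ∈ permAlg K k)
    (f : Module.End K (𝐓 G)) : shift k f * perm q = perm q * shift k f := by
  refine Algebra.adjoin_induction ?_ ?_ ?_ ?_ hq
  · rintro _ ⟨i, hi, rfl⟩
    rw [perm_ι]
    exact shift_tau_comm (by omega) f
  · intro r
    rw [AlgHom.commutes]
    exact (Algebra.commutes r _).symm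
  · intro x y _ _ hx hy
    rw [map_add, mul_add, add_mul, hx, hy]
  · intro x y _ _ hx hy
    rw [map_mul, ← mul_assoc, hx, mul_assoc, hy, mul_assoc]

section
variable (β : G →ₗ[K] G →ₗ[K] G) (d : G →ₗ[K] G ⊗[K] G)

/-- The iterated bracket `mu 0 * ⋯ * mu (k - 1)`. -/
def iterBr : ℕ → Module.End K (𝐓 G)
  | 0 => 1
  | k + 1 => iterBr k * mu β k

/-- The composite of the iterated cobracket, of `E` applied to the last factor, of a permutation
of the other factors, and of the iterated bracket. -/
def comb (k : ℕ) (q : FreeAlgebra K ℕ) (E : Module.End K G) : Module.End K (𝐓 G) :=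
  iterBr β k * (perm q * (shift k (head E) * LegRelations.cobr (del d) k))

end

end Tens

end

end LieBialg

/-! ### Structure of universal endomorphisms. -/

namespace LieBialg

noncomputable section

namespace LegRelations

variable {K S : Type*} [Field K] [Ring S] [Algebra K S] {π t d : ℕ → S}

/-- A composite of transpositions and cobrackets starting from one factor is a finite sum of its
homogeneous components. -/
theorem exists_sum_proj (R : LegRelations π t d) {D : S}
    (hD : D ∈ Algebra.adjoin K (Set.range t ∪ Set.range d)) :
    ∃ n, ∀ N ≥ n, D * π 1 = ∑ k ∈ Finset.range N, π (k + 1) * (D * π 1) := by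
  let M : Submodule K S :=
    { carrier := {D | ∃ n, ∀ N ≥ n, D * π 1 = ∑ k ∈ Finset.range N, π (k + 1) * (D * π 1)}
      zero_mem' := ⟨0, fun N _ => by simp⟩
      add_mem' := by
        rintro x y ⟨n, hn⟩ ⟨n', hn'⟩
        refine ⟨max n n', fun N hN => ?_⟩
        simp only [add_mul, mul_add, Finset.sum_add_distrib]
        rw [← hn N (le_trans (le_max_left _ _) hN), ← hn' N (le_trans (le_max_right _ _) hN)]
      smul_mem' := by
        rintro r x ⟨n, hn⟩
        refine ⟨n, fun N hN => ?_⟩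
        simp only [smul_mul_assoc, mul_smul_comm, ← Finset.smul_sum]
        rw [← hn N hN] }
  refine adjoin_le_of_left M ⟨1, fun N hN => ?_⟩ ?_ hD
  · rw [Finset.sum_eq_single_of_mem 0 (Finset.mem_range.2 (by omega))]
    · simp [R.π_π]
    · intro k _ hk
      rw [one_mul, R.π_π_zero (by omega)]
  · rintro a (⟨i, rfl⟩ | ⟨i, rfl⟩) x ⟨n, hn⟩
    · refine ⟨n, fun N hN => ?_⟩
      rw [mul_assoc]
      simp only [← mul_assoc (π _) (t i), ← R.t_π]
      simp only [mul_assoc (t i)]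
      rw [← Finset.mul_sum, ← hn N hN]
    · refine ⟨n + 1, fun N hN => ?_⟩
      obtain ⟨N, rfl⟩ : ∃ N', N = N' + 1 := ⟨N - 1, by omega⟩
      rw [Finset.sum_range_succ', mul_assoc]
      simp only [← mul_assoc (π _) (d i), ← R.d_π]
      rw [R.d_π_zero (Nat.zero_le i)]
      simp only [mul_assoc (d i)]
      rw [← Finset.mul_sum, ← hn N (by omega), zero_mul, add_zero]

end LegRelations

open Tens

/-- The endomorphisms which are derivations and coderivations of a Lie bialgebra. -/
def IsBiderivation {K : Type u} [Field K] (A : LBA K) (E : A →ₗ[K] A) : Prop :=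
  IsDerivation A E ∧ IsCoderivation A E

namespace Fam

variable {K : Type u} [Field K]

theorem ev_cycle (A : LBA K) (j m : ℕ) :
    ev A (LegRelations.cycle t j m) = LegRelations.cycle tau j m := by
  induction m generalizing j with
  | zero => rfl
  | succ m ih => rw [LegRelations.cycle_succ, LegRelations.cycle_succ, map_mul, ih, ev_t]

theorem ev_cobr (A : LBA K) (k : ℕ) :
    ev A (LegRelations.cobr d k) = LegRelations.cobr (del A.cobracket) k := by
  induction k with
  | zero => rfl
  | succ k ih => rw [LegRelations.cobr, map_mul, ih]; rfl

theorem ev_unop_cobr (A : LBA K) (k : ℕ) :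
    ev A (MulOpposite.unop (LegRelations.cobr (fun i => MulOpposite.op (m i)) k))
      = iterBr A.br k := by
  induction k with
  | zero => rfl
  | succ k ih => rw [LegRelations.cobr, MulOpposite.unop_mul, map_mul, ih]; rfl

theorem exists_perm_of_legs {k : ℕ} {P : Fam K} (hP : P ∈ LegRelations.legs K t k) :
    ∃ q ∈ permAlg K k, ∀ A, ev A P = perm q := by
  refine Algebra.adjoin_induction ?_ ?_ ?_ ?_ hP
  · rintro _ ⟨i, hi, rfl⟩
    exact ⟨_, Algebra.subset_adjoin ⟨i, hi, rfl⟩, fun A => by simp⟩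
  · exact fun r => ⟨algebraMap _ _ r, Subalgebra.algebraMap_mem _ _, fun A => by
      rw [AlgHom.commutes, AlgHom.commutes]⟩
  · rintro x y _ _ ⟨p, hp, ep⟩ ⟨q, hq, eq⟩
    exact ⟨p + q, add_mem hp hq, fun A => by rw [map_add, map_add, ep, eq]⟩
  · rintro x y _ _ ⟨p, hp, ep⟩ ⟨q, hq, eq⟩
    exact ⟨p * q, mul_mem hp hq, fun A => by rw [map_mul, map_mul, ep, eq]⟩

theorem unop_mem_legs {k : ℕ} {P : (Fam K)ᵐᵒᵖ}
    (hP : P ∈ LegRelations.legs K (fun i => MulOpposite.op (t i)) k) :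
    MulOpposite.unop P ∈ LegRelations.legs K t k := by
  refine Algebra.adjoin_induction ?_ ?_ ?_ ?_ hP
  · rintro _ ⟨i, hi, rfl⟩
    exact LegRelations.t_mem_legs hi
  · exact fun r => Subalgebra.algebraMap_mem _ r
  · exact fun x y _ _ hx hy => add_mem hx hy
  · exact fun x y _ _ hx hy => mul_mem hy hx

theorem op_mem {s s' : Set (Fam K)} {U : Fam K} (hU : U ∈ Algebra.adjoin K (s ∪ s')) :
    MulOpposite.op U ∈ Algebra.adjoin K (MulOpposite.op '' s ∪ MulOpposite.op '' s') := by
  refine Algebra.adjoin_induction ?_ ?_ ?_ ?_ hU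
  · rintro x (hx | hx)
    · exact Algebra.subset_adjoin (Or.inl ⟨x, hx, rfl⟩)
    · exact Algebra.subset_adjoin (Or.inr ⟨x, hx, rfl⟩)
  · exact fun r => Subalgebra.algebraMap_mem _ r
  · exact fun x y _ _ hx hy => add_mem hx hy
  · exact fun x y _ _ hx hy => mul_mem hy hx

/-- The right leg form, on the side of the brackets. -/
theorem exists_legs_left {U : Fam K}
    (hU : U ∈ Algebra.adjoin K (Set.range t ∪ Set.range m)) (j n : ℕ) :
    ∃ q ∈ permAlg K (j + n), ∀ A : LBA K, (proj 1 * ev A U) * proj (j + n + 1)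
      = ((proj 1 * iterBr A.br (j + n)) * perm q) *
          ev A (MulOpposite.unop (LegRelations.cycle (fun i => MulOpposite.op (t i)) j n)) := by
  have h := op_mem hU
  rw [← Set.range_comp, ← Set.range_comp] at h
  obtain ⟨P, hP, e⟩ := legRelations_m.exists_legs h j n
  obtain ⟨q, hq, eq⟩ := exists_perm_of_legs (unop_mem_legs hP)
  refine ⟨q, hq, fun A => ?_⟩
  have := congrArg (fun F => ev A (MulOpposite.unop F)) e
  simp only [MulOpposite.unop_mul, MulOpposite.unop_op, map_mul, ev_π, eq, ev_unop_cobr] at this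
  exact this

theorem exists_legs_right {D : Fam K}
    (hD : D ∈ Algebra.adjoin K (Set.range t ∪ Set.range d)) (j n : ℕ) :
    ∃ q ∈ permAlg K (j + n), ∀ A : LBA K, proj (j + n + 1) * (ev A D * proj 1)
      = LegRelations.cycle tau j n *
          (perm q * (LegRelations.cobr (del A.cobracket) (j + n) * proj 1)) := by
  obtain ⟨P, hP, e⟩ := legRelations_d.exists_legs hD j n
  obtain ⟨q, hq, eq⟩ := exists_perm_of_legs hP
  refine ⟨q, hq, fun A => ?_⟩
  have := congrArg (ev A) e
  simp only [map_mul, ev_π, eq, ev_cobr, ev_cycle] at this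
  exact this

theorem unop_cycle_cycle (A : LBA K) (j n : ℕ) :
    ev A (MulOpposite.unop (LegRelations.cycle (fun i => MulOpposite.op (t i)) j n)) *
      (LegRelations.cycle tau j n * proj (j + n + 1)) = proj (j + n + 1) := by
  induction n generalizing j with
  | zero => rfl
  | succ n ih =>
    rw [LegRelations.cycle_succ, LegRelations.cycle_succ, MulOpposite.unop_mul, map_mul, mul_assoc,
      MulOpposite.unop_op, ev_t, mul_assoc (tau j)]
    have := ih (j + 1)
    rw [show j + 1 + n + 1 = j + (n + 1) + 1 by omega] at this
    rw [(legRelations_cobracket A).cycle_π, ← mul_assoc (tau j) (proj _),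
      ← mul_assoc (tau j) (tau j * proj _), (legRelations_cobracket A).t_t (by omega),
      ← (legRelations_cobracket A).cycle_π, this]

end Fam

namespace Tens

variable {K : Type u} [Field K] {G : Type u} [AddCommGroup G] [Module K G]

theorem perm_comm {f : Module.End K (TensorAlgebra K G)} (h : ∀ i, f * tau i = tau i * f)
    (q : FreeAlgebra K ℕ) : f * perm q = perm q * f := by
  induction q using FreeAlgebra.induction with
  | grade0 r => rw [AlgHom.commutes]; exact (Algebra.commutes r _).symm
  | grade1 i => rw [perm_ι, h]
  | mul x y hx hy => rw [map_mul, ← mul_assoc, hx, mul_assoc, hy, mul_assoc]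
  | add x y hx hy => rw [map_add, mul_add, add_mul, hx, hy]

theorem shift_proj_comm {f : Module.End K (TensorAlgebra K G)}
    (h : ∀ n, f * proj n = proj n * f) (h1 : f 1 = 0) (j n : ℕ) :
    shift j f * proj n = proj n * shift j f := by
  induction j generalizing n with
  | zero => exact h n
  | succ j ih =>
    rcases n with _ | n
    · rw [mul_proj_zero (shift_one h1 _)]
      exact (proj_zero_mul_lift _).symm
    · rw [proj_succ, shift_succ, ← lift_mul, ← lift_mul, ih]

theorem shift_head_proj (E : Module.End K G) (j n : ℕ) :
    shift j (head E) * proj n = proj n * shift j (head E) := by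
  refine shift_proj_comm (fun n => ?_) (by simp) j n
  rcases n with _ | n
  · exact ext_head (by simp) (by simp)
  · exact head_lift E _

theorem shift_head_id {j n : ℕ} (h : j < n) :
    shift j (head LinearMap.id) * proj n = (proj n : Module.End K (TensorAlgebra K G)) := by
  obtain ⟨c, rfl⟩ : ∃ c, n = j + (c + 1) := ⟨n - j - 1, by omega⟩
  rw [← shift_proj, ← shift_mul]
  exact congrArg _ (ext_head (by simp) (by simp))

end Tens

namespace Fam

variable {K : Type u} [Field K]

/-- The cycle of the cobracket side carries the marked operator to the last strand, and the cycle of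
the bracket side cancels it. -/
theorem sandwich {S : Type*} [Monoid S] {κ c e e' p : S} (h1 : κ * (c * p) = p)
    (h2 : e * c = c * e') (h3 : e' * p = p * e') (y : S) :
    κ * (e * (c * (p * y))) = e' * (p * y) := by
  rw [← mul_assoc e, h2, mul_assoc, ← mul_assoc e', h3, mul_assoc p, ← mul_assoc c, ← mul_assoc κ,
    h1, ← mul_assoc]

/-- For every `j`, both sides are written with strand `j` as the innermost leg. The two cycles
cancel, `E` lands on the last strand, and `q` is the sum over `j` of the products of the remaining
permutations. It depends neither on `A` nor on `E`. -/
theorem exists_sum_legs {U D : Fam K} (hU : U ∈ Algebra.adjoin K (Set.range t ∪ Set.range m))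
    (hD : D ∈ Algebra.adjoin K (Set.range t ∪ Set.range d)) (k : ℕ) :
    ∃ q ∈ permAlg K k, ∀ (A : LBA K) (E : Module.End K A),
      ∑ j ∈ Finset.range (k + 1), (proj 1 * ev A U * proj (k + 1)) *
        (shift j (head E) * (proj (k + 1) * (ev A D * proj 1)))
      = proj 1 * (comb A.br A.cobracket k q E * proj 1) := by
  choose p hp ep using fun j => exists_legs_left hU j (k - j)
  choose p' hp' ep' using fun j => exists_legs_right hD j (k - j)
  refine ⟨∑ j ∈ Finset.range (k + 1), p j * p' j, sum_mem fun j hj => ?_, fun A E => ?_⟩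
  · have hj : j + (k - j) = k := by have := Finset.mem_range.1 hj; omega
    have h1 := hp j
    have h2 := hp' j
    rw [hj] at h1 h2
    exact mul_mem h1 h2
  · have e : proj 1 * (comb A.br A.cobracket k (∑ j ∈ Finset.range (k + 1), p j * p' j) E * proj 1)
        = ∑ j ∈ Finset.range (k + 1), proj 1 * (comb A.br A.cobracket k (p j * p' j) E * proj 1) := by
      simp only [comb, map_sum, Finset.sum_mul, Finset.mul_sum]
    rw [e]
    refine Finset.sum_congr rfl fun j hj => ?_
    have hj : j + (k - j) = k := by have := Finset.mem_range.1 hj; omega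
    have hp := hp' j
    have h1 := ep j A
    have h2 := ep' j A
    have h3 := unop_cycle_cycle A j (k - j)
    have h4 := shift_head_cycle E j (k - j)
    rw [hj] at h1 h2 h3 h4 hp
    have R := legRelations_cobracket A
    have h5 : perm (p' j) * (LegRelations.cobr (del A.cobracket) k * proj 1)
        = proj (k + 1) * (perm (p' j) * (LegRelations.cobr (del A.cobracket) k * proj 1)) := by
      rw [← mul_assoc (proj _), perm_comm (fun i => (R.t_π i _).symm), mul_assoc,
        show k + 1 = 1 + k by omega, ← mul_assoc (proj _), ← R.cobr_π, mul_assoc, R.π_π]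
    rw [h1, h2, h5, mul_assoc, sandwich h3 h4 (shift_head_proj E k _), ← h5,
      ← mul_assoc (shift k _), shift_perm hp]
    simp only [comb, map_mul, mul_assoc]

theorem commute_der {F : Fam K} (hF : F ∈ words K) (A : LBA K) {E : Module.End K A}
    (hE : IsBiderivation A E) : der E * ev A F = ev A F * der E := by
  refine Algebra.adjoin_induction ?_ ?_ ?_ ?_ hF
  · rintro _ ((⟨i, rfl⟩ | ⟨i, rfl⟩) | ⟨i, rfl⟩)
    · exact der_shift E (der_tau₀ E) i
    · exact der_shift E (der_mu₀ (β := A.br) fun a b => hE.1 a b) i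
    · exact der_shift E (der_del₀ hE.2) i
  · intro r
    rw [AlgHom.commutes]
    exact (Algebra.commutes r _).symm
  · intro x y _ _ hx hy
    rw [map_add, mul_add, add_mul, hx, hy]
  · intro x y _ _ hx hy
    rw [map_mul, ← mul_assoc, hx, mul_assoc, hy, mul_assoc]

theorem sum_legs_id (A : LBA K) (k : ℕ) (X Y : Module.End K (TensorAlgebra K A)) :
    ∑ j ∈ Finset.range (k + 1), X * (shift j (head LinearMap.id) * (proj (k + 1) * Y))
      = (k + 1 : K) • (X * (proj (k + 1) * Y)) := by
  rw [Finset.sum_congr rfl fun j hj => by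
    rw [← mul_assoc (shift j _), shift_head_id (Finset.mem_range.1 hj)]]
  rw [Finset.sum_const, Finset.card_range, ← Nat.cast_smul_eq_nsmul K]
  push_cast
  rfl

theorem proj_der (A : LBA K) (E : Module.End K A) (n : ℕ) :
    der E * proj n = (proj n : Module.End K (TensorAlgebra K A)) * der E := by
  have h : der E * proj 0 = (proj 0 : Module.End K (TensorAlgebra K A)) * der E :=
    ext_head (by simp) (by simp)
  have := der_shift E h n
  rwa [shift_proj] at this

/-- For `E = id` the `k + 1` strands contribute equally. For a biderivation the sum over strands is
`der E` acting between `U` and `D`, and `der E` commutes with `D`. -/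
theorem exists_comb {U D : Fam K} (hU : U ∈ Algebra.adjoin K (Set.range t ∪ Set.range m))
    (hD : D ∈ Algebra.adjoin K (Set.range t ∪ Set.range d)) (k : ℕ) :
    ∃ q ∈ permAlg K k, ∀ A : LBA K,
      ((proj 1 : Module.End K (TensorAlgebra K A)) * (comb A.br A.cobracket k q LinearMap.id * proj 1)
        = (k + 1 : K) • (proj 1 * ev A U * (proj (k + 1) * (ev A D * proj 1)))) ∧
      ∀ E, IsBiderivation A E →
        (k + 1 : K) • (proj 1 * (comb A.br A.cobracket k q E * proj 1))
        = proj 1 * (comb A.br A.cobracket k q LinearMap.id * proj 1) * der E := by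
  obtain ⟨q, hq, e⟩ := exists_sum_legs hU hD k
  refine ⟨q, hq, fun A => ?_⟩
  have h1 : proj 1 * (comb A.br A.cobracket k q LinearMap.id * proj 1)
      = (k + 1 : K) • (proj 1 * ev A U * (proj (k + 1) * (ev A D * proj 1))) := by
    rw [← e A LinearMap.id, sum_legs_id, mul_assoc (proj 1 * ev A U), ← mul_assoc (proj _) (proj _),
      proj_proj]
  refine ⟨h1, fun E hE => ?_⟩
  have hD' : D ∈ words K := Algebra.adjoin_mono
    (Set.union_subset_union_left _ Set.subset_union_left) hD
  rw [h1, ← e A E, smul_mul_assoc]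
  congr 1
  have h2 : ev A D * proj 1 * der E = der E * (ev A D * proj 1) := by
    rw [mul_assoc, ← proj_der, ← mul_assoc, ← mul_assoc, commute_der hD' A hE]
  have h3 : proj (k + 1) * der E = ∑ j ∈ Finset.range (k + 1), proj (k + 1) *
      (shift j (head E) * (proj (k + 1) : Module.End K (TensorAlgebra K A))) := by
    rw [← Finset.mul_sum, ← der_proj, proj_der, ← mul_assoc, proj_proj]
  rw [mul_assoc _ (proj (k + 1) * _) (der E), mul_assoc (proj (k + 1)), h2, ← mul_assoc (proj (k + 1)) (der E), h3]
  simp only [Finset.sum_mul, Finset.mul_sum, mul_assoc]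

/-- The homogeneous components of an element of `words K` acting on one factor. -/
theorem exists_comb_sum {F : Fam K} (hF : F ∈ words K) :
    ∃ n, ∃ q : ℕ → FreeAlgebra K ℕ, (∀ k, q k ∈ permAlg K k) ∧
      (∀ (A : LBA K) (k : ℕ) (E : Module.End K A), IsBiderivation A E →
        (k + 1 : K) • (proj 1 * (comb A.br A.cobracket k (q k) E * proj 1))
        = proj 1 * (comb A.br A.cobracket k (q k) LinearMap.id * proj 1) * der E) ∧
      ∀ (A : LBA K), ∀ N ≥ n, [CharZero K] → proj 1 * (ev A F * proj 1) =
        ∑ k ∈ Finset.range N, (k + 1 : K)⁻¹ •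
          (proj 1 * (comb A.br A.cobracket k (q k) LinearMap.id * proj 1)) := by
  have h := swapRelations.mem_mul hF
  refine Submodule.mul_induction_on h ?_ ?_
  · intro U hU D hD
    obtain ⟨n, hn⟩ := legRelations_d.exists_sum_proj hD
    choose q hq e using fun k => exists_comb hU hD k
    refine ⟨n, q, hq, fun A k => (e k A).2, fun A N hN _ => ?_⟩
    have h1 := congrArg (ev A) (hn N hN)
    simp only [map_mul, map_sum, ev_π] at h1
    rw [map_mul, mul_assoc, h1, Finset.mul_sum, Finset.mul_sum]
    refine Finset.sum_congr rfl fun k _ => ?_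
    rw [(e k A).1, smul_smul, inv_mul_cancel₀ (Nat.cast_add_one_ne_zero k), one_smul, mul_assoc]
  · rintro F F' ⟨n, q, h1, h2, h3⟩ ⟨n', q', h1', h2', h3'⟩
    refine ⟨max n n', q + q', fun k => add_mem (h1 k) (h1' k), fun A k E hE => ?_,
      fun A N hN _ => ?_⟩
    · have : ∀ E : Module.End K A, proj 1 * (comb A.br A.cobracket k ((q + q') k) E * proj 1)
          = proj 1 * (comb A.br A.cobracket k (q k) E * proj 1)
            + proj 1 * (comb A.br A.cobracket k (q' k) E * proj 1) := by
        intro E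
        simp only [comb, Pi.add_apply, map_add, add_mul, mul_add]
      rw [this, this, smul_add, add_mul, h2 A k E hE, h2' A k E hE]
    · rw [map_add, add_mul, mul_add, h3 A N (le_trans (le_max_left _ _) hN),
        h3' A N (le_trans (le_max_right _ _) hN), ← Finset.sum_add_distrib]
      refine Finset.sum_congr rfl fun k _ => ?_
      rw [← smul_add]
      simp only [comb, Pi.add_apply, map_add, add_mul, mul_add]

end Fam

namespace Tens

variable {K : Type u} [Field K] {G : Type u} [AddCommGroup G] [Module K G]

/-- The endomorphism of `G` induced by an operator on the tensor algebra. -/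
def res (F : Module.End K (TensorAlgebra K G)) : Module.End K G :=
  TensorAlgebra.ιInv ∘ₗ F ∘ₗ TensorAlgebra.ι K

theorem proj_one_mem (t : TensorAlgebra K G) :
    proj 1 t ∈ LinearMap.range (TensorAlgebra.ι K : G →ₗ[K] TensorAlgebra K G) := by
  have : (LinearMap.range (TensorAlgebra.ι K : G →ₗ[K] TensorAlgebra K G)).comap (proj 1) = ⊤ := by
    refine eq_top_of_cons _ (by simp) fun a t _ => ?_
    simp only [Submodule.mem_comap, proj_succ_cons]
    refine ⟨TensorAlgebra.algebraMapInv t • a, ?_⟩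
    simp [proj, Algebra.smul_def, Algebra.commutes]
  exact (this ▸ Submodule.mem_top : t ∈ _)

theorem ι_res {F : Module.End K (TensorAlgebra K G)} (h : F * proj 1 = proj 1 * F) (a : G) :
    TensorAlgebra.ι K (res F a) = F (TensorAlgebra.ι K a) := by
  have h1 : F (TensorAlgebra.ι K a) = proj 1 (F (TensorAlgebra.ι K a)) := by
    have := LinearMap.congr_fun h (TensorAlgebra.ι K a)
    simpa using this
  obtain ⟨b, hb⟩ := proj_one_mem (F (TensorAlgebra.ι K a))
  rw [res, LinearMap.comp_apply, LinearMap.comp_apply, h1, ← hb,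
    TensorAlgebra.ι_leftInverse (R := K) (M := G)]

theorem iterBr_proj (β : G →ₗ[K] G →ₗ[K] G) (k n : ℕ) :
    iterBr β k * proj (n + k) = proj n * iterBr β k := by
  induction k with
  | zero => rfl
  | succ k ih => rw [iterBr, mul_assoc, ← add_assoc, ← proj_mu, ← mul_assoc, ih, mul_assoc]

theorem cobr_proj (d : G →ₗ[K] G ⊗[K] G) (k n : ℕ) :
    LegRelations.cobr (del d) k * proj n = proj (n + k) * LegRelations.cobr (del d) k := by
  induction k with
  | zero => rfl
  | succ k ih => rw [LegRelations.cobr, mul_assoc, ih, ← mul_assoc, del_proj, mul_assoc, add_assoc]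

theorem comb_proj (β : G →ₗ[K] G →ₗ[K] G) (d : G →ₗ[K] G ⊗[K] G) (k : ℕ) (q : FreeAlgebra K ℕ)
    (E : Module.End K G) (n : ℕ) : comb β d k q E * proj n = proj n * comb β d k q E := by
  rw [comb, mul_assoc, mul_assoc, mul_assoc, cobr_proj, ← mul_assoc (shift k _), shift_head_proj,
    mul_assoc (proj _), ← mul_assoc (perm q), ← perm_comm fun i => (tau_proj i _).symm,
    mul_assoc (proj _), ← mul_assoc (iterBr β k), iterBr_proj, mul_assoc]

/-- The endomorphism of `G` induced by `comb`. -/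
def combEnd (β : G →ₗ[K] G →ₗ[K] G) (d : G →ₗ[K] G ⊗[K] G) (k : ℕ) (q : FreeAlgebra K ℕ)
    (E : Module.End K G) : Module.End K G :=
  res (comb β d k q E)

theorem ι_combEnd (β : G →ₗ[K] G →ₗ[K] G) (d : G →ₗ[K] G ⊗[K] G) (k : ℕ) (q : FreeAlgebra K ℕ)
    (E : Module.End K G) (a : G) :
    TensorAlgebra.ι K (combEnd β d k q E a) = comb β d k q E (TensorAlgebra.ι K a) :=
  ι_res (comb_proj β d k q E 1) a

end Tens

/-- The structure of universal endomorphisms. -/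
theorem IsUniversal.exists_combEnd {K : Type u} [Field K] [CharZero K] {l : EndFamily K}
    (hl : IsUniversal l) :
    ∃ n, ∃ q : ℕ → FreeAlgebra K ℕ, (∀ k, q k ∈ permAlg K k) ∧
      (∀ (A : LBA K) (k : ℕ) (E : Module.End K A), IsBiderivation A E → ∀ a,
        combEnd A.br A.cobracket k (q k) LinearMap.id (E a)
          = (k + 1 : K) • combEnd A.br A.cobracket k (q k) E a) ∧
      ∀ (A : LBA K) (a : A), l A a = ∑ k ∈ Finset.range n, (k + 1 : K)⁻¹ •
          combEnd A.br A.cobracket k (q k) LinearMap.id a := by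
  obtain ⟨F, hF, e⟩ := IsUniversal.exists_words hl
  obtain ⟨n, q, hq, h2, h3⟩ := Fam.exists_comb_sum hF
  have hc : ∀ (A : LBA K) (k : ℕ) (E : Module.End K A) (a : A),
      (proj 1 * (comb A.br A.cobracket k (q k) E * proj 1) : Module.End K (TensorAlgebra K A))
          (TensorAlgebra.ι K a)
        = TensorAlgebra.ι K (combEnd A.br A.cobracket k (q k) E a) := by
    intro A k E a
    rw [comb_proj, ← mul_assoc, proj_proj, ← comb_proj, ι_combEnd]
    simp
  have hι : ∀ A : LBA K, Function.Injective (TensorAlgebra.ι K : A → TensorAlgebra K A) :=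
    fun A => TensorAlgebra.ι_leftInverse.injective
  refine ⟨n, q, hq, fun A k E hE a => hι A ?_, fun A a => hι A ?_⟩
  · have := LinearMap.congr_fun (h2 A k E hE) (TensorAlgebra.ι K a)
    rw [LinearMap.smul_apply, hc, Module.End.mul_apply, der_ι, hc] at this
    rw [← this, map_smul]
  · have := LinearMap.congr_fun (h3 A n le_rfl) (TensorAlgebra.ι K a)
    rw [LinearMap.sum_apply] at this
    simp only [LinearMap.smul_apply, hc] at this
    rw [map_sum]
    simp only [map_smul, ← this, Module.End.mul_apply, proj_succ_ι, proj_zero_one, mul_one, e]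

end

end LieBialg

/-! ### Shuffles, the antipode identity and split sums. -/

namespace LieBialg

namespace Shuffle

variable {X V W : Type*} [AddCommGroup V] [AddCommGroup W]

/-- The sum of the values of `f` at all shuffles of two words. -/
def sh {V : Type*} [AddCommGroup V] (f : List X → V) : List X → List X → V
  | [], v => f v
  | a :: u, [] => f (a :: u)
  | a :: u, b :: v => sh (fun t => f (a :: t)) u (b :: v) + sh (fun t => f (b :: t)) (a :: u) v
  termination_by u v => u.length + v.length

@[simp] theorem sh_nil_left (f : List X → V) (v : List X) : sh f [] v = f v := by rw [sh]

@[simp] theorem sh_nil_right (f : List X → V) (u : List X) : sh f u [] = f u := by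
  cases u <;> rw [sh]

theorem sh_cons_cons (f : List X → V) (a b : X) (u v : List X) :
    sh f (a :: u) (b :: v)
      = sh (fun t => f (a :: t)) u (b :: v) + sh (fun t => f (b :: t)) (a :: u) v := by rw [sh]

theorem sh_map (φ : V →+ W) (f : List X → V) (u v : List X) :
    sh (fun t => φ (f t)) u v = φ (sh f u v) := by
  induction u generalizing f v with
  | nil => simp
  | cons a u ihu =>
    induction v generalizing f with
    | nil => simp
    | cons b v ihv =>
      rw [sh_cons_cons, sh_cons_cons, map_add, ← ihu, ← ihv]

theorem sh_congr {f g : List X → V} {u v : List X} (h : ∀ t, t.Perm (u ++ v) → f t = g t) :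
    sh f u v = sh g u v := by
  induction u generalizing f g v with
  | nil => simpa using h v (by simp)
  | cons a u ihu =>
    induction v generalizing f g with
    | nil => simpa using h (a :: u) (by simp)
    | cons b v ihv =>
      rw [sh_cons_cons, sh_cons_cons]
      congr 1
      · exact ihu fun t ht => h _ (by simpa using ht)
      · exact ihv fun t ht => h _ ((List.Perm.cons b ht).trans List.perm_middle.symm)

theorem sh_add (f g : List X → V) (u v : List X) :
    sh (fun t => f t + g t) u v = sh f u v + sh g u v := by
  induction u generalizing f g v with
  | nil => simp
  | cons a u ihu =>
    induction v generalizing f g with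
    | nil => simp
    | cons b v ihv =>
      rw [sh_cons_cons, sh_cons_cons, sh_cons_cons, ihu, ihv]
      abel

theorem sh_comm (f : List X → V) (u v : List X) : sh f u v = sh f v u := by
  induction u generalizing f v with
  | nil => simp
  | cons a u ihu =>
    induction v generalizing f with
    | nil => simp
    | cons b v ihv => rw [sh_cons_cons, sh_cons_cons, ihu, ihv, add_comm]

theorem sh_assoc (f : List X → V) (u v w : List X) :
    sh (fun s => sh f s w) u v = sh (fun s => sh f u s) v w := by
  induction u generalizing f v w with
  | nil => simp
  | cons a u ihu =>
    induction v generalizing f w with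
    | nil => simp
    | cons b v ihv =>
      induction w generalizing f with
      | nil => simp
      | cons c w ihw =>
        simp only [sh_cons_cons, sh_add]
        rw [ihu, ihv, ← ihw, sh_cons_cons]
        simp only [sh_cons_cons]
        abel

theorem sh_left_comm (f : List X → V) (u v w : List X) :
    sh (fun s => sh f u s) v w = sh (fun s => sh f v s) u w := by
  rw [← sh_assoc, sh_comm, sh_assoc]

/-- The sum of the values of `f` at all shuffles of a list of words. -/
def shufs (f : List X → V) : List (List X) → V
  | [] => f []
  | u :: L => shufs (fun s => sh f u s) L

theorem shufs_map (φ : V →+ W) (f : List X → V) (L : List (List X)) :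
    shufs (fun t => φ (f t)) L = φ (shufs f L) := by
  induction L generalizing f with
  | nil => rfl
  | cons u L ih => simp only [shufs, sh_map, ih]

theorem shufs_add (f g : List X → V) (L : List (List X)) :
    shufs (fun t => f t + g t) L = shufs f L + shufs g L := by
  induction L generalizing f g with
  | nil => rfl
  | cons u L ih => simp only [shufs, sh_add, ih]

theorem shufs_congr {f g : List X → V} {L : List (List X)}
    (h : ∀ t, t.Perm L.flatten → f t = g t) : shufs f L = shufs g L := by
  induction L generalizing f g with
  | nil => exact h [] (by simp)
  | cons u L ih =>
    refine ih fun s hs => sh_congr fun t ht => h t (ht.trans ?_)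
    exact hs.append_left u

theorem shufs_zero (L : List (List X)) : shufs (fun _ : List X => (0 : V)) L = 0 := by
  simpa using shufs_map (0 : V →+ V) (fun _ : List X => (0 : V)) L

theorem shufs_perm {L L' : List (List X)} (h : L.Perm L') (f : List X → V) :
    shufs f L = shufs f L' := by
  induction h generalizing f with
  | nil => rfl
  | cons u _ ih => exact ih _
  | swap u v L => simp only [shufs, sh_left_comm f u v]
  | trans _ _ ih ih' => rw [ih, ih']

/-- Evaluation at a word followed by the sum over the shuffles with the words of `L`. -/
theorem sh_shufs (f : List X → V) (u v : List X) (L : List (List X)) :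
    sh (fun s => shufs f (s :: L)) u v = shufs f (u :: v :: L) := by
  let Φ : (List X → V) →+ V :=
    { toFun := fun g => shufs g L
      map_zero' := shufs_zero L
      map_add' := fun g g' => shufs_add g g' L }
  have h1 := sh_map Φ (fun s t => sh f s t) u v
  refine h1.trans (congrArg Φ ?_)
  funext t
  have h2 := sh_map (Pi.evalAddMonoidHom (fun _ : List X => V) t) (fun s t => sh f s t) u v
  refine h2.symm.trans ?_
  exact sh_assoc f u v t

/-- The alternating sum over the deconcatenations `v = v₁ ++ v₂` of the shuffles of
`v₁.reverse ++ u` and `v₂`. -/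
def antip (f : List X → V) (u : List X) : List X → V
  | [] => f u
  | b :: v => sh f u (b :: v) - antip f (b :: u) v

/-- The antipode identity: terms whose first letter comes from the second word cancel in consecutive
pairs, and only those starting with the first letter of `u` survive. For empty `u` nothing is left.
-/
theorem antip_cons (f : List X → V) (u v : List X) (b : X) :
    antip f u (b :: v) = match u with
      | [] => 0
      | a :: u => sh (fun t => f (a :: t)) u (b :: v) := by
  induction v generalizing u b with
  | nil =>
    cases u with
    | nil => simp [antip]
    | cons a u => simp [antip, sh_cons_cons]
  | cons c v ih =>
    rw [antip, ih]
    cases u with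
    | nil => simp
    | cons a u => simp [sh_cons_cons f]

theorem antip_eq {f : List X → V} {u v : List X} (hu : u ≠ [])
    (h : ∀ u' v', u' ≠ [] → v' ≠ [] → (u' ++ v').Perm (u ++ v) → sh f u' v' = 0) :
    antip f u v = (-1) ^ v.length • f (v.reverse ++ u) := by
  induction v generalizing u with
  | nil => simp [antip]
  | cons b v ih =>
    rw [antip, h u (b :: v) hu (by simp) (List.Perm.refl _), ih (by simp), zero_sub]
    · simp [pow_succ]
    · intro u' v' hu' hv' hp
      exact h u' v' hu' hv' (hp.trans List.perm_middle.symm)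

/-- Reversal of a word, for functionals which vanish on proper shuffles. -/
theorem reverse_eq {f : List X → V} {v : List X} {b : X}
    (h : ∀ u' v', u' ≠ [] → v' ≠ [] → (u' ++ v').Perm (b :: v) → sh f u' v' = 0) :
    f (b :: v) = (-1) ^ v.length • f (v.reverse ++ [b]) := by
  have h1 : antip f [] (b :: v) = 0 := antip_cons f [] v b
  rw [antip, sh_nil_left, antip_eq (by simp) (by simpa using h), sub_eq_zero] at h1
  exact h1

/-- The decompositions of a word as `α ++ x :: β`. -/
def splits : List X → List (List X × X × List X)
  | [] => []
  | a :: w => ([], a, w) :: (splits w).map fun s => (a :: s.1, s.2.1, s.2.2)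

theorem splits_append (w : List X) (b : X) :
    splits (w ++ [b]) = (splits w).map (fun s => (s.1, s.2.1, s.2.2 ++ [b])) ++ [(w, b, [])] := by
  induction w with
  | nil => rfl
  | cons a w ih => simp [splits, ih]

theorem eq_of_mem_splits {w : List X} {s : List X × X × List X} (h : s ∈ splits w) :
    w = s.1 ++ s.2.1 :: s.2.2 := by
  induction w generalizing s with
  | nil => simp [splits] at h
  | cons a w ih =>
    simp only [splits, List.mem_cons, List.mem_map] at h
    rcases h with rfl | ⟨s', hs', rfl⟩
    · rfl
    · simp [← ih hs']

/-- The signed sum over the decompositions `w = α ++ x :: β` of `f` at the shuffles of `α`,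
`β.reverse` and `v`, weighted by a function of `x`. -/
def splitSum (f : X → List X → V) (w v : List X) : V :=
  ((splits w).map fun s =>
    (-1 : ℤ) ^ s.2.2.length • sh (fun t => sh (f s.2.1) t v) s.1 s.2.2.reverse).sum

theorem shufs_list_sum {ι : Type*} (l : List ι) (g : ι → List X → V) (L : List (List X)) :
    shufs (fun v => (l.map fun s => g s v).sum) L = (l.map fun s => shufs (g s) L).sum := by
  induction l with
  | nil => simpa using shufs_zero L
  | cons a l ih => simp only [List.map_cons, List.sum_cons, shufs_add, ih]

theorem shufs_sh_sh (f : List X → V) (u v : List X) (L : List (List X)) :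
    shufs (fun w => sh (fun t => sh f t w) u v) L = shufs f (u :: v :: L) := by
  simp only [shufs, sh_assoc]

/-! ### Vanishing of functionals on coloured words. -/

section Coloured

variable {R : Type*}

/-- The colours of a word of coloured letters. -/
def colours (t : List (R × ℕ)) : Finset ℕ := (t.map Prod.snd).toFinset

theorem mem_colours {t : List (R × ℕ)} {c : ℕ} : c ∈ colours t ↔ ∃ x ∈ t, x.2 = c := by
  simp [colours]

theorem colours_perm {t t' : List (R × ℕ)} (h : t.Perm t') : colours t = colours t' :=
  Finset.ext fun c => by simp [mem_colours, h.mem_iff]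

/-- Replacing a letter by the unit with a new colour. -/
theorem card_colours_replace {x : R × ℕ} {t t' : List (R × ℕ)} {c : ℕ} {z : R}
    (hc : c ∉ colours (x :: t)) (h : t'.Perm ((z, c) :: t)) {a : ℕ}
    (ha : a ≤ (colours (x :: t)).card) : a ≤ (colours t').card := by
  have h1 : colours (x :: t) = insert x.2 (colours t) := by simp [colours]
  have h2 : colours t' = insert c (colours t) := by rw [colours_perm h]; simp [colours]
  rw [h1] at ha hc
  rw [h2, Finset.card_insert_of_notMem fun h => hc (Finset.mem_insert_of_mem h)]
  exact ha.trans (Finset.card_insert_le _ _)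

variable [Ring R]

/-- Letters of different colours commute. -/
def Commuting (t : List (R × ℕ)) : Prop :=
  ∀ x ∈ t, ∀ y ∈ t, x.2 ≠ y.2 → Commute x.1 y.1

theorem Commuting.of_perm {t t' : List (R × ℕ)} (ht : Commuting t) (h : t'.Perm t) :
    Commuting t' := fun x hx y hy => ht x (h.mem_iff.1 hx) y (h.mem_iff.1 hy)

theorem Commuting.replace {x : R × ℕ} {t t' : List (R × ℕ)} {c : ℕ}
    (h : Commuting (x :: t)) (h' : t'.Perm ((1, c) :: t)) : Commuting t' := by
  refine Commuting.of_perm ?_ h'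
  intro y hy z hz hyz
  rcases List.mem_cons.1 hy with rfl | hy
  · exact Commute.one_left _
  · rcases List.mem_cons.1 hz with rfl | hz
    · exact Commute.one_right _
    · exact h y (List.mem_cons_of_mem _ hy) z (List.mem_cons_of_mem _ hz) hyz

/-- A functional on words of length `M` which satisfies the relations imposed by the derivation
property. -/
structure Relations (f : List (R × ℕ) → R) (M : ℕ) : Prop where
  zero : ∀ t, (∃ x ∈ t, x.1 = 0) → f t = 0
  ones : ∀ t, (∀ x ∈ t, x.1 = 1) → t.length = M → f t = 0
  rel : ∀ w v, 2 ≤ w.length → w.length + v.length = M + 1 → (∃ x ∈ w, x.1 = 1) →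
    (∀ α x β v' y v'', w = α ++ x :: β → v = v' ++ y :: v'' →
      ∀ l, l.Perm (α ++ β ++ v' ++ (x.1 * y.1 - y.1 * x.1, x.2) :: v'') → f l = 0) →
    splitSum (fun x t => f t * x.1) w v = 0

/-- The lists of non-empty words with `M` letters and at least `a` colours. -/
def Good (M a : ℕ) (L : List (List (R × ℕ))) : Prop :=
  (∀ u ∈ L, u ≠ []) ∧ L.flatten.length = M ∧ Commuting L.flatten ∧ a ≤ (colours L.flatten).card

theorem Good.of_perm {M a : ℕ} {L L' : List (List (R × ℕ))} (h : Good M a L)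
    (hp : L'.flatten.Perm L.flatten) (hL : ∀ u ∈ L', u ≠ []) : Good M a L' :=
  ⟨hL, hp.length_eq.trans h.2.1, h.2.2.1.of_perm hp, by rw [colours_perm hp]; exact h.2.2.2⟩

theorem Good.replace {M a : ℕ} {L L' : List (List (R × ℕ))} (h : Good M a L) {x : R × ℕ}
    {t : List (R × ℕ)} {c : ℕ} (hp : L.flatten.Perm (x :: t)) (hc : c ∉ colours L.flatten)
    (hp' : L'.flatten.Perm ((1, c) :: t)) (hL : ∀ u ∈ L', u ≠ []) : Good M a L' := by
  refine ⟨hL, ?_, (h.2.2.1.of_perm hp.symm).replace hp', ?_⟩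
  · rw [hp'.length_eq, ← h.2.1, hp.length_eq]; rfl
  · rw [colours_perm hp] at hc
    exact card_colours_replace hc hp' (by rw [← colours_perm hp]; exact h.2.2.2)

theorem exists_fresh (s : Finset ℕ) : ∃ c, c ∉ s := Infinite.exists_notMem_finset s

variable {f : List (R × ℕ) → R} {M : ℕ}

/-- The relation is applied to `x :: u ++ [e]`, with `e` a unit of a new colour, shuffled with `L`.
Commutator terms vanish by `hS`, or because two letters commute; decompositions at an interior
letter have one word more and vanish by `hT`. The two extreme decompositions remain and give the two
sides. -/
theorem Relations.shufs_rotate (hf : Relations f M) {a b : ℕ}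
    (hS : ∀ t, t.length = M → Commuting t → a + 1 ≤ (colours t).card → f t = 0)
    (hT : ∀ L, Good M a L → b + 1 ≤ L.length → shufs f L = 0)
    {x : R × ℕ} {u : List (R × ℕ)} {L : List (List (R × ℕ))} (hL : Good M a ((x :: u) :: L))
    (hb : b ≤ L.length + 1) {c : ℕ} (hc : c ∉ colours ((x :: u) :: L).flatten) :
    shufs f ((x :: u) :: L) = shufs f ((u ++ [(1, c)]) :: L) * x.1 := by
  set e : R × ℕ := (1, c) with he
  have hlen : u.length + 1 + L.flatten.length = M := by
    have := hL.2.1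
    simpa [add_comm, add_left_comm, add_assoc] using this
  have hLne : ∀ w ∈ L, w ≠ [] := fun w hw => hL.1 w (List.mem_cons_of_mem _ hw)
  have hzero : shufs (fun v => splitSum (fun x t => f t * x.1) (x :: (u ++ [e])) v) L = 0 := by
    rw [← shufs_zero L]
    refine shufs_congr fun v hv => hf.rel _ _ (by simp) ?_ ⟨e, by simp, rfl⟩ ?_
    · simp only [List.length_cons, List.length_append, List.length_nil, hv.length_eq]; omega
    · intro α z β v' y v'' hw hv' l hl
      have hperm : (z :: (α ++ β ++ (v' ++ y :: v''))).Perm (x :: (u ++ [e] ++ L.flatten)) := by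
        have h1 : (z :: (α ++ β ++ (v' ++ y :: v''))).Perm ((α ++ z :: β) ++ (v' ++ y :: v'')) := by
          rw [List.append_assoc, List.append_assoc]
          exact List.perm_middle.symm
        refine h1.trans ?_
        rw [← hw, ← hv']
        simpa using hv.append_left (x :: (u ++ [e]))
      have hy : y ∈ L.flatten := hv.mem_iff.1 (by rw [hv']; simp)
      have hzy : Commute z.1 y.1 → f l = 0 := fun h =>
        hf.zero _ ⟨(z.1 * y.1 - y.1 * z.1, z.2), hl.mem_iff.2 (by simp), sub_eq_zero.2 h⟩
      have hz : z ∈ x :: (u ++ [e]) := by rw [hw]; simp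
      by_cases hze : z = e
      · exact hzy (by rw [hze]; exact Commute.one_left _)
      have hz' : z ∈ x :: u := by
        rcases List.mem_cons.1 hz with h | h
        · rw [h]; simp
        · rcases List.mem_append.1 h with h | h
          · exact List.mem_cons_of_mem _ h
          · exact absurd (by simpa using h) hze
      have hzL : z ∈ ((x :: u) :: L).flatten := List.mem_flatten_of_mem (by simp) hz'
      have hyL : y ∈ ((x :: u) :: L).flatten := by
        rw [List.flatten_cons]; exact List.mem_append_right _ hy
      -- Letters of different colours have commutator zero. If the colours agree, the commutator
      -- keeps this colour, so no colour is lost while `e` adds a new one, and `hS` applies.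
      by_cases hcol : z.2 = y.2
      swap
      · exact hzy (hL.2.2.1 z hzL y hyL hcol)
      have hmem : ∀ s ∈ l, s = (z.1 * y.1 - y.1 * z.1, z.2) ∨ s ∈ ((x :: u) :: L).flatten
          ∨ s = e := by
        intro s hs
        have hs := hl.mem_iff.1 hs
        have h2 : s = (z.1 * y.1 - y.1 * z.1, z.2) ∨
            s ∈ (z :: (α ++ β ++ (v' ++ y :: v''))) := by
          simp only [List.mem_append, List.mem_cons] at hs ⊢
          tauto
        rcases h2 with h2 | h2
        · exact Or.inl h2
        · have := hperm.mem_iff.1 h2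
          simp only [List.mem_cons, List.mem_append, List.flatten_cons, List.mem_nil_iff] at this ⊢
          tauto
      have hcomm : ∀ s ∈ ((x :: u) :: L).flatten, s.2 ≠ z.2 →
          Commute s.1 (z.1 * y.1 - y.1 * z.1) := by
        intro s hs hsz
        have h1 := hL.2.2.1 s hs z hzL hsz
        have h2 := hL.2.2.1 s hs y hyL (hcol ▸ hsz)
        exact (h1.mul_right h2).sub_right (h2.mul_right h1)
      refine hS l ?_ ?_ ?_
      · have h1 := hl.length_eq
        have h2 := hperm.length_eq
        simp only [List.length_append, List.length_cons, List.length_nil] at h1 h2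
        omega
      · intro s hs s' hs' hss
        rcases hmem s hs with rfl | h | rfl
        · rcases hmem s' hs' with rfl | h' | rfl
          · exact absurd rfl hss
          · exact (hcomm s' h' (Ne.symm hss)).symm
          · exact Commute.one_right _
        · rcases hmem s' hs' with rfl | h' | rfl
          · exact hcomm s h hss
          · exact hL.2.2.1 s h s' h' hss
          · exact Commute.one_right _
        · exact Commute.one_left _
      · have hsub : insert c (colours ((x :: u) :: L).flatten) ⊆ colours l := by
          intro c' hc'
          have key : ∃ s ∈ (z :: (α ++ β ++ (v' ++ y :: v''))), s.2 = c' := by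
            rcases Finset.mem_insert.1 hc' with rfl | h
            · exact ⟨e, hperm.mem_iff.2 (by simp), rfl⟩
            · obtain ⟨s, hs, rfl⟩ := mem_colours.1 h
              refine ⟨s, hperm.mem_iff.2 ?_, rfl⟩
              simp only [List.mem_cons, List.mem_append, List.flatten_cons] at hs ⊢
              tauto
          obtain ⟨s, hs, rfl⟩ := key
          rw [mem_colours]
          by_cases hsz : s.2 = z.2
          · exact ⟨(z.1 * y.1 - y.1 * z.1, z.2), hl.mem_iff.2 (by simp), hsz.symm⟩
          · refine ⟨s, hl.mem_iff.2 ?_, rfl⟩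
            have h1 : s ≠ z := fun h => hsz (by rw [h])
            have h2 : s ≠ y := fun h => hsz (by rw [h, hcol])
            simp only [List.mem_append, List.mem_cons, h1, h2, false_or] at hs ⊢
            tauto
        have := Finset.card_le_card hsub
        rw [Finset.card_insert_of_notMem hc] at this
        have := hL.2.2.2
        omega
  -- Two non-empty words next to `L` exceed the number `b`; replacing the letter `z` by `e` does not
  -- lower the number of colours.
  have hmid : ∀ A B : List (R × ℕ), A ≠ [] → B ≠ [] → ∀ z, (∃ t, ((x :: u) :: L).flatten.Perm (z :: t) ∧
      (A :: B :: L).flatten.Perm (e :: t)) → shufs f (A :: B :: L) = 0 := by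
    rintro A B hA hB z ⟨t, h1, h2⟩
    refine hT _ (hL.replace h1 hc h2 ?_) (by simp; omega)
    intro w hw
    rcases List.mem_cons.1 hw with rfl | hw
    · exact hA
    · rcases List.mem_cons.1 hw with rfl | hw
      · exact hB
      · exact hLne _ hw
  -- By `hmid` the functional vanishes on proper shuffles, so the antipode identity reverses the
  -- word up to sign.
  have hrev : shufs f ((e :: u.reverse) :: L) = (-1) ^ u.length • shufs f ((u ++ [e]) :: L) := by
    have := reverse_eq (f := fun s => shufs f (s :: L)) (b := e) (v := u.reverse) ?_
    · simpa using this
    · intro u' v' hu' hv' hp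
      rw [sh_shufs]
      refine hmid u' v' hu' hv' x ⟨u ++ L.flatten, by simp, ?_⟩
      simp only [List.flatten_cons, ← List.append_assoc]
      refine (hp.append_right _).trans ?_
      simp only [List.cons_append]
      exact List.Perm.cons _ ((List.reverse_perm u).append_right _)
  have hF : ∀ (z : R × ℕ) (n : ℕ) (A B : List (R × ℕ)),
      shufs (fun v => (-1 : ℤ) ^ n • sh (fun t => sh (fun t => f t * z.1) t v) A B) L
        = (-1 : ℤ) ^ n • (shufs f (A :: B :: L) * z.1) := by
    intro z n A B
    have h1 := shufs_map (DistribSMul.toAddMonoidHom R ((-1 : ℤ) ^ n))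
      (fun v => sh (fun t => sh (fun t => f t * z.1) t v) A B) L
    refine h1.trans (congrArg (fun r : R => (-1 : ℤ) ^ n • r) ?_)
    rw [shufs_sh_sh]
    exact shufs_map (AddMonoidHom.mulRight z.1) f _
  simp only [splitSum, splits, splits_append, List.map_cons, List.map_append, List.map_map,
    List.map_nil, List.sum_cons, List.sum_append, List.sum_nil, add_zero, shufs_add] at hzero
  rw [hF, hF, shufs_list_sum] at hzero
  simp only [Function.comp_apply, hF] at hzero
  rw [List.sum_eq_zero (by
    intro r hr
    obtain ⟨s, hs, rfl⟩ := List.mem_map.1 hr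
    rw [hmid (x :: s.1) (s.2.2 ++ [e]).reverse (by simp) (by simp) s.2.1, zero_mul, smul_zero]
    have hu := eq_of_mem_splits hs
    refine ⟨x :: (s.1 ++ s.2.2.reverse ++ L.flatten), ?_, ?_⟩
    · rw [List.flatten_cons]
      conv_lhs => rw [hu]
      have : (x :: (s.1 ++ s.2.1 :: s.2.2) ++ L.flatten).Perm
          (s.2.1 :: (x :: s.1 ++ (s.2.2 ++ L.flatten))) := by
        have := List.perm_middle (a := s.2.1) (l₁ := x :: s.1) (l₂ := s.2.2 ++ L.flatten)
        simpa using this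
      refine this.trans (List.Perm.cons _ ?_)
      simp only [List.cons_append, List.append_assoc]
      exact List.Perm.cons _ (((List.reverse_perm _).symm.append_right _).append_left _)
    · have := List.perm_middle (a := e) (l₁ := x :: s.1) (l₂ := s.2.2.reverse ++ L.flatten)
      simpa using this), zero_add] at hzero
  simp only [List.reverse_append, List.reverse_cons, List.reverse_nil, List.nil_append,
    List.singleton_append, List.length_append, List.length_cons, List.length_nil, zero_add,
    pow_zero, one_smul] at hzero
  have hnil : ∀ A : List (R × ℕ), shufs f ([] :: A :: L) = shufs f (A :: L) := fun A => by
    simp [shufs]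
  have hnil' : ∀ A : List (R × ℕ), shufs f (A :: [] :: L) = shufs f (A :: L) := fun A => by
    simp [shufs]
  rw [hnil, hnil', hrev, he, mul_one] at hzero
  rw [← he] at hzero
  have hsign : (-1 : ℤ) ^ (u.length + 1) • ((-1) ^ u.length • shufs f ((u ++ [e]) :: L) * x.1)
      = -(shufs f ((u ++ [e]) :: L) * x.1) := by
    rcases neg_one_pow_eq_or ℤ u.length with h | h <;> simp [pow_succ, h]
  rw [hsign] at hzero
  rw [eq_comm, ← sub_eq_zero, ← neg_eq_zero]
  rw [← hzero]
  abel

/-- Each rotation trades the first letter for a unit at the end and a factor on the right, so after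
one turn the word consists of units. -/
theorem Relations.shufs_of_ones (hf : Relations f M) {a b : ℕ}
    (hS : ∀ t, t.length = M → Commuting t → a + 1 ≤ (colours t).card → f t = 0)
    (hT : ∀ L, Good M a L → b + 1 ≤ L.length → shufs f L = 0) {L : List (List (R × ℕ))}
    (hb : b ≤ L.length + 1)
    (hL : ∀ o : List (R × ℕ), (∀ x ∈ o, x.1 = 1) → Good M a (o :: L) → shufs f (o :: L) = 0)
    (u o : List (R × ℕ)) (ho : ∀ x ∈ o, x.1 = 1) (hg : Good M a ((u ++ o) :: L)) :
    shufs f ((u ++ o) :: L) = 0 := by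
  induction u generalizing o with
  | nil => exact hL o ho hg
  | cons x u ih =>
    obtain ⟨c, hc⟩ := exists_fresh (colours ((x :: (u ++ o)) :: L).flatten)
    rw [List.cons_append] at hg ⊢
    rw [hf.shufs_rotate hS hT hg hb hc, List.append_assoc, ih, zero_mul]
    · intro y hy
      rcases List.mem_append.1 hy with hy | hy
      · exact ho y hy
      · rw [List.mem_singleton.1 hy]
    · refine hg.replace (x := x) (t := u ++ o ++ L.flatten) (by simp) hc ?_ ?_
      · have := List.perm_middle (a := ((1 : R), c)) (l₁ := u ++ o) (l₂ := L.flatten)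
        simpa using this
      · intro w hw
        rcases List.mem_cons.1 hw with rfl | hw
        · simp
        · exact hg.1 w (List.mem_cons_of_mem _ hw)

/-- The words of `L₁` are replaced by words of units one at a time, the order of the list being
irrelevant; words made of units only are covered by `Relations.ones`. -/
theorem Relations.shufs_eq_zero_of_succ (hf : Relations f M) {a b : ℕ}
    (hS : ∀ t, t.length = M → Commuting t → a + 1 ≤ (colours t).card → f t = 0)
    (hT : ∀ L, Good M a L → b + 1 ≤ L.length → shufs f L = 0) (L₁ L₂ : List (List (R × ℕ)))
    (ho : ∀ x ∈ L₂.flatten, x.1 = 1) (hg : Good M a (L₁ ++ L₂)) (hb : b ≤ (L₁ ++ L₂).length) :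
    shufs f (L₁ ++ L₂) = 0 := by
  induction L₁ generalizing L₂ with
  | nil =>
    rw [← shufs_zero L₂]
    refine shufs_congr fun t ht => hf.ones t (fun x hx => ho x (ht.mem_iff.1 hx)) ?_
    rw [ht.length_eq]
    exact hg.2.1
  | cons u L₁ ih =>
    have h := hf.shufs_of_ones hS hT (L := L₁ ++ L₂) (by simpa using hb) ?_ u [] (by simp)
      (by simpa using hg)
    · simpa using h
    · intro o ho' hg'
      have hp : (o :: (L₁ ++ L₂)).Perm (L₁ ++ o :: L₂) := List.perm_middle.symm
      rw [shufs_perm hp]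
      refine ih (o :: L₂) ?_ (hg'.of_perm hp.symm.flatten fun w hw => hg'.1 w (hp.mem_iff.2 hw)) ?_
      · intro x hx
        rcases List.mem_append.1 hx with hx | hx
        · exact ho' x hx
        · exact ho x hx
      · simp only [List.length_append, List.length_cons] at hb ⊢
        omega

/-- Descending induction on the number of words: more than `M` non-empty words do not fit in `M`
letters. -/
theorem Relations.eq_zero_of_succ (hf : Relations f M) (hM : 1 ≤ M) {a : ℕ}
    (hS : ∀ t, t.length = M → Commuting t → a + 1 ≤ (colours t).card → f t = 0)
    (t : List (R × ℕ)) (hl : t.length = M) (hc : Commuting t) (ha : a ≤ (colours t).card) :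
    f t = 0 := by
  have key : ∀ j b, M + 1 ≤ b + j → ∀ L, Good M a L → b ≤ L.length → shufs f L = 0 := by
    intro j
    induction j with
    | zero =>
      intro b hb L hL hbL
      have h1 : L.length ≤ L.flatten.length := by
        have := hL.1
        clear hbL hL
        induction L with
        | nil => simp
        | cons u L ih =>
          have h1 := ih fun w hw => this w (List.mem_cons_of_mem _ hw)
          have h2 := List.length_pos_iff.2 (this u (by simp))
          simp only [List.length_cons, List.flatten_cons, List.length_append]
          omega
      have := hL.2.1
      omega
    | succ j ih =>
      intro b hb L hL hbL
      have := hf.shufs_eq_zero_of_succ hS (ih (b + 1) (by omega)) L [] (by simp) (by simpa using hL)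
        (by simpa using hbL)
      simpa using this
  have ht : t ≠ [] := by rintro rfl; simp at hl; omega
  simpa [shufs] using key (M + 1) 0 (by omega) [t]
    ⟨by simpa using ht, by simpa using hl, by simpa using hc, by simpa using ha⟩ (by simp)

/-- A functional which satisfies the relations vanishes on the words of length `M`. -/
theorem Relations.eq_zero (hf : Relations f M) (hM : 1 ≤ M) (t : List (R × ℕ))
    (hl : t.length = M) (hc : Commuting t) : f t = 0 := by
  -- Descending induction on the number of colours, which is at most the length `M`.
  have key : ∀ k a, M + 1 ≤ a + k → ∀ t : List (R × ℕ), t.length = M → Commuting t →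
      a ≤ (colours t).card → f t = 0 := by
    intro k
    induction k with
    | zero =>
      intro a ha t hl _ hat
      have : (colours t).card ≤ t.length := (List.toFinset_card_le _).trans (by simp)
      omega
    | succ k ih =>
      intro a ha
      exact hf.eq_zero_of_succ hM (ih (a + 1) (by omega))
  exact key (M + 1) 0 (by omega) t hl hc (Nat.zero_le _)

end Coloured

end Shuffle

end LieBialg

/-! ### Cocycles on free Lie algebras, and the co-Jacobi defect. -/

namespace LieBialg

noncomputable section

namespace FreeLie

section Cocycle

attribute [local instance 100] LieRing.ofAssociativeRing LieAlgebra.ofAssociativeAlgebra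

variable {K S M : Type*} [Field K] [AddCommGroup M] [Module K M]
  [LieRingModule (FreeLieAlgebra K S) M] [LieModule K (FreeLieAlgebra K S) M]

/-- The subspace is a Lie subalgebra, and by freeness its inclusion has a right inverse. -/
theorem eq_top (N : Submodule K (FreeLieAlgebra K S)) (hof : ∀ s, FreeLieAlgebra.of K s ∈ N)
    (hlie : ∀ x ∈ N, ∀ y ∈ N, ⁅x, y⁆ ∈ N) : N = ⊤ := by
  let N' : LieSubalgebra K (FreeLieAlgebra K S) :=
    { N with lie_mem' := fun {x y} hx hy => hlie x hx y hy }
  let φ : FreeLieAlgebra K S →ₗ⁅K⁆ N' := FreeLieAlgebra.lift K fun s => ⟨FreeLieAlgebra.of K s, hof s⟩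
  have h : N'.incl.comp φ = LieHom.id := FreeLieAlgebra.hom_ext fun s => by
    simp [φ, FreeLieAlgebra.lift_of_apply]
  refine (Submodule.eq_top_iff').2 fun x => ?_
  have := LieHom.congr_fun h x
  rw [LieHom.comp_apply, LieHom.id_apply] at this
  rw [← this]
  exact (φ x).2

/-- The action on `M × K` determined by the action on `M` and the values of a cocycle. -/
def cocycleAux (g : S → M) : FreeLieAlgebra K S →ₗ⁅K⁆ Module.End K (M × K) :=
  FreeLieAlgebra.lift K fun s => LinearMap.inl K M K ∘ₗ
    (LieModule.toEnd K _ M (FreeLieAlgebra.of K s) ∘ₗ LinearMap.fst K M K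
      + LinearMap.toSpanSingleton K M (g s) ∘ₗ LinearMap.snd K M K)

/-- The cocycle with given values at the generators. -/
def cocycle (g : S → M) : FreeLieAlgebra K S →ₗ[K] M :=
  LinearMap.fst K M K ∘ₗ (LinearMap.applyₗ ((0 : M), (1 : K)) ∘ₗ
    (cocycleAux (K := K) g).toLinearMap)

theorem cocycle_apply (g : S → M) (x : FreeLieAlgebra K S) :
    cocycle g x = (cocycleAux g x ((0 : M), (1 : K))).1 := rfl

@[simp] theorem cocycle_of (g : S → M) (s : S) : cocycle g (FreeLieAlgebra.of K s) = g s := by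
  rw [cocycle_apply, cocycleAux, FreeLieAlgebra.lift_of_apply]
  simp

/-- The action stays block triangular: it agrees with the module action on `M`, and its off-diagonal
block is the cocycle. Commutators of such blocks give the cocycle rule. -/
theorem cocycleAux_apply (g : S → M) (x : FreeLieAlgebra K S) (m : M) (r : K) :
    cocycleAux g x (m, r) = (⁅x, m⁆ + r • cocycle g x, 0) := by
  let N : Submodule K (FreeLieAlgebra K S) :=
    { carrier := {x | ∀ m r, cocycleAux g x (m, r) = (⁅x, m⁆ + r • cocycle g x, 0)}
      zero_mem' := fun m r => by simp; rfl
      add_mem' := fun {x y} hx hy m r => by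
        rw [map_add, LinearMap.add_apply, hx, hy, map_add, add_lie, smul_add, Prod.mk_add_mk,
          add_zero, add_add_add_comm]
      smul_mem' := fun c x hx m r => by
        rw [map_smul, LinearMap.smul_apply, hx, map_smul, smul_lie, smul_comm r c, Prod.smul_mk,
          smul_add, smul_zero] }
  have h : N = ⊤ := by
    refine eq_top N (fun s m r => ?_) fun x hx y hy m r => ?_
    · rw [cocycle_of, cocycleAux, FreeLieAlgebra.lift_of_apply]
      simp
    · have key : ∀ m r, cocycleAux g ⁅x, y⁆ (m, r)
          = (⁅⁅x, y⁆, m⁆ + r • (⁅x, cocycle g y⁆ - ⁅y, cocycle g x⁆), 0) := by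
        intro m r
        rw [LieHom.map_lie, LieRing.of_associative_ring_bracket, LinearMap.sub_apply,
          Module.End.mul_apply, Module.End.mul_apply, hx, hy, hx, hy, lie_lie]
        simp only [lie_add, lie_smul, zero_smul, add_zero, Prod.mk_sub_mk, sub_zero, smul_sub]
        congr 1
        abel
      rw [key, cocycle_apply g ⁅x, y⁆, key]
      simp
  exact (h ▸ Submodule.mem_top : x ∈ N) m r

theorem cocycle_lie (g : S → M) (x y : FreeLieAlgebra K S) :
    cocycle g ⁅x, y⁆ = ⁅x, cocycle g y⁆ - ⁅y, cocycle g x⁆ := by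
  rw [cocycle_apply, LieHom.map_lie, LieRing.of_associative_ring_bracket, LinearMap.sub_apply,
    Module.End.mul_apply, Module.End.mul_apply, cocycleAux_apply, cocycleAux_apply,
    cocycleAux_apply, cocycleAux_apply]
  simp

end Cocycle

section CoJacobi

variable {K : Type u} [Field K] {A : Type u} [LieRing A] [LieAlgebra K A]

@[simp] theorem cyc_tmul (x y z : A) : cyc K A (x ⊗ₜ (y ⊗ₜ z)) = y ⊗ₜ[K] (z ⊗ₜ[K] x) := rfl

theorem cyc_lie (x : A) (t : A ⊗[K] (A ⊗[K] A)) : cyc K A ⁅x, t⁆ = ⁅x, cyc K A t⁆ := by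
  induction t with
  | zero => simp
  | add t t' h h' => rw [lie_add, map_add, map_add, lie_add, h, h']
  | tmul a s =>
    induction s with
    | zero => simp
    | add s s' h h' => rw [TensorProduct.tmul_add, lie_add, map_add, map_add, lie_add, h, h']
    | tmul b c =>
      simp only [cyc_tmul, TensorProduct.LieModule.lie_tmul_right, map_add, TensorProduct.tmul_add]
      abel

variable (K A) in
/-- The sum of the cyclic permutations of the factors. -/
def cycSum : A ⊗[K] (A ⊗[K] A) →ₗ[K] A ⊗[K] (A ⊗[K] A) :=
  LinearMap.id + cyc K A + cyc K A ∘ₗ cyc K A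

theorem cycSum_apply (t : A ⊗[K] (A ⊗[K] A)) :
    cycSum K A t = t + cyc K A t + cyc K A (cyc K A t) := rfl

theorem cycSum_lie (x : A) (t : A ⊗[K] (A ⊗[K] A)) : cycSum K A ⁅x, t⁆ = ⁅x, cycSum K A t⁆ := by
  simp only [cycSum_apply, cyc_lie, lie_add]

/-- The action of the second factor of a tensor. -/
def actSnd (s : A ⊗[K] A) : A ⊗[K] A →ₗ[K] A ⊗[K] (A ⊗[K] A) :=
  ((LieModule.toEnd K A (A ⊗[K] A) : A →ₗ[K] Module.End K (A ⊗[K] A)).flip s).lTensor A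

@[simp] theorem actSnd_tmul (s : A ⊗[K] A) (a b : A) :
    actSnd s (a ⊗ₜ b) = a ⊗ₜ[K] ⁅b, s⁆ := rfl

theorem actSnd_add (s s' t : A ⊗[K] A) : actSnd (s + s') t = actSnd s t + actSnd s' t := by
  simp [actSnd, LinearMap.lTensor_add]

theorem actSnd_zero (t : A ⊗[K] A) : actSnd 0 t = 0 := by
  simp [actSnd]

theorem cycSum_actSnd_aux (s t : A ⊗[K] A) :
    cycSum K A (actSnd (s - TensorProduct.comm K A A s) (t - TensorProduct.comm K A A t))
      = cycSum K A (actSnd (t - TensorProduct.comm K A A t) (s - TensorProduct.comm K A A s)) := by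
  induction s with
  | zero => simp [actSnd_zero]
  | add s s' h h' =>
    rw [map_add, add_sub_add_comm, actSnd_add, map_add, h, h', map_add, map_add]
  | tmul a b =>
    induction t with
    | zero => simp [actSnd_zero]
    | add t t' h h' =>
      rw [map_add, add_sub_add_comm, actSnd_add, map_add, map_add, h, h', map_add]
    | tmul c d =>
      have h1 : ⁅c, a⁆ = -⁅a, c⁆ := (lie_skew _ _).symm
      have h2 : ⁅d, a⁆ = -⁅a, d⁆ := (lie_skew _ _).symm
      have h3 : ⁅c, b⁆ = -⁅b, c⁆ := (lie_skew _ _).symm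
      have h4 : ⁅d, b⁆ = -⁅b, d⁆ := (lie_skew _ _).symm
      simp only [TensorProduct.comm_tmul, map_sub, actSnd_tmul, lie_sub, map_add,
        TensorProduct.LieModule.lie_tmul_right, TensorProduct.tmul_sub, TensorProduct.tmul_add,
        cycSum_apply, cyc_tmul, h1, h2, h3, h4, TensorProduct.tmul_neg, TensorProduct.neg_tmul,
        map_neg]
      abel

/-- An antisymmetric tensor is the antisymmetrization of its half, which reduces the claim to pure
tensors. -/
theorem cycSum_actSnd [CharZero K] {s t : A ⊗[K] A} (hs : TensorProduct.comm K A A s = -s)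
    (ht : TensorProduct.comm K A A t = -t) :
    cycSum K A (actSnd s t) = cycSum K A (actSnd t s) := by
  have h : ∀ s : A ⊗[K] A, TensorProduct.comm K A A s = -s →
      (2⁻¹ : K) • s - TensorProduct.comm K A A ((2⁻¹ : K) • s) = s := by
    intro s hs
    rw [map_smul, hs, smul_neg, sub_neg_eq_add, ← add_smul]
    norm_num
  have := cycSum_actSnd_aux ((2⁻¹ : K) • s) ((2⁻¹ : K) • t)
  rwa [h s hs, h t ht] at this

variable {δ : A →ₗ[K] A ⊗[K] A}

theorem lTensor_lie (h : ∀ x y, δ ⁅x, y⁆ = ⁅x, δ y⁆ - ⁅y, δ x⁆) (x : A) (t : A ⊗[K] A) :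
    δ.lTensor A ⁅x, t⁆ = ⁅x, δ.lTensor A t⁆ - actSnd (δ x) t := by
  induction t with
  | zero => simp
  | add t t' h h' => rw [lie_add, map_add, h, h', map_add, map_add, lie_add]; abel
  | tmul a b =>
    simp only [TensorProduct.LieModule.lie_tmul_right, map_add, LinearMap.lTensor_tmul, h,
      actSnd_tmul, TensorProduct.tmul_sub]
    abel

/-- The co-Jacobi defect of a cocycle is itself a cocycle, the cross terms cancelling by
`cycSum_actSnd`. Co-Jacobi therefore needs checking on generators only. -/
theorem cycSum_lTensor_lie [CharZero K] (h : ∀ x y, δ ⁅x, y⁆ = ⁅x, δ y⁆ - ⁅y, δ x⁆)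
    (hδ : ∀ x, TensorProduct.comm K A A (δ x) = -δ x) (x y : A) :
    cycSum K A (δ.lTensor A (δ ⁅x, y⁆))
      = ⁅x, cycSum K A (δ.lTensor A (δ y))⁆ - ⁅y, cycSum K A (δ.lTensor A (δ x))⁆ := by
  rw [h, map_sub, lTensor_lie h, lTensor_lie h, map_sub, map_sub, map_sub, cycSum_lie, cycSum_lie,
    cycSum_actSnd (hδ x) (hδ y)]
  abel

theorem comm_lie (x : A) (t : A ⊗[K] A) :
    TensorProduct.comm K A A ⁅x, t⁆ = ⁅x, TensorProduct.comm K A A t⁆ := by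
  induction t with
  | zero => simp
  | add t t' h h' => rw [lie_add, map_add, h, h', map_add, lie_add]
  | tmul a b =>
    simp only [TensorProduct.LieModule.lie_tmul_right, map_add, TensorProduct.comm_tmul]
    abel

end CoJacobi

end FreeLie

/-! ### Sums over deconcatenations. -/

section Deconc

variable {X V W : Type*} [AddCommGroup V] [AddCommGroup W]

/-- The sum of the values of `F` at the deconcatenations of a word. -/
def deconc {V : Type*} [AddCommGroup V] (F : List X → List X → V) : List X → V
  | [] => F [] []
  | a :: w => F [] (a :: w) + deconc (fun u v => F (a :: u) v) w

theorem deconc_map (φ : V →+ W) (F : List X → List X → V) (w : List X) :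
    deconc (fun u v => φ (F u v)) w = φ (deconc F w) := by
  induction w generalizing F with
  | nil => rfl
  | cons a w ih => rw [deconc, deconc, ih, map_add]

theorem deconc_add (F F' : List X → List X → V) (w : List X) :
    deconc (fun u v => F u v + F' u v) w = deconc F w + deconc F' w := by
  induction w generalizing F F' with
  | nil => rfl
  | cons a w ih => rw [deconc, deconc, deconc, ih, add_add_add_comm]

theorem deconc_zero (w : List X) : deconc (fun _ _ : List X => (0 : V)) w = 0 := by
  simpa using deconc_map (0 : V →+ V) (fun _ _ : List X => (0 : V)) w

theorem deconc_concat (F : List X → List X → V) (w : List X) (b : X) :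
    deconc F (w ++ [b]) = deconc (fun u v => F u (v ++ [b])) w + F (w ++ [b]) [] := by
  induction w generalizing F with
  | nil => rfl
  | cons a w ih => rw [List.cons_append, deconc, deconc, ih, add_assoc]; rfl

theorem deconc_assoc (F : List X → List X → List X → V) (w : List X) :
    deconc (fun u v => deconc (fun u₁ u₂ => F u₁ u₂ v) u) w
      = deconc (fun u v => deconc (F u) v) w := by
  induction w generalizing F with
  | nil => rfl
  | cons a w ih =>
    simp only [deconc, deconc_add]
    rw [ih, add_assoc]

theorem deconc_head {F : List X → List X → V} (h : ∀ u v, u.length ≠ 1 → F u v = 0) (a : X)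
    (w : List X) : deconc F (a :: w) = F [a] w := by
  have h2 : ∀ (a b : X) (w : List X), deconc (fun u v => F (a :: b :: u) v) w = 0 := by
    intro a b w
    rw [← deconc_zero w]
    congr 1
    funext u v
    exact h _ _ (by simp)
  rw [deconc, h [] _ (by simp), zero_add]
  cases w with
  | nil => rfl
  | cons b w => rw [deconc, h2, add_zero]

theorem deconc_last {F : List X → List X → V} (h : ∀ u v, v.length ≠ 1 → F u v = 0) (b : X)
    (w : List X) : deconc F (w ++ [b]) = F w [b] := by
  rw [deconc_concat, h _ [] (by simp), add_zero]
  induction w generalizing F with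
  | nil => rfl
  | cons a w ih =>
    rw [deconc, h _ _ (by simp), zero_add, ih fun u v huv => h _ _ huv]

end Deconc

end

end LieBialg

/-! ### The Lie bialgebra of words and its weight derivations. -/

namespace LieBialg

noncomputable section

theorem deconc_congr {X V : Type*} [AddCommGroup V] {F F' : List X → List X → V} {w : List X}
    (h : ∀ u v, u ++ v = w → F u v = F' u v) : deconc F w = deconc F' w := by
  induction w generalizing F F' with
  | nil => exact h [] [] rfl
  | cons a w ih =>
    rw [deconc, deconc, h [] (a :: w) rfl, ih fun u v huv => h _ _ (by rw [List.cons_append, huv])]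

variable {K X : Type u} [Field K]

variable (K) in
/-- The cobracket of a generator of the Lie bialgebra of words. -/
def wordCobr (w : List X) : FreeLieAlgebra K (List X) ⊗[K] FreeLieAlgebra K (List X) :=
  deconc (fun u v => FreeLieAlgebra.of K u ⊗ₜ[K] FreeLieAlgebra.of K v
    - FreeLieAlgebra.of K v ⊗ₜ[K] FreeLieAlgebra.of K u) w

theorem map_wordCobr {V : Type*} [AddCommGroup V] [Module K V]
    (φ : FreeLieAlgebra K (List X) ⊗[K] FreeLieAlgebra K (List X) →ₗ[K] V) (w : List X) :
    φ (wordCobr K w) = deconc (fun u v => φ (FreeLieAlgebra.of K u ⊗ₜ[K] FreeLieAlgebra.of K v)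
      - φ (FreeLieAlgebra.of K v ⊗ₜ[K] FreeLieAlgebra.of K u)) w := by
  rw [wordCobr, ← LinearMap.toAddMonoidHom_coe, ← deconc_map]
  simp

/-- Deconcatenation is coassociative. After antisymmetrization, the cyclic sum is a difference of
the two groupings of a threefold deconcatenation, and these agree up to the cyclic symmetry of `G`.
-/
theorem wordCobr_coJacobi (w : List X) :
    FreeLie.cycSum K (FreeLieAlgebra K (List X)) ((FreeLie.cocycle (wordCobr K)).lTensor
      (FreeLieAlgebra K (List X)) (wordCobr K w)) = 0 := by
  let a : List X → FreeLieAlgebra K (List X) := FreeLieAlgebra.of K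
  let F : List X → List X → List X →
      FreeLieAlgebra K (List X) ⊗[K] (FreeLieAlgebra K (List X) ⊗[K] FreeLieAlgebra K (List X)) :=
    fun u v z => a u ⊗ₜ (a v ⊗ₜ a z)
  let G : List X → List X → List X →
      FreeLieAlgebra K (List X) ⊗[K] (FreeLieAlgebra K (List X) ⊗[K] FreeLieAlgebra K (List X)) :=
    fun u v z => FreeLie.cycSum K _ (F u v z - F u z v)
  have hG : ∀ u v z, G z u v = G u v z := by
    intro u v z
    simp only [G, F, FreeLie.cycSum_apply, map_sub, FreeLie.cyc_tmul]
    abel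
  have h1 : ∀ u v, FreeLie.cycSum K _ ((FreeLie.cocycle (wordCobr K)).lTensor
      (FreeLieAlgebra K (List X)) (a u ⊗ₜ[K] a v)) = deconc (G u) v := by
    intro u v
    rw [LinearMap.lTensor_tmul, FreeLie.cocycle_of]
    refine (map_wordCobr (FreeLie.cycSum K _ ∘ₗ TensorProduct.mk K _ _ (a u)) v).trans ?_
    refine deconc_congr fun u' v' _ => ?_
    simp only [G, F, map_sub]
    rfl
  refine (map_wordCobr (FreeLie.cycSum K _ ∘ₗ
    (FreeLie.cocycle (wordCobr K)).lTensor (FreeLieAlgebra K (List X))) w).trans ?_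
  simp only [LinearMap.comp_apply]
  have h2 : deconc (fun u v => deconc (G u) v) w = deconc (fun u v => deconc (G v) u) w := by
    rw [← deconc_assoc]
    refine deconc_congr fun u v _ => deconc_congr fun u' v' _ => ?_
    exact (hG _ _ _).symm
  have h3 := deconc_add (fun u v => deconc (G u) v) (fun u v => -deconc (G v) u) w
  rw [← sub_eq_zero] at h2
  refine Eq.trans (Eq.trans (deconc_congr fun u v _ => ?_) h3) ?_
  · rw [h1, h1, sub_eq_add_neg]
  · have h4 := deconc_map (-AddMonoidHom.id _) (fun u v => deconc (G v) u) w
    simp only [AddMonoidHom.neg_apply, AddMonoidHom.id_apply] at h4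
    rw [h4, ← sub_eq_add_neg, h2]

variable (K X) in
/-- The free Lie algebra on the words in `X`, with the cobracket given on the generators by
the antisymmetrized deconcatenation. -/
def wordLBA [CharZero K] : LBA K :=
  have anti : ∀ x, TensorProduct.comm K _ _ (FreeLie.cocycle (wordCobr (X := X) K) x)
      = -FreeLie.cocycle (wordCobr K) x := by
    let N : Submodule K (FreeLieAlgebra K (List X)) :=
      LinearMap.ker ((TensorProduct.comm K _ _).toLinearMap ∘ₗ FreeLie.cocycle (wordCobr (X := X) K)
        + FreeLie.cocycle (wordCobr K))
    have h : N = ⊤ := by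
      refine FreeLie.eq_top N (fun w => ?_) fun x hx y hy => ?_
      · rw [LinearMap.mem_ker, LinearMap.add_apply, LinearMap.comp_apply, FreeLie.cocycle_of]
        have h1 := map_wordCobr (TensorProduct.comm K (FreeLieAlgebra K (List X))
          (FreeLieAlgebra K (List X))).toLinearMap w
        have h2 := map_wordCobr (LinearMap.id : FreeLieAlgebra K (List X) ⊗[K]
          FreeLieAlgebra K (List X) →ₗ[K] _) w
        rw [LinearMap.id_apply] at h2
        rw [h1, h2, ← deconc_add, ← deconc_zero w]
        refine deconc_congr fun u v _ => ?_
        simp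
      · rw [LinearMap.mem_ker, LinearMap.add_apply, LinearMap.comp_apply,
          LinearEquiv.coe_coe, add_eq_zero_iff_eq_neg] at hx hy ⊢
        rw [FreeLie.cocycle_lie, map_sub, FreeLie.comm_lie, FreeLie.comm_lie, hx, hy, lie_neg,
          lie_neg]
        abel
    intro x
    have hx : x ∈ N := h ▸ Submodule.mem_top
    exact add_eq_zero_iff_eq_neg.1 hx
  { carrier := FreeLieAlgebra K (List X)
    cobracket := FreeLie.cocycle (wordCobr K)
    antisymm := anti
    coJacobi := by
      let N : Submodule K (FreeLieAlgebra K (List X)) :=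
        LinearMap.ker (FreeLie.cycSum K _ ∘ₗ (FreeLie.cocycle (wordCobr (X := X) K)).lTensor _ ∘ₗ
          FreeLie.cocycle (wordCobr K))
      have h : N = ⊤ := by
        refine FreeLie.eq_top N (fun w => ?_) fun x hx y hy => ?_
        · rw [LinearMap.mem_ker, LinearMap.comp_apply, LinearMap.comp_apply, FreeLie.cocycle_of]
          exact wordCobr_coJacobi w
        · rw [LinearMap.mem_ker, LinearMap.comp_apply, LinearMap.comp_apply] at hx hy ⊢
          rw [FreeLie.cycSum_lTensor_lie (FreeLie.cocycle_lie _) anti, hx, hy, lie_zero, lie_zero,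
            sub_zero]
      intro x
      have hx : x ∈ N := h ▸ Submodule.mem_top
      exact hx
    cocycle := FreeLie.cocycle_lie _ }

namespace WordLBA

variable [CharZero K]

/-- The generators of the Lie bialgebra of words. -/
def gen (w : List X) : wordLBA K X := FreeLieAlgebra.of K w

theorem eq_top (N : Submodule K (wordLBA K X)) (hof : ∀ w, gen w ∈ N)
    (hlie : ∀ x ∈ N, ∀ y ∈ N, ⁅x, y⁆ ∈ N) : N = ⊤ := FreeLie.eq_top N hof hlie

theorem map_cobracket_gen {V : Type*} [AddCommGroup V] [Module K V]
    (φ : (wordLBA K X) ⊗[K] (wordLBA K X) →ₗ[K] V) (w : List X) :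
    φ ((wordLBA K X).cobracket (gen w))
      = deconc (fun u v => φ (gen u ⊗ₜ[K] gen v) - φ (gen v ⊗ₜ[K] gen u)) w :=
  (congrArg φ (FreeLie.cocycle_of (wordCobr K) w)).trans (map_wordCobr φ w)

/-- The derivation which multiplies the generators by an integral weight. -/
def weight (n : List X → ℕ) : wordLBA K X →ₗ[K] wordLBA K X :=
  @FreeLie.cocycle K (List X) (FreeLieAlgebra K (List X)) _ _ LieAlgebra.toModule _
    lieAlgebraSelfModule fun w => (n w : K) • FreeLieAlgebra.of K w

theorem weight_gen (n : List X → ℕ) (w : List X) :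
    weight n (gen w : wordLBA K X) = (n w : K) • gen w := 
  @FreeLie.cocycle_of K (List X) (FreeLieAlgebra K (List X)) _ _ LieAlgebra.toModule _
    lieAlgebraSelfModule _ w

theorem isDerivation_weight (n : List X → ℕ) : IsDerivation (wordLBA K X) (weight n) := by
  intro x y
  refine (@FreeLie.cocycle_lie K (List X) (FreeLieAlgebra K (List X)) _ _ LieAlgebra.toModule _
    lieAlgebraSelfModule _ x y).trans ?_
  change ⁅x, weight n y⁆ - ⁅y, weight n x⁆ = _
  rw [← lie_skew (weight n x), sub_eq_add_neg, add_comm]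

/-- If two elements satisfy the coderivation identity, so does their bracket, because both sides
obey the same expansion through the cocycle identity. -/
theorem isCoderivation_of_gen {E : wordLBA K X →ₗ[K] wordLBA K X}
    (hE : IsDerivation (wordLBA K X) E)
    (h : ∀ w, (wordLBA K X).cobracket (E (gen w)) =
      (TensorProduct.map E LinearMap.id + TensorProduct.map LinearMap.id E :
        (wordLBA K X) ⊗[K] (wordLBA K X) →ₗ[K] (wordLBA K X) ⊗[K] (wordLBA K X))
      ((wordLBA K X).cobracket (gen w))) :
    IsCoderivation (wordLBA K X) E := by
  set D : (wordLBA K X) ⊗[K] (wordLBA K X) →ₗ[K] (wordLBA K X) ⊗[K] (wordLBA K X) :=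
    TensorProduct.map E LinearMap.id + TensorProduct.map LinearMap.id E with hD
  have hDl : ∀ (x : wordLBA K X) t, D ⁅x, t⁆ = ⁅E x, t⁆ + ⁅x, D t⁆ := by
    intro x t
    induction t with
    | zero => simp
    | add t t' h h' => rw [lie_add, map_add, h, h', map_add, lie_add, lie_add]; abel
    | tmul a b =>
      simp only [hD, TensorProduct.LieModule.lie_tmul_right, map_add, LinearMap.add_apply,
        TensorProduct.map_tmul, LinearMap.id_apply, hE _ _, TensorProduct.add_tmul,
        TensorProduct.tmul_add, lie_add]
      abel
  have := eq_top (LinearMap.eqLocus ((wordLBA K X).cobracket ∘ₗ E) (D ∘ₗ (wordLBA K X).cobracket))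
    h fun x hx y hy => ?_
  · refine LinearMap.ext fun x => ?_
    exact (this ▸ Submodule.mem_top : x ∈ _)
  · simp only [LinearMap.mem_eqLocus, LinearMap.comp_apply] at hx hy ⊢
    rw [hE x y, map_add, (wordLBA K X).cocycle, (wordLBA K X).cocycle, (wordLBA K X).cocycle, map_sub,
      hDl, hDl, hx, hy]
    abel

/-- A weight additive under concatenation is distributed over the two parts of every
deconcatenation. -/
theorem isBiderivation_weight {n : List X → ℕ} (hn : ∀ u v, n (u ++ v) = n u + n v) :
    IsBiderivation (wordLBA K X) (weight n) := by
  refine ⟨isDerivation_weight n, isCoderivation_of_gen (isDerivation_weight n) fun w => ?_⟩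
  rw [weight_gen, map_smul, map_cobracket_gen]
  have h1 := map_cobracket_gen ((n w : K) • (LinearMap.id : (wordLBA K X) ⊗[K] (wordLBA K X) →ₗ[K] _)) w
  refine h1.trans (deconc_congr fun u v huv => ?_)
  subst huv
  simp only [LinearMap.smul_apply, LinearMap.id_apply, LinearMap.add_apply, TensorProduct.map_tmul,
    weight_gen, ← TensorProduct.smul_tmul', TensorProduct.tmul_smul, hn, Nat.cast_add, add_smul]
  abel

end WordLBA

end

end LieBialg

/-! ### Naturality, and evaluation of nested brackets in an associative algebra. -/

namespace LieBialg

noncomputable section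

namespace Tens

variable {K : Type u} [Field K] {G : Type u} [AddCommGroup G] [Module K G]

local notation "𝐓" => TensorAlgebra K

theorem tau_succ (i : ℕ) : (tau (i + 1) : Module.End K (𝐓 G)) = lift (tau i) := rfl

theorem tau_mul_of_lt {i k : ℕ} (h : i + 1 < k) (s b : 𝐓 G) :
    tau i (proj k s * b) = tau i (proj k s) * b := by
  induction i generalizing k s with
  | zero =>
    obtain ⟨k, rfl⟩ : ∃ k', k = k' + 2 := ⟨k - 2, by omega⟩
    have : tau 0 ∘ₗ LinearMap.mulRight K b ∘ₗ proj (k + 2)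
        = LinearMap.mulRight K b ∘ₗ tau 0 ∘ₗ (proj (k + 2) : Module.End K (𝐓 G)) := by
      refine ext_head2 (by simp) (fun a => by simp) fun a c t => ?_
      simp [tau, mul_assoc]
    exact LinearMap.congr_fun this s
  | succ i ih =>
    obtain ⟨k, rfl⟩ : ∃ k', k = k' + 1 := ⟨k - 1, by omega⟩
    have : tau (i + 1) ∘ₗ LinearMap.mulRight K b ∘ₗ proj (k + 1)
        = LinearMap.mulRight K b ∘ₗ tau (i + 1) ∘ₗ (proj (k + 1) : Module.End K (𝐓 G)) := by
      refine ext_head (by simp) fun a t => ?_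
      simp only [tau_succ, LinearMap.comp_apply, LinearMap.mulRight_apply, proj_succ_cons,
        mul_assoc, lift_cons, ih (s := t) (show i + 1 < k by omega)]
    exact LinearMap.congr_fun this s

theorem proj_perm (q : FreeAlgebra K ℕ) (k : ℕ) (s : 𝐓 G) :
    proj k (perm q s) = perm q (proj k s) :=
  LinearMap.congr_fun (perm_comm (fun i => (tau_proj i k).symm) q) s

theorem perm_mul_of_mem {k : ℕ} {q : FreeAlgebra K ℕ} (hq : q ∈ permAlg K k) (s b : 𝐓 G) :
    perm q (proj k s * b) = perm q (proj k s) * b := by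
  revert s
  refine Algebra.adjoin_induction ?_ ?_ ?_ ?_ hq
  · rintro _ ⟨i, hi, rfl⟩ s
    simpa using tau_mul_of_lt hi s b
  · intro r s
    rw [AlgHom.commutes]
    simp [Module.algebraMap_end_apply]
  · intro x y _ _ hx hy s
    rw [map_add, LinearMap.add_apply, LinearMap.add_apply, hx, hy, add_mul]
  · intro x y _ _ hx hy s
    rw [map_mul perm, Module.End.mul_apply, Module.End.mul_apply, hy, ← proj_perm, hx]

section Naturality

variable {H : Type u} [AddCommGroup H] [Module K H]

/-- The algebra morphism of tensor algebras induced by a linear map. -/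
def mapT (f : G →ₗ[K] H) : 𝐓 G →ₐ[K] 𝐓 H := TensorAlgebra.lift K (TensorAlgebra.ι K ∘ₗ f)

@[simp] theorem mapT_ι (f : G →ₗ[K] H) (a : G) :
    mapT f (TensorAlgebra.ι K a) = TensorAlgebra.ι K (f a) := by simp [mapT]

theorem map_lift (f : G →ₗ[K] H) {F : Module.End K (𝐓 G)} {F' : Module.End K (𝐓 H)}
    (h : ∀ t, mapT f (F t) = F' (mapT f t)) (t : 𝐓 G) :
    mapT f (lift F t) = lift F' (mapT f t) := by
  have : (mapT f).toLinearMap ∘ₗ lift F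
      = lift F' ∘ₗ (mapT f).toLinearMap :=
    ext_head (by simp) fun a t => by simp [h]
  exact LinearMap.congr_fun this t

theorem map_shift (f : G →ₗ[K] H) {F : Module.End K (𝐓 G)} {F' : Module.End K (𝐓 H)}
    (h : ∀ t, mapT f (F t) = F' (mapT f t)) (i : ℕ) (t : 𝐓 G) :
    mapT f (shift i F t) = shift i F' (mapT f t) := by
  induction i generalizing t with
  | zero => exact h t
  | succ i ih => exact map_lift f ih t

theorem map_tau (f : G →ₗ[K] H) (i : ℕ) (t : 𝐓 G) :
    mapT f (tau i t) = tau i (mapT f t) := by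
  refine map_shift f (fun t => ?_) i t
  have : (mapT f).toLinearMap ∘ₗ tau₀ = tau₀ ∘ₗ (mapT f).toLinearMap :=
    ext_head2 (by simp) (fun a => by simp) fun a b t => by simp
  exact LinearMap.congr_fun this t

theorem map_perm (f : G →ₗ[K] H) (q : FreeAlgebra K ℕ) (t : 𝐓 G) :
    mapT f (perm q t) = perm q (mapT f t) := by
  induction q using FreeAlgebra.induction generalizing t with
  | grade0 r => rw [AlgHom.commutes, AlgHom.commutes]; simp [Module.algebraMap_end_apply]
  | grade1 i => rw [perm_ι, perm_ι, map_tau]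
  | mul x y hx hy => rw [map_mul, map_mul, Module.End.mul_apply, Module.End.mul_apply, hx, hy]
  | add x y hx hy => rw [map_add, map_add, LinearMap.add_apply, LinearMap.add_apply, map_add, hx, hy]

theorem map_iterBr (f : G →ₗ[K] H) {β : G →ₗ[K] G →ₗ[K] G} {β' : H →ₗ[K] H →ₗ[K] H}
    (h : ∀ a b, f (β a b) = β' (f a) (f b)) (k : ℕ) (t : 𝐓 G) :
    mapT f (iterBr β k t) = iterBr β' k (mapT f t) := by
  induction k generalizing t with
  | zero => rfl
  | succ k ih =>
    rw [iterBr, iterBr, Module.End.mul_apply, Module.End.mul_apply, ih, mu, mu, map_shift f]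
    intro t
    have : (mapT f).toLinearMap ∘ₗ mu₀ β
        = mu₀ β' ∘ₗ (mapT f).toLinearMap :=
      ext_head2 (by simp) (fun a => by simp) fun a b t => by simp [h]
    exact LinearMap.congr_fun this t

end Naturality

/-- The definition adds the innermost bracket; splitting off the outermost one fits recursion on the
first letter. -/
theorem iterBr_succ (β : G →ₗ[K] G →ₗ[K] G) (k : ℕ) :
    iterBr β (k + 1) = mu₀ β * lift (iterBr β k) := by
  induction k with
  | zero =>
    refine ext_head (by simp [iterBr, mu]) fun a t => ?_
    simp [iterBr, mu]
  | succ k ih =>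
    change iterBr β (k + 1) * mu β (k + 1) = mu₀ β * lift (iterBr β k * mu β k)
    rw [lift_mul, ← mul_assoc, ← ih]
    rfl

theorem cobr_succ (d : G →ₗ[K] G ⊗[K] G) (k : ℕ) :
    LegRelations.cobr (del d) (k + 1) = lift (LegRelations.cobr (del d) k) * del₀ d := by
  induction k with
  | zero =>
    refine ext_head (by simp [LegRelations.cobr, del]) fun a t => ?_
    simp only [LegRelations.cobr, del, shift_zero, mul_one, Module.End.mul_apply, del₀_cons]
    exact mul₂_ext (f := LinearMap.id) (d a) t fun a b => by simp
  | succ k ih =>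
    change del d (k + 1) * LegRelations.cobr (del d) (k + 1)
      = lift (del d k * LegRelations.cobr (del d) k) * del₀ d
    rw [lift_mul, mul_assoc, ← ih]
    rfl

section Eval

variable {R : Type u} [Ring R] [Algebra K R]

/-- The linear map which is `c` on vectors and vanishes in the other degrees. -/
def onVectors (c : G →ₗ[K] R) : 𝐓 G →ₗ[K] R :=
  headRec (LinearMap.smulRightₗ (TensorAlgebra.algebraMapInv (R := K) (M := G)).toLinearMap ∘ₗ c)

@[simp] theorem onVectors_one (c : G →ₗ[K] R) : onVectors c 1 = 0 := by simp [onVectors]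
@[simp] theorem onVectors_cons (c : G →ₗ[K] R) (a : G) (t : 𝐓 G) :
    onVectors c (TensorAlgebra.ι K a * t) = TensorAlgebra.algebraMapInv t • c a := by
  simp [onVectors]
@[simp] theorem onVectors_ι (c : G →ₗ[K] R) (a : G) :
    onVectors c (TensorAlgebra.ι K a) = c a := by
  rw [← mul_one (TensorAlgebra.ι K a), onVectors_cons, map_one, one_smul]

/-- The map `p ⊗ ⋯ ⊗ p ⊗ c` on the tensors of degree `k + 1`. -/
def evalT (p c : G →ₗ[K] R) : ℕ → 𝐓 G →ₗ[K] 𝐓 R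
  | 0 => headRec (LinearMap.smulRightₗ
      (TensorAlgebra.algebraMapInv (R := K) (M := G)).toLinearMap ∘ₗ TensorAlgebra.ι K ∘ₗ c)
  | k + 1 => headRec ((LinearMap.mul K (𝐓 R)).compl₂ (evalT p c k) ∘ₗ TensorAlgebra.ι K ∘ₗ p)

variable (p c : G →ₗ[K] R)

@[simp] theorem evalT_one (k : ℕ) : evalT p c k 1 = 0 := by
  cases k <;> simp [evalT]
@[simp] theorem evalT_zero_cons (a : G) (t : 𝐓 G) : evalT p c 0 (TensorAlgebra.ι K a * t)
    = TensorAlgebra.algebraMapInv t • TensorAlgebra.ι K (c a) := by simp [evalT]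
@[simp] theorem evalT_succ_cons (k : ℕ) (a : G) (t : 𝐓 G) :
    evalT p c (k + 1) (TensorAlgebra.ι K a * t) = TensorAlgebra.ι K (p a) * evalT p c k t := by
  simp [evalT]

theorem evalT_tau {i k : ℕ} (h : i + 1 < k) (t : 𝐓 G) :
    evalT p c k (tau i t) = tau i (evalT p c k t) := by
  induction i generalizing k t with
  | zero =>
    obtain ⟨k, rfl⟩ : ∃ k', k = k' + 2 := ⟨k - 2, by omega⟩
    have : evalT p c (k + 2) ∘ₗ tau 0 = tau 0 ∘ₗ evalT p c (k + 2) := by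
      refine ext_head2 (by simp [tau]) (fun a => ?_) fun a b t => by simp [tau]
      rw [← mul_one (TensorAlgebra.ι K a)]
      simp only [LinearMap.comp_apply, evalT_succ_cons, evalT_one, mul_zero, map_zero]
      simp [tau]
    exact LinearMap.congr_fun this t
  | succ i ih =>
    obtain ⟨k, rfl⟩ : ∃ k', k = k' + 1 := ⟨k - 1, by omega⟩
    have : evalT p c (k + 1) ∘ₗ tau (i + 1) = tau (i + 1) ∘ₗ evalT p c (k + 1) := by
      refine ext_head (by simp [tau_succ]) fun a t => ?_
      simp [tau_succ, ih (show i + 1 < k by omega)]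
    exact LinearMap.congr_fun this t

theorem evalT_perm {k : ℕ} {q : FreeAlgebra K ℕ} (hq : q ∈ permAlg K k) (t : 𝐓 G) :
    evalT p c k (perm q t) = perm q (evalT p c k t) := by
  revert t
  refine Algebra.adjoin_induction ?_ ?_ ?_ ?_ hq
  · rintro _ ⟨i, hi, rfl⟩ t
    simpa using evalT_tau p c hi t
  · intro r t
    rw [AlgHom.commutes, AlgHom.commutes]
    simp [Module.algebraMap_end_apply]
  · intro x y _ _ hx hy t
    rw [map_add, map_add, LinearMap.add_apply, LinearMap.add_apply, map_add, hx, hy]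
  · intro x y _ _ hx hy t
    rw [map_mul, map_mul, Module.End.mul_apply, Module.End.mul_apply, hx, hy]

variable (K R) in
/-- The multiplication map on the tensor algebra of an algebra. -/
def mulT : 𝐓 R →ₐ[K] R := TensorAlgebra.lift K LinearMap.id

@[simp] theorem mulT_ι (r : R) : mulT K R (TensorAlgebra.ι K r) = r := by simp [mulT]

variable {p c} {β : G →ₗ[K] G →ₗ[K] G}

theorem onVectors_mu₀ {c : G →ₗ[K] R} (hc : ∀ a b, c (β a b) = p a * c b - p b * c a) (a : G)
    (u : 𝐓 G) : onVectors c (mu₀ β (TensorAlgebra.ι K a * u))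
      = p a * onVectors c u - onVectors p u * c a := by
  have : onVectors c ∘ₗ mu₀ β ∘ₗ LinearMap.mulLeft K (TensorAlgebra.ι K a)
      = LinearMap.mulLeft K (p a) ∘ₗ onVectors c - LinearMap.mulRight K (c a) ∘ₗ onVectors p := by
    refine ext_head (by simp) fun b t => ?_
    simp [hc, smul_sub]
  exact LinearMap.congr_fun this u

/-- Since `p` kills the image of `E`, it kills every nested bracket with `E` innermost. In the rule
for `c` the term `p b * c a` then disappears at each step, and the nested bracket becomes the plain
product of the values of `p` with one final value of `c`. -/
theorem onVectors_iterBr (hp : ∀ a b, p (β a b) = p a * p b - p b * p a)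
    (hc : ∀ a b, c (β a b) = p a * c b - p b * c a) {E : Module.End K G}
    (hpE : ∀ a, p (E a) = 0) (hcE : ∀ a, c (E a) = c a) (k : ℕ) (t : 𝐓 G) :
    onVectors p (iterBr β k (shift k (head E) t)) = 0 ∧
      onVectors c (iterBr β k (shift k (head E) t)) = mulT K R (evalT p c k t) := by
  have key : onVectors p ∘ₗ iterBr β k ∘ₗ shift k (head E) = 0 ∧
      onVectors c ∘ₗ iterBr β k ∘ₗ shift k (head E) = (mulT K R).toLinearMap ∘ₗ evalT p c k := by
    induction k with
    | zero =>
      constructor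
      · exact ext_head (by simp [iterBr]) fun a t => by simp [iterBr, hpE]
      · exact ext_head (by simp [iterBr]) fun a t => by simp [iterBr, hcE]
    | succ k ih =>
      have h1 := fun t => LinearMap.congr_fun ih.1 t
      have h2 := fun t => LinearMap.congr_fun ih.2 t
      simp only [LinearMap.comp_apply, LinearMap.zero_apply, AlgHom.toLinearMap_apply] at h1 h2
      constructor
      · refine ext_head (by simp [iterBr_succ, shift_succ]) fun a t => ?_
        simp only [LinearMap.comp_apply, shift_succ, lift_cons, iterBr_succ, Module.End.mul_apply]
        rw [onVectors_mu₀ hp, h1]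
        simp
      · refine ext_head (by simp [iterBr_succ, shift_succ]) fun a t => ?_
        simp only [LinearMap.comp_apply, shift_succ, lift_cons, iterBr_succ, Module.End.mul_apply]
        rw [onVectors_mu₀ hc, h1, h2]
        simp
  exact ⟨LinearMap.congr_fun key.1 t, LinearMap.congr_fun key.2 t⟩

/-- All Lie brackets are gone on the right: `q` only permutes factors in the tensor algebra of `R`
before they are multiplied. -/
theorem apply_combEnd (hp : ∀ a b, p (β a b) = p a * p b - p b * p a)
    (hc : ∀ a b, c (β a b) = p a * c b - p b * c a) {E : Module.End K G}
    (hpE : ∀ a, p (E a) = 0) (hcE : ∀ a, c (E a) = c a) (d : G →ₗ[K] G ⊗[K] G) {k : ℕ}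
    {q : FreeAlgebra K ℕ} (hq : q ∈ permAlg K k) (a : G) :
    c (combEnd β d k q E a) = mulT K R (perm q (evalT p c k
      (LegRelations.cobr (del d) k (TensorAlgebra.ι K a)))) := by
  rw [← onVectors_ι c, ι_combEnd, comb, ← mul_assoc (perm q), ← shift_perm hq]
  simp only [Module.End.mul_apply]
  rw [(onVectors_iterBr hp hc hpE hcE k _).2, evalT_perm p c hq]

end Eval

end Tens

end

end LieBialg

/-! ### The triangular representation of words, and iterated cobrackets of generators. -/

namespace LieBialg

noncomputable section

namespace Tens

variable {K : Type u} [Field K] {G : Type u} [AddCommGroup G] [Module K G]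
  {R : Type u} [Ring R] [Algebra K R] (p c : G →ₗ[K] R) (d : G →ₗ[K] G ⊗[K] G)

/-- The map `p ⊗ ⋯ ⊗ p ⊗ c` applied to the iterated cobracket. -/
def evalCobr (k : ℕ) : G →ₗ[K] TensorAlgebra K R :=
  evalT p c k ∘ₗ LegRelations.cobr (del d) k ∘ₗ TensorAlgebra.ι K

/-- The bilinear map in the recursion for `evalCobr`. -/
def evalStep (k : ℕ) : G ⊗[K] G →ₗ[K] TensorAlgebra K R :=
  TensorProduct.lift ((LinearMap.mul K (TensorAlgebra K R)).compl₁₂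
    (TensorAlgebra.ι K ∘ₗ p) (evalCobr p c d k))

@[simp] theorem evalStep_tmul (k : ℕ) (a b : G) :
    evalStep p c d k (a ⊗ₜ b) = TensorAlgebra.ι K (p a) * evalCobr p c d k b := rfl

theorem evalCobr_zero (a : G) : evalCobr p c d 0 a = TensorAlgebra.ι K (c a) := by
  have := evalT_zero_cons p c a 1
  rw [mul_one, map_one, one_smul] at this
  exact this

theorem evalCobr_succ (k : ℕ) (a : G) :
    evalCobr p c d (k + 1) a = evalStep p c d k (d a) := by
  have h : ∀ s : G ⊗[K] G, evalT p c (k + 1) (lift (LegRelations.cobr (del d) k) (mul₂ s))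
      = evalStep p c d k s := by
    intro s
    induction s with
    | zero => simp
    | add s s' h h' => simp only [map_add, h, h']
    | tmul a b => simp [evalCobr]
  rw [← h, evalCobr, LinearMap.comp_apply, LinearMap.comp_apply, cobr_succ, Module.End.mul_apply,
    del₀_ι]

end Tens

namespace WordLBA

variable {K : Type u} [Field K]

section Letters

variable [CharZero K] {X : Type u}

attribute [local instance 100] LieRing.ofAssociativeRing LieAlgebra.ofAssociativeAlgebra

/-- The Lie algebra morphism to the free associative algebra which preserves the generators of
length one and kills the other generators. -/
def letters : wordLBA K X →ₗ[K] FreeAlgebra K X :=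
  (FreeLieAlgebra.lift K (fun w : List X => match w with
    | [x] => FreeAlgebra.ι K x
    | _ => 0) : FreeLieAlgebra K (List X) →ₗ⁅K⁆ FreeAlgebra K X).toLinearMap

theorem letters_lie (x y : wordLBA K X) :
    letters ⁅x, y⁆ = letters x * letters y - letters y * letters x :=
  LieHom.map_lie (FreeLieAlgebra.lift K (fun w : List X => match w with
    | [x] => FreeAlgebra.ι K x
    | _ => 0) : FreeLieAlgebra K (List X) →ₗ⁅K⁆ FreeAlgebra K X) x y

theorem letters_gen (x : X) : letters (gen [x] : wordLBA K X) = FreeAlgebra.ι K x :=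
  FreeLieAlgebra.lift_of_apply _ _

theorem letters_gen_of_ne {w : List X} (h : w.length ≠ 1) :
    letters (gen w : wordLBA K X) = 0 := by
  refine (FreeLieAlgebra.lift_of_apply _ _).trans ?_
  rcases w with _ | ⟨x, _ | ⟨y, w⟩⟩
  · rfl
  · simp at h
  · rfl

end Letters

section Eval

variable {Y R : Type u} [Ring R] [Algebra K R] (ν : Y → R)

/-- The representation of the free algebra by triangular matrices. -/
def mat : FreeAlgebra K (Option Y) →ₐ[K] Matrix (Fin 2) (Fin 2) R :=
  -- The corner entry of a product of letters is non-zero only if `none` occurs once, at the end; it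
  -- is then the product of the values `ν y` of the other letters.
  FreeAlgebra.lift K fun o => o.elim !![0, 1; 0, 0] fun y => !![ν y, 0; 0, 0]

theorem mat_none : mat ν (FreeAlgebra.ι K none) = !![0, 1; 0, 0] := by simp [mat]
theorem mat_some (y : Y) : mat ν (FreeAlgebra.ι K (some y)) = !![ν y, 0; 0, 0] := by simp [mat]

/-- The tensor attached to a word. -/
def word (l : List Y) : TensorAlgebra K R := (l.map fun y => TensorAlgebra.ι K (ν y)).prod

@[simp] theorem word_nil : (word ν [] : TensorAlgebra K R) = 1 := rfl
@[simp] theorem word_cons (y : Y) (l : List Y) :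
    (word ν (y :: l) : TensorAlgebra K R) = TensorAlgebra.ι K (ν y) * word ν l := by simp [word]

variable [CharZero K]

/-- The diagonal entry. -/
def psi : wordLBA K (Option Y) →ₗ[K] R :=
  Matrix.entryLinearMap K R 0 0 ∘ₗ (mat ν).toLinearMap ∘ₗ letters

/-- The corner entry. -/
def corner : wordLBA K (Option Y) →ₗ[K] R :=
  Matrix.entryLinearMap K R 0 1 ∘ₗ (mat ν).toLinearMap ∘ₗ letters

theorem psi_apply (x : wordLBA K (Option Y)) : psi ν x = mat ν (letters x) 0 0 := rfl
theorem corner_apply (x : wordLBA K (Option Y)) : corner ν x = mat ν (letters x) 0 1 := rfl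

/-- Matrices with zero second row are stable under commutators and contain the images of the
generators. This makes the diagonal entry a Lie morphism and the corner entry a cocycle over it. -/
theorem mat_row (x : wordLBA K (Option Y)) (j : Fin 2) : mat ν (letters x) 1 j = 0 := by
  let N : Submodule K (wordLBA K (Option Y)) :=
    { carrier := {x | ∀ j, mat ν (letters x) 1 j = 0}
      zero_mem' := fun j => by simp
      add_mem' := fun {x y} hx hy j => by simp [hx j, hy j]
      smul_mem' := fun r x hx j => by simp [hx j] }
  have h : N = ⊤ := by
    refine eq_top N (fun w j => ?_) fun x hx y hy j => ?_
    · by_cases hw : w.length = 1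
      · obtain ⟨o, rfl⟩ := List.length_eq_one_iff.1 hw
        rw [letters_gen]
        cases o with
        | none => rw [mat_none]; fin_cases j <;> simp
        | some y => rw [mat_some]; fin_cases j <;> simp
      · rw [letters_gen_of_ne hw, map_zero]
        rfl
    · rw [letters_lie, map_sub, map_mul, map_mul, Matrix.sub_apply, Matrix.mul_apply,
        Matrix.mul_apply, Fin.sum_univ_two, Fin.sum_univ_two, hx, hx, hy, hy]
      simp [show ∀ j, mat ν (letters x) 1 j = 0 from hx, show ∀ j, mat ν (letters y) 1 j = 0 from hy]
  exact (h ▸ Submodule.mem_top : x ∈ N) j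

theorem psi_lie (x y : wordLBA K (Option Y)) :
    psi ν ⁅x, y⁆ = psi ν x * psi ν y - psi ν y * psi ν x := by
  simp only [psi_apply, letters_lie, map_sub, map_mul, Matrix.sub_apply, Matrix.mul_apply,
    Fin.sum_univ_two, mat_row, mul_zero, add_zero]

theorem corner_lie (x y : wordLBA K (Option Y)) :
    corner ν ⁅x, y⁆ = psi ν x * corner ν y - psi ν y * corner ν x := by
  simp only [corner_apply, psi_apply, letters_lie, map_sub, map_mul, Matrix.sub_apply,
    Matrix.mul_apply, Fin.sum_univ_two, mat_row, mul_zero, add_zero]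

theorem psi_gen_of_ne {w : List (Option Y)} (h : w.length ≠ 1) :
    psi ν (gen w : wordLBA K (Option Y)) = 0 := by
  rw [psi_apply, letters_gen_of_ne h, map_zero]; rfl

theorem corner_gen_of_ne {w : List (Option Y)} (h : w.length ≠ 1) :
    corner ν (gen w : wordLBA K (Option Y)) = 0 := by
  rw [corner_apply, letters_gen_of_ne h, map_zero]; rfl

theorem psi_none : psi ν (gen [none] : wordLBA K (Option Y)) = 0 := by
  rw [psi_apply, letters_gen, mat_none]; rfl
theorem psi_some (y : Y) : psi ν (gen [some y] : wordLBA K (Option Y)) = ν y := by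
  rw [psi_apply, letters_gen, mat_some]; rfl
theorem corner_none : corner ν (gen [none] : wordLBA K (Option Y)) = 1 := by
  rw [corner_apply, letters_gen, mat_none]; rfl
theorem corner_some (y : Y) : corner ν (gen [some y] : wordLBA K (Option Y)) = 0 := by
  rw [corner_apply, letters_gen, mat_some]; rfl

variable (K) in
/-- The number of letters `none`, as a derivation. -/
def countNone : wordLBA K (Option Y) →ₗ[K] wordLBA K (Option Y) :=
  weight fun w => w.countP fun o => o.isNone

theorem isBiderivation_countNone : IsBiderivation _ (countNone (Y := Y) K) :=
  isBiderivation_weight fun _ _ => List.countP_append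

theorem psi_countNone (x : wordLBA K (Option Y)) : psi ν (countNone K x) = 0 := by
  have h : LinearMap.ker (psi ν ∘ₗ countNone (Y := Y) K) = ⊤ := by
    refine eq_top _ (fun w => ?_) fun x hx y hy => ?_
    · rw [LinearMap.mem_ker, LinearMap.comp_apply, countNone, weight_gen, map_smul]
      by_cases hw : w.length = 1
      · obtain ⟨o, rfl⟩ := List.length_eq_one_iff.1 hw
        cases o with
        | none => rw [psi_none, smul_zero]
        | some y => simp
      · rw [psi_gen_of_ne ν hw, smul_zero]
    · rw [LinearMap.mem_ker, LinearMap.comp_apply] at hx hy ⊢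
      rw [isBiderivation_countNone.1 x y, map_add, psi_lie, psi_lie, hx, hy]
      simp
  exact (h ▸ Submodule.mem_top : x ∈ _)

/-- Every word contributing to the corner contains `none` exactly once. -/
theorem corner_countNone (x : wordLBA K (Option Y)) : corner ν (countNone K x) = corner ν x := by
  have h : LinearMap.eqLocus (corner ν ∘ₗ countNone (Y := Y) K) (corner ν) = ⊤ := by
    refine eq_top _ (fun w => ?_) fun x hx y hy => ?_
    · rw [LinearMap.mem_eqLocus, LinearMap.comp_apply, countNone, weight_gen, map_smul]
      by_cases hw : w.length = 1
      · obtain ⟨o, rfl⟩ := List.length_eq_one_iff.1 hw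
        cases o with
        | none => simp
        | some y => rw [corner_some, smul_zero]
      · rw [corner_gen_of_ne ν hw, smul_zero]
    · rw [LinearMap.mem_eqLocus, LinearMap.comp_apply] at hx hy ⊢
      rw [isBiderivation_countNone.1 x y, map_add, corner_lie, corner_lie, corner_lie, hx, hy,
        psi_countNone, psi_countNone]
      simp only [zero_mul, zero_sub, sub_zero]
      abel
  exact (h ▸ Submodule.mem_top : x ∈ _)

/-- The image of the iterated cobracket in the tensor algebra of `R`. -/
def tens (k : ℕ) : wordLBA K (Option Y) →ₗ[K] TensorAlgebra K R :=
  Tens.evalCobr (psi ν) (corner ν) (wordLBA K (Option Y)).cobracket k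

theorem tens_zero (x : wordLBA K (Option Y)) : tens ν 0 x = TensorAlgebra.ι K (corner ν x) :=
  Tens.evalCobr_zero _ _ _ x

theorem tens_succ (k : ℕ) (x : wordLBA K (Option Y)) :
    tens ν (k + 1) x = Tens.evalStep (psi ν) (corner ν) (wordLBA K (Option Y)).cobracket k
      ((wordLBA K (Option Y)).cobracket x) := Tens.evalCobr_succ _ _ _ k x

theorem step_tmul (k : ℕ) (x y : wordLBA K (Option Y)) :
    Tens.evalStep (psi ν) (corner ν) (wordLBA K (Option Y)).cobracket k (x ⊗ₜ y)
      = TensorAlgebra.ι K (psi ν x) * tens ν k y := rfl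

variable (K) in
/-- The generator attached to a word without the letter `none`. -/
def plain (w : List Y) : wordLBA K (Option Y) := gen (w.map some)

variable (K) in
/-- The generator attached to a word followed by the letter `none`. -/
def starred (w : List Y) : wordLBA K (Option Y) := gen (w.map some ++ [none])

theorem psi_starred (v : List Y) : psi ν (starred K v) = 0 := by
  cases v with
  | nil => exact psi_none ν
  | cons a v => exact psi_gen_of_ne ν (by simp)

theorem psi_plain_of_ne {w : List Y} (h : w.length ≠ 1) :
    psi ν (plain K w) = 0 := psi_gen_of_ne ν (by simpa using h)

theorem psi_plain (y : Y) : psi ν (plain K [y]) = ν y := psi_some ν y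

theorem psi_lie_starred (x : wordLBA K (Option Y)) (v : List Y) : psi ν ⁅x, starred K v⁆ = 0 := by
  rw [psi_lie, psi_starred]; simp

theorem corner_plain (w : List Y) : corner ν (plain K w) = 0 := by
  by_cases h : w.length = 1
  · obtain ⟨y, rfl⟩ := List.length_eq_one_iff.1 h
    exact corner_some ν y
  · exact corner_gen_of_ne ν (by simpa using h)

theorem corner_starred (v : List Y) :
    corner ν (starred K v) = if v = [] then 1 else 0 := by
  cases v with
  | nil => exact corner_none ν
  | cons a v => exact corner_gen_of_ne ν (by simp)

end Eval

end WordLBA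

theorem deconc_map_list {X Y V : Type*} [AddCommGroup V] (f : X → Y) (F : List Y → List Y → V)
    (w : List X) : deconc F (w.map f) = deconc (fun u v => F (u.map f) (v.map f)) w := by
  induction w generalizing F with
  | nil => rfl
  | cons a w ih => rw [List.map_cons, deconc, deconc, ih]; rfl

theorem deconc_sub {X V : Type*} [AddCommGroup V] (F F' : List X → List X → V) (w : List X) :
    deconc (fun u v => F u v - F' u v) w = deconc F w - deconc F' w := by
  rw [eq_sub_iff_add_eq, ← deconc_add]
  simp

/-- A function of the first letter and of the rest of a word, zero on the empty word. -/
def headTail {X V : Type*} [Zero V] (w : List X) (F : X → List X → V) : V :=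
  match w with
  | [] => 0
  | a :: w => F a w

namespace WordLBA

variable {K : Type u} [Field K] [CharZero K] {Y R : Type u} [Ring R] [Algebra K R] (ν : Y → R)

theorem map_cobracket_plain {V : Type*} [AddCommGroup V] [Module K V]
    (φ : (wordLBA K (Option Y)) ⊗[K] (wordLBA K (Option Y)) →ₗ[K] V) (w : List Y) :
    φ ((wordLBA K (Option Y)).cobracket (plain K w))
      = deconc (fun u v => φ (plain K u ⊗ₜ[K] plain K v) - φ (plain K v ⊗ₜ[K] plain K u)) w := by
  rw [plain, map_cobracket_gen, deconc_map_list]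
  rfl

theorem map_cobracket_starred {V : Type*} [AddCommGroup V] [Module K V]
    (φ : (wordLBA K (Option Y)) ⊗[K] (wordLBA K (Option Y)) →ₗ[K] V) (w : List Y) :
    φ ((wordLBA K (Option Y)).cobracket (starred K w))
      = deconc (fun u v => φ (plain K u ⊗ₜ[K] starred K v) - φ (starred K v ⊗ₜ[K] plain K u)) w
        + (φ (starred K w ⊗ₜ[K] plain K []) - φ (plain K [] ⊗ₜ[K] starred K w)) := by
  rw [starred, map_cobracket_gen, deconc_concat, deconc_map_list]
  rfl

theorem deconc_psi_head (H : List Y → TensorAlgebra K R) (w : List Y) :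
    deconc (fun u v => TensorAlgebra.ι K (psi ν (plain K u)) * H v) w
      = headTail w fun x w' => TensorAlgebra.ι K (ν x) * H w' := by
  cases w with
  | nil => simp [deconc, psi_plain_of_ne, headTail]
  | cons x w =>
    rw [deconc_head (fun u v hu => by rw [psi_plain_of_ne ν hu, map_zero, zero_mul]), psi_plain]
    rfl

theorem deconc_psi_last (H : List Y → TensorAlgebra K R) (w : List Y) :
    deconc (fun u v => TensorAlgebra.ι K (psi ν (plain K v)) * H u) w
      = headTail w.reverse fun x w' => TensorAlgebra.ι K (ν x) * H w'.reverse := by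
  rcases List.eq_nil_or_concat w with rfl | ⟨w, x, rfl⟩
  · simp [deconc, psi_plain_of_ne, headTail]
  · rw [List.concat_eq_append, deconc_last
      (fun u v hu => by rw [psi_plain_of_ne ν hu, map_zero, zero_mul]), psi_plain]
    simp [headTail]

theorem tens_plain (k : ℕ) (w : List Y) : tens ν k (plain K w) = 0 := by
  induction k generalizing w with
  | zero => rw [tens_zero, corner_plain, map_zero]
  | succ k ih =>
    rw [tens_succ, map_cobracket_plain, ← deconc_zero w]
    refine deconc_congr fun u v _ => ?_
    rw [step_tmul, step_tmul, ih, ih, mul_zero, mul_zero, sub_zero]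

/-- Since `psi` sees only one-letter words, successive cobrackets peel off the letters of `v` from
the left, and the final `none` has corner value 1. -/
theorem tens_starred (k : ℕ) (v : List Y) : tens ν k (starred K v)
    = if v.length = k then word ν v * TensorAlgebra.ι K 1 else 0 := by
  induction k generalizing v with
  | zero =>
    rw [tens_zero, corner_starred]
    cases v <;> simp
  | succ k ih =>
    rw [tens_succ, map_cobracket_starred]
    simp only [step_tmul, tens_plain, psi_starred, mul_zero, map_zero, zero_mul, sub_zero,
      psi_plain_of_ne ν (w := ([] : List Y)) (by simp), add_zero, deconc_psi_head, ih]
    cases v with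
    | nil => rfl
    | cons y v =>
      simp only [headTail, List.length_cons, add_left_inj, word_cons]
      split_ifs <;> simp [mul_assoc]

theorem psi_lie_plain_of_ne (w : List Y) {u : List Y} (h : u.length ≠ 1) :
    psi ν ⁅plain K w, plain K u⁆ = 0 := by
  rw [psi_lie, psi_plain_of_ne ν h]; simp

theorem deconc_psi_lie (H : List Y → TensorAlgebra K R) (w v : List Y) :
    deconc (fun u v => TensorAlgebra.ι K (psi ν ⁅plain K w, plain K u⁆) * H v) v
      = if w.length = 1 then headTail w fun x _ => headTail v fun y v' =>
          TensorAlgebra.ι K (ν x * ν y - ν y * ν x) * H v' else 0 := by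
  cases v with
  | nil =>
    rw [deconc, psi_lie_plain_of_ne ν w (by simp), map_zero, zero_mul]
    cases w <;> simp [headTail]
  | cons y v =>
    rw [deconc_head (fun u v hu => by rw [psi_lie_plain_of_ne ν w hu, map_zero, zero_mul]), psi_lie,
      psi_plain]
    split_ifs with h
    · obtain ⟨x, rfl⟩ := List.length_eq_one_iff.1 h
      rw [psi_plain]
      rfl
    · rw [psi_plain_of_ne ν h]
      simp

/-- The recursion for the brackets of generators. -/
theorem tens_lie_succ (k : ℕ) (w v : List Y) :
    tens ν (k + 1) ⁅(plain K w), starred K v⁆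
      = (if w.length = 1 then headTail w fun x _ => headTail v fun y v' =>
          if v'.length = k then TensorAlgebra.ι K (ν x * ν y - ν y * ν x) *
            (word ν v' * TensorAlgebra.ι K 1) else 0 else 0)
        + headTail v (fun y v' => TensorAlgebra.ι K (ν y) * tens ν k ⁅plain K w, starred K v'⁆)
        + headTail w (fun x w' => TensorAlgebra.ι K (ν x) * tens ν k ⁅plain K w', starred K v⁆)
        - headTail w.reverse (fun x w' =>
            TensorAlgebra.ι K (ν x) * tens ν k ⁅plain K w'.reverse, starred K v⁆) := by
  have h1 := map_cobracket_starred (Tens.evalStep (psi ν) (corner ν)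
    (wordLBA K (Option Y)).cobracket k ∘ₗ
      LieModule.toEnd K (wordLBA K (Option Y)) _ (plain K w)) v
  have h2 := map_cobracket_plain (Tens.evalStep (psi ν) (corner ν)
    (wordLBA K (Option Y)).cobracket k ∘ₗ
      LieModule.toEnd K (wordLBA K (Option Y)) _ (starred K v)) w
  simp only [LinearMap.comp_apply, LieModule.toEnd_apply_apply,
    TensorProduct.LieModule.lie_tmul_right, map_add, step_tmul, psi_starred, psi_lie_starred,
    map_zero, zero_mul, tens_plain, mul_zero, sub_zero, add_zero, zero_add,
    psi_plain_of_ne ν (w := ([] : List Y)) (by simp)] at h1 h2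
  -- The cobracket of the bracket, as seen by `psi` in the first factor, detaches the first letter
  -- of `v`, the first letter of `w`, or, with a minus sign, the last letter of `w`; the commutator
  -- term appears when `w` is one letter.
  rw [tens_succ, (wordLBA K (Option Y)).cocycle, map_sub, h1, h2]
  rw [psi_lie_plain_of_ne ν w (by simp), map_zero, zero_mul, sub_zero, add_zero, deconc_add,
    deconc_sub, deconc_psi_lie, deconc_psi_head, deconc_psi_head, deconc_psi_last]
  have e : ∀ u, ⁅starred K v, plain K u⁆ = -⁅plain K u, starred K v⁆ := fun u => (lie_skew _ _).symm
  simp only [e, tens_starred, map_neg, mul_ite, mul_zero, mul_neg]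
  rw [sub_sub_eq_add_sub, add_sub_assoc, add_sub_assoc]
  congr 1
  have n : ∀ (u : List Y) (F : Y → List Y → TensorAlgebra K R),
      headTail u (fun x w' => -F x w') = -headTail u F := by
    intro u F
    cases u <;> simp [headTail]
  rw [n, n]
  abel

end WordLBA

end

end LieBialg

/-! ### Iterated cobrackets of brackets as split sums of shuffles. -/

namespace LieBialg

namespace Shuffle

variable {X V : Type*} [AddCommGroup V]

theorem sh_headTail (f : List X → V) {u v : List X} (h : u ≠ [] ∨ v ≠ []) :
    sh f u v = headTail u (fun a u' => sh (fun t => f (a :: t)) u' v)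
      + headTail v (fun b v' => sh (fun t => f (b :: t)) u v') := by
  rcases u with _ | ⟨a, u⟩
  · rcases v with _ | ⟨b, v⟩
    · simp at h
    · simp [headTail]
  · rcases v with _ | ⟨b, v⟩
    · simp [headTail]
    · rw [sh_cons_cons]; rfl

theorem headTail_add (u : List X) (F F' : X → List X → V) :
    headTail u (fun a u' => F a u' + F' a u') = headTail u F + headTail u F' := by
  cases u <;> simp [headTail]

theorem sh_sh_headTail (f : List X → V) {a b c : List X} (h : a ≠ [] ∨ b ≠ [] ∨ c ≠ []) :
    sh (fun t => sh f t c) a b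
      = headTail c (fun z c' => sh (fun t => sh (fun s => f (z :: s)) t c') a b)
        + headTail a (fun x a' => sh (fun t => sh (fun s => f (x :: s)) t c) a' b)
        + headTail b (fun y b' => sh (fun t => sh (fun s => f (y :: s)) t c) a b') := by
  by_cases hab : a ≠ [] ∨ b ≠ []
  · have h1 : ∀ (x : X) (t : List X), sh f (x :: t) c = sh (fun s => f (x :: s)) t c
        + headTail c (fun z c' => sh (fun s => f (z :: s)) (x :: t) c') := by
      intro x t
      rw [sh_headTail f (Or.inl (by simp))]
      rfl
    rw [sh_headTail _ hab]
    simp only [h1, sh_add, headTail_add]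
    cases c with
    | nil =>
      have h0 : ∀ a b : List X, sh (fun _ => (0 : V)) a b = 0 := fun a b => by
        simpa using sh_map (0 : V →+ V) (fun _ => (0 : V)) a b
      simp only [headTail, h0, zero_add]
      cases a <;> cases b <;> simp
    | cons z c =>
      have h2 := sh_headTail (fun t => sh (fun s => f (z :: s)) t c) hab
      simp only [headTail] at h2 ⊢
      rw [h2]
      abel
  · simp only [ne_eq, not_or, not_not] at hab
    obtain ⟨rfl, rfl⟩ := hab
    cases c with
    | nil => simp at h
    | cons z c => simp [headTail]

theorem sum_map_add' {ι : Type*} (l : List ι) (f g : ι → V) :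
    (l.map fun i => f i + g i).sum = (l.map f).sum + (l.map g).sum := by
  induction l with
  | nil => simp
  | cons a l ih => simp only [List.map_cons, List.sum_cons, ih]; abel

/-- A shuffle of `α`, `β.reverse` and `v` starts with the first letter of `v`, the first letter of
`w` or the last letter of `w`. Removing the latter shortens `β`, whence the minus sign. This is the
recursion of `tens_lie_succ` without its commutator term. -/
theorem splitSum_headTail (f : X → List X → V) {w v : List X} (h : 2 ≤ w.length + v.length) :
    splitSum f w v = headTail v (fun y v' => splitSum (fun x t => f x (y :: t)) w v')
      + headTail w (fun y w' => splitSum (fun x t => f x (y :: t)) w' v)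
      - headTail w.reverse (fun y w' => splitSum (fun x t => f x (y :: t)) w'.reverse v) := by
  have h1 : splitSum f w v = ((splits w).map fun s =>
      (-1 : ℤ) ^ s.2.2.length • headTail v (fun z v' =>
        sh (fun t => sh (fun r => f s.2.1 (z :: r)) t v') s.1 s.2.2.reverse)
      + (-1 : ℤ) ^ s.2.2.length • headTail s.1 (fun z a' =>
        sh (fun t => sh (fun r => f s.2.1 (z :: r)) t v) a' s.2.2.reverse)
      + (-1 : ℤ) ^ s.2.2.length • headTail s.2.2.reverse (fun z b' =>
        sh (fun t => sh (fun r => f s.2.1 (z :: r)) t v) s.1 b')).sum := by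
    refine congrArg List.sum (List.map_congr_left fun s hs => ?_)
    rw [sh_sh_headTail, smul_add, smul_add]
    by_contra! hc
    obtain ⟨h1, h2, h3⟩ := hc
    have := congrArg List.length (eq_of_mem_splits hs)
    simp only [List.reverse_eq_nil_iff] at h2
    simp only [h1, h2, h3, List.nil_append, List.length_cons, List.length_nil] at this h
    omega
  rw [h1, sum_map_add', sum_map_add', sub_eq_add_neg]
  congr 1
  · congr 1
    · cases v with
      | nil => simp [headTail]
      | cons z v => rfl
    · cases w with
      | nil => simp [headTail, splits]
      | cons a w => simp [headTail, splits, splitSum, Function.comp_def]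
  · rcases List.eq_nil_or_concat w with rfl | ⟨w, b, rfl⟩
    · simp [headTail, splits]
    · simp only [List.concat_eq_append, splits_append, List.map_append, List.map_map,
        List.map_cons, List.map_nil, List.sum_append, Function.comp_def, List.reverse_append,
        List.reverse_cons, List.reverse_nil, List.nil_append, List.singleton_append, headTail,
        List.length_append, List.length_cons, List.length_nil, List.reverse_reverse, splitSum,
        zero_add, List.sum_cons, List.sum_nil, smul_zero, add_zero]
      have := map_list_sum (-AddMonoidHom.id V) ((splits w).map fun s =>
        (-1 : ℤ) ^ s.2.2.length • sh (fun t => sh (fun r => f s.2.1 (b :: r)) t v) s.1 s.2.2.reverse)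
      rw [AddMonoidHom.neg_apply, AddMonoidHom.id_apply] at this
      rw [this, List.map_map]
      refine congrArg List.sum (List.map_congr_left fun s _ => ?_)
      simp [pow_succ]

end Shuffle

namespace WordLBA

open Shuffle

variable {K : Type u} [Field K] [CharZero K] {Y R : Type u} [Ring R] [Algebra K R] (ν : Y → R)

/-- The value of a linear map at the tensor of a bracket of generators, when the linear map
vanishes at the words obtained by bracketing two letters. -/
theorem map_tens_lie {V : Type*} [AddCommGroup V] [Module K V] (n : ℕ)
    (f : TensorAlgebra K R →ₗ[K] V) (w v : List Y) (hn : w.length + v.length = n + 1)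
    (hf : ∀ α x β v' y v'', w = α ++ x :: β → v = v' ++ y :: v'' → ∀ l₁ l₂ : List Y,
      (l₁ ++ l₂).Perm (α ++ β ++ v' ++ v'') →
      f (word ν l₁ * (TensorAlgebra.ι K (ν x * ν y - ν y * ν x) *
        (word ν l₂ * TensorAlgebra.ι K 1))) = 0) :
    f (tens ν n ⁅plain K w, starred K v⁆)
      = splitSum (fun x t => f (word ν t * TensorAlgebra.ι K (ν x))) w v := by
  induction n generalizing f w v with
  | zero =>
    rw [tens_zero, corner_lie, psi_starred, zero_mul, sub_zero, corner_starred]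
    rcases w with _ | ⟨x, w⟩
    · rw [psi_plain_of_ne ν (by simp)]
      simp [splitSum, splits]
    · simp only [List.length_cons, zero_add] at hn
      have hw : w = [] := List.length_eq_zero_iff.1 (by omega)
      have hv : v = [] := List.length_eq_zero_iff.1 (by omega)
      subst hw hv
      rw [psi_plain]
      simp [splitSum, splits]
  | succ n ih =>
    have hbr : f (if w.length = 1 then headTail w fun x _ => headTail v fun y v' =>
          if v'.length = n then TensorAlgebra.ι K (ν x * ν y - ν y * ν x) *
            (word ν v' * TensorAlgebra.ι K 1) else 0 else 0) = 0 := by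
      split_ifs with h
      · obtain ⟨x, rfl⟩ := List.length_eq_one_iff.1 h
        cases v with
        | nil => simp [headTail]
        | cons y v =>
          simp only [headTail]
          split_ifs with h'
          · simpa using hf [] x [] [] y v rfl rfl [] v (by simp)
          · simp
      · simp
    rw [tens_lie_succ, map_sub, map_add, map_add, hbr, zero_add, splitSum_headTail _ (by omega)]
    -- Once a letter `z` is split off, the hypothesis for `f` after left multiplication by `z`
    -- follows by adding `z` to the front of `l₁`.
    have key : ∀ (z : Y) (w' v' : List Y), w'.length + v'.length = n + 1 →
        (∀ α x β v₁ y v₂, w' = α ++ x :: β → v' = v₁ ++ y :: v₂ → ∃ α' β' v₁' v₂',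
          w = α' ++ x :: β' ∧ v = v₁' ++ y :: v₂' ∧
            (z :: (α ++ β ++ v₁ ++ v₂)).Perm (α' ++ β' ++ v₁' ++ v₂')) →
        f (TensorAlgebra.ι K (ν z) * tens ν n ⁅plain K w', starred K v'⁆)
          = splitSum (fun x t => f (word ν (z :: t) * TensorAlgebra.ι K (ν x))) w' v' := by
      intro z w' v' hl hex
      have := ih (f ∘ₗ LinearMap.mulLeft K (TensorAlgebra.ι K (ν z))) w' v' hl ?_
      · simpa [mul_assoc] using this
      · intro α x β v₁ y v₂ hw hv l₁ l₂ hp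
        obtain ⟨α', β', v₁', v₂', hw', hv', hp'⟩ := hex α x β v₁ y v₂ hw hv
        have := hf α' x β' v₁' y v₂' hw' hv' (z :: l₁) l₂ ((List.Perm.cons z hp).trans hp')
        simpa [mul_assoc] using this
    congr 1
    · congr 1
      · cases v with
        | nil => simp [headTail]
        | cons z v =>
          refine key z w v (by simp at hn; omega) fun α x β v₁ y v₂ hw hv =>
            ⟨α, β, z :: v₁, v₂, hw, by rw [hv]; rfl, ?_⟩
          have := (List.perm_middle (a := z) (l₁ := α ++ β) (l₂ := v₁ ++ v₂)).symm
          simpa using this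
      · cases w with
        | nil => simp [headTail]
        | cons z w =>
          exact key z w v (by simp at hn; omega) fun α x β v₁ y v₂ hw hv =>
            ⟨z :: α, β, v₁, v₂, by rw [hw]; rfl, hv, by simp⟩
    · rcases List.eq_nil_or_concat w with rfl | ⟨w, z, rfl⟩
      · simp [headTail]
      · rw [List.concat_eq_append, List.reverse_append] at *
        simp only [List.reverse_cons, List.reverse_nil, List.nil_append, List.singleton_append,
          headTail, List.reverse_reverse]
        refine key z w v (by simp at hn; omega) fun α x β v₁ y v₂ hw hv =>
          ⟨α, β ++ [z], v₁, v₂, by rw [hw]; simp, hv, ?_⟩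
        have := (List.perm_middle (a := z) (l₁ := α ++ β) (l₂ := v₁ ++ v₂)).symm
        simpa using this

end WordLBA

end LieBialg

/-! ### Brackets modulo the centre, and the augmentation of words in transpositions. -/

namespace LieBialg

noncomputable section

namespace Tens

variable {K : Type u} [Field K] {G : Type u} [AddCommGroup G] [Module K G]
  {R : Type u} [Ring R] [Algebra K R]

local notation "𝐓" => TensorAlgebra K

theorem algebraMapInv_mapT {H : Type u} [AddCommGroup H] [Module K H] (f : G →ₗ[K] H) (t : 𝐓 G) :
    TensorAlgebra.algebraMapInv (mapT f t) = TensorAlgebra.algebraMapInv t := by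
  have : (TensorAlgebra.algebraMapInv (R := K)).comp (mapT f) = TensorAlgebra.algebraMapInv :=
    TensorAlgebra.hom_ext (LinearMap.ext fun a => by simp [TensorAlgebra.algebraMapInv])
  exact DFunLike.congr_fun this t

/-- Iterated brackets only depend on the images of their arguments modulo the centre. -/
theorem onVectors_iterBr_eq_zero {β : G →ₗ[K] G →ₗ[K] G} {p : G →ₗ[K] R}
    (hp : ∀ a b, p (β a b) = p a * p b - p b * p a) (k : ℕ) (t : 𝐓 G)
    (ht : mapT ((LinearMap.ker (LinearMap.mul K R - (LinearMap.mul K R).flip)).mkQ ∘ₗ p) t = 0) :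
    onVectors p (iterBr β (k + 1) t) = 0 := by
  set μ : R →ₗ[K] R →ₗ[K] R := LinearMap.mul K R - (LinearMap.mul K R).flip with hμ
  have hμa : ∀ a b, μ a b = a * b - b * a := fun a b => rfl
  -- `N` is the centre of `R`; the commutator descends to `R ⧸ N` in both arguments.
  set N := LinearMap.ker μ with hN
  let β₁ : (R ⧸ N) →ₗ[K] (R ⧸ N) →ₗ[K] R := N.liftQ (N.liftQ μ le_rfl).flip fun b hb => by
    refine LinearMap.mem_ker.2 (LinearMap.ext fun a => ?_)
    obtain ⟨a, rfl⟩ := N.mkQ_surjective a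
    have h1 : μ b a = 0 := by rw [LinearMap.mem_ker.1 hb]; rfl
    have h2 : μ a b = 0 := by rw [hμa] at h1 ⊢; rw [← neg_sub, h1, neg_zero]
    simpa using h2
  have hβ₁ : ∀ a b, β₁ (N.mkQ b) (N.mkQ a) = a * b - b * a := fun a b => rfl
  let g : 𝐓 (R ⧸ N) →ₗ[K] R := head2 (LinearMap.compr₂ β₁.flip
    (LinearMap.smulRightₗ (TensorAlgebra.algebraMapInv (R := K) (M := R ⧸ N)).toLinearMap))
  have h1 : onVectors p ∘ₗ mu₀ β = g ∘ₗ (mapT (N.mkQ ∘ₗ p)).toLinearMap := by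
    refine ext_head2 (by simp [g]) (fun a => by simp [g]) fun a b t => ?_
    have h2 : β₁ (N.mkQ (p b)) (N.mkQ (p a)) = p a * p b - p b * p a := hβ₁ _ _
    simp only [LinearMap.comp_apply, mu₀_cons, onVectors_cons, hp, g, AlgHom.toLinearMap_apply,
      map_mul, mapT_ι, head2_cons_cons, LinearMap.compr₂_apply, LinearMap.flip_apply, h2,
      LinearMap.smulRightₗ_apply, LinearMap.smulRight_apply, AlgHom.toLinearMap_apply,
      algebraMapInv_mapT]
  have h3 : ∀ t, mapT (N.mkQ ∘ₗ p) (iterBr β k t)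
      = iterBr (LinearMap.compr₂ β₁.flip N.mkQ) k (mapT (N.mkQ ∘ₗ p) t) := by
    refine map_iterBr _ (fun a b => ?_) k
    have h2 : β₁ (N.mkQ (p b)) (N.mkQ (p a)) = p a * p b - p b * p a := hβ₁ _ _
    simp only [LinearMap.comp_apply, hp, LinearMap.compr₂_apply, LinearMap.flip_apply, h2]
  rw [iterBr_succ, Module.End.mul_apply]
  refine (LinearMap.congr_fun h1 _).trans ?_
  -- The inner `k` brackets can be computed in `R ⧸ N`, where the tensor is already zero.
  rw [LinearMap.comp_apply, AlgHom.toLinearMap_apply, map_lift _ h3, ht, map_zero, map_zero]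

theorem proj_list (l : List G) : proj l.length (l.map (TensorAlgebra.ι K)).prod
    = (l.map (TensorAlgebra.ι K)).prod := by
  induction l with
  | nil => simp
  | cons a l ih => simp [ih]

theorem proj_eq_zero_of_forall {M : Type u} [AddCommGroup M] [Module K M] (k : ℕ)
    (F : 𝐓 G →ₗ[K] M) (h : ∀ l : List G, l.length = k → F (l.map (TensorAlgebra.ι K)).prod = 0) :
    F ∘ₗ proj k = 0 := by
  induction k generalizing F with
  | zero => exact ext_head (by simpa using h [] rfl) (by simp)
  | succ k ih =>
    refine ext_head (by simp) fun a t => ?_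
    have := ih (F ∘ₗ LinearMap.mulLeft K (TensorAlgebra.ι K a)) fun l hl => by
      simpa using h (a :: l) (by simp [hl])
    simpa using LinearMap.congr_fun this t

/-- For `R` the tensor algebra itself, multiplication loses nothing; this is why vanishing after
`mulT` implies vanishing of the permutation operator. -/
theorem mulT_mapT_ι (t : 𝐓 G) : mulT K (𝐓 G) (mapT (TensorAlgebra.ι K) t) = t := by
  have : (mulT K (𝐓 G)).comp (mapT (TensorAlgebra.ι K)) = AlgHom.id K (𝐓 G) :=
    TensorAlgebra.hom_ext (LinearMap.ext fun a => by simp)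
  exact DFunLike.congr_fun this t

/-- The augmentation of the algebra of words in transpositions. -/
def permAug : FreeAlgebra K ℕ →ₐ[K] K := FreeAlgebra.lift K fun _ => 1

theorem tau_pow {i k : ℕ} (h : i + 1 < k) (a : G) :
    tau i (TensorAlgebra.ι K a ^ k) = TensorAlgebra.ι K a ^ k := by
  induction i generalizing k with
  | zero =>
    obtain ⟨k, rfl⟩ : ∃ k', k = k' + 2 := ⟨k - 2, by omega⟩
    rw [pow_succ', pow_succ']
    exact tau₀_cons a a _
  | succ i ih =>
    obtain ⟨k, rfl⟩ : ∃ k', k = k' + 1 := ⟨k - 1, by omega⟩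
    rw [pow_succ', tau_succ, lift_cons, ih (by omega)]

theorem perm_pow {k : ℕ} {q : FreeAlgebra K ℕ} (hq : q ∈ permAlg K k) (a : G) :
    perm q (TensorAlgebra.ι K a ^ k) = permAug q • TensorAlgebra.ι K a ^ k := by
  refine Algebra.adjoin_induction ?_ ?_ ?_ ?_ hq
  · rintro _ ⟨i, hi, rfl⟩
    rw [perm_ι, tau_pow hi, permAug, FreeAlgebra.lift_ι_apply, one_smul]
  · intro r
    rw [AlgHom.commutes, AlgHom.commutes]
    rfl
  · intro x y _ _ hx hy
    rw [map_add, map_add, LinearMap.add_apply, hx, hy, add_smul]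
  · intro x y _ _ hx hy
    rw [map_mul perm, map_mul permAug, Module.End.mul_apply, hy, map_smul, hx, smul_smul, mul_comm]

theorem perm_der (E : Module.End K G) (q : FreeAlgebra K ℕ) (t : 𝐓 G) :
    perm q (der E t) = der E (perm q t) :=
  (LinearMap.congr_fun (perm_comm (fun i => der_shift E (der_tau₀ E) i) q) t).symm

theorem mulT_der_pow (y : R) (k : ℕ) :
    mulT K R (der (LinearMap.mulLeft K y) (TensorAlgebra.ι K 1 ^ k)) = (k : K) • y := by
  induction k with
  | zero => simp
  | succ k ih =>
    rw [pow_succ', der_cons, map_add, map_mul, map_mul, ih, map_pow, mulT_ι, mulT_ι]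
    simp [add_smul, add_comm]

end Tens

end

end LieBialg

/-! ### Shuffle relations from the derivation property. -/

namespace LieBialg

noncomputable section

open Tens

namespace WordLBA

open Shuffle

variable {K : Type u} [Field K]

section

variable {Y R : Type u} [Ring R] [Algebra K R] (ν : Y → R)

/-- The value at a word of the multilinear map attached to words in transpositions. -/
def permWord (q : FreeAlgebra K ℕ) (t : List Y) : R := mulT K R (perm q (word ν t))

theorem proj_word (t : List Y) :
    proj t.length (word ν t : TensorAlgebra K R) = word ν t := by
  have := proj_list (K := K) (t.map ν)
  rw [List.length_map, List.map_map] at this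
  exact this

theorem mulT_perm_word {k : ℕ} {q : FreeAlgebra K ℕ} (hq : q ∈ permAlg K k) {t : List Y}
    (ht : t.length = k) (b : TensorAlgebra K R) :
    mulT K R (perm q (word ν t * b)) = permWord ν q t * mulT K R b := by
  subst ht
  rw [← proj_word, perm_mul_of_mem hq, proj_word, map_mul]
  rfl

end

variable [CharZero K]

/-- The consequences of the derivation property used to show that a universal derivation
vanishes, tested on the Lie bialgebras of words. -/
structure IsTest (k : ℕ) (q : FreeAlgebra K ℕ) : Prop where
  mem : q ∈ permAlg K k
  count : ∀ (Y : Type u) (x : wordLBA K (Option Y)),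
    letters (countNone K (combEnd (wordLBA K (Option Y)).br (wordLBA K (Option Y)).cobracket k q
        LinearMap.id x))
      = (k + 1 : K) • letters (combEnd (wordLBA K (Option Y)).br (wordLBA K (Option Y)).cobracket k q
        (countNone K) x)
  lie : ∀ (Y : Type u) (x y : wordLBA K (Option Y)),
    letters (combEnd (wordLBA K (Option Y)).br (wordLBA K (Option Y)).cobracket k q
        LinearMap.id ⁅x, y⁆)
      = letters (⁅combEnd (wordLBA K (Option Y)).br (wordLBA K (Option Y)).cobracket k q
        LinearMap.id x, y⁆ + ⁅x, combEnd (wordLBA K (Option Y)).br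
          (wordLBA K (Option Y)).cobracket k q LinearMap.id y⁆)

section

variable {Y R : Type u} [Ring R] [Algebra K R] (ν : Y → R)

theorem corner_congr {x y : wordLBA K (Option Y)} (h : letters x = letters y) :
    corner ν x = corner ν y := by rw [corner_apply, corner_apply, h]

variable {k : ℕ} {q : FreeAlgebra K ℕ}

theorem corner_combEnd (hq : q ∈ permAlg K k) (x : wordLBA K (Option Y)) :
    corner ν (combEnd (wordLBA K (Option Y)).br (wordLBA K (Option Y)).cobracket k q
      (countNone K) x) = mulT K R (perm q (tens ν k x)) :=
  apply_combEnd (fun a b => psi_lie ν a b) (fun a b => corner_lie ν a b) (psi_countNone ν)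
    (corner_countNone ν) _ hq x

/-- The corner entry is unchanged by `countNone`, so this derivation may be applied first; the test
`count` then moves it into the last slot at the price of the factor `k + 1`. -/
theorem IsTest.corner (h : IsTest k q) (x : wordLBA K (Option Y)) :
    corner ν (combEnd (wordLBA K (Option Y)).br (wordLBA K (Option Y)).cobracket k q
      LinearMap.id x) = (k + 1 : K) • mulT K R (perm q (tens ν k x)) := by
  have h1 := h.count Y x
  rw [← map_smul] at h1
  rw [← corner_countNone, corner_congr ν h1, map_smul, corner_combEnd ν h.mem]

/-- Expanding the corner of the derivation rule, three of the four terms contain `psi` of a starred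
word, `psi` of `w`, or the corner of `w`, all zero. The fourth has the corner of `starred v`, zero
unless `v` is empty. -/
theorem IsTest.mulT_tens_lie (h : IsTest k q) {w v : List Y} (hw : w.length ≠ 1)
    (hv : v ≠ [] ∨ psi ν (combEnd (wordLBA K (Option Y)).br (wordLBA K (Option Y)).cobracket k q
      LinearMap.id (plain K w)) = 0) :
    mulT K R (perm q (tens ν k ⁅plain K w, starred K v⁆)) = 0 := by
  have h1 := h.corner ν ⁅plain K w, starred K v⁆
  rw [corner_congr ν (h.lie Y (plain K w) (starred K v)), map_add, corner_lie, corner_lie,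
    psi_starred, psi_plain_of_ne ν hw, corner_plain, corner_starred] at h1
  have h2 : (k + 1 : K) ≠ 0 := Nat.cast_add_one_ne_zero k
  have h3 : (k + 1 : K) • mulT K R (perm q (tens ν k ⁅plain K w, starred K v⁆)) = 0 := by
    rw [← h1]
    rcases hv with hv | hv
    · simp [hv]
    · simp [hv]
  exact (smul_eq_zero.1 h3).resolve_left h2

/-- Only one-letter words survive `χ`. Since the length is `k + 1`, the word must be cut into single
letters, and the slot containing `y` gives zero. -/
theorem mapT_cobr_plain {H : Type u} [AddCommGroup H] [Module K H]
    (χ : wordLBA K (Option Y) →ₗ[K] H) (hχ : ∀ w : List Y, w.length ≠ 1 → χ (plain K w) = 0)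
    {y : Y} (hy : χ (plain K [y]) = 0) (k : ℕ) {w : List Y} (hw : w.length = k + 1) (hyw : y ∈ w) :
    mapT χ (LegRelations.cobr (del (wordLBA K (Option Y)).cobracket) k
      (TensorAlgebra.ι K (plain K w))) = 0 := by
  induction k generalizing w with
  | zero =>
    obtain ⟨z, rfl⟩ := List.length_eq_one_iff.1 hw
    rw [List.mem_singleton.1 hyw] at hy
    rw [LegRelations.cobr, Module.End.one_apply, mapT_ι, hy, map_zero]
  | succ k ih =>
    have h1 := map_cobracket_plain ((mapT χ).toLinearMap ∘ₗ
      lift (LegRelations.cobr (del (wordLBA K (Option Y)).cobracket) k) ∘ₗ mul₂) w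
    rw [cobr_succ, Module.End.mul_apply, del₀_ι]
    refine h1.trans ?_
    rw [← deconc_zero w]
    have key : ∀ u v, u.length + v.length = w.length → (∀ z, z ∈ w → z ∈ u ∨ z ∈ v) →
        mapT χ (lift (LegRelations.cobr (del (wordLBA K (Option Y)).cobracket) k)
          (mul₂ (plain K u ⊗ₜ[K] plain K v))) = 0 := by
      intro u v huv hm
      rw [mul₂_tmul, lift_cons, map_mul, mapT_ι]
      by_cases hu : u.length = 1
      · obtain ⟨z, rfl⟩ := List.length_eq_one_iff.1 hu
        rcases hm y hyw with h | h
        · rw [← List.mem_singleton.1 h, hy, map_zero, zero_mul]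
        · rw [ih (by simp at huv; omega) h, mul_zero]
      · rw [hχ u hu, map_zero, zero_mul]
    refine deconc_congr fun u v huv => ?_
    simp only [LinearMap.comp_apply, AlgHom.toLinearMap_apply]
    rw [key u v (by rw [← huv, List.length_append]) (fun z hz => by rw [← huv] at hz; simpa using hz),
      key v u (by rw [← huv, List.length_append, add_comm])
        (fun z hz => by rw [← huv] at hz; simpa [or_comm] using hz), sub_zero]

/-- A unit letter is central and occurs in every surviving tensor; as `k ≥ 1` there is at least one
bracket to kill it. -/
theorem psi_combEnd_plain (hk : 1 ≤ k) {y : Y} (hy : ν y = 1) {w : List Y}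
    (hw : w.length = k + 1) (hyw : y ∈ w) :
    psi ν (combEnd (wordLBA K (Option Y)).br (wordLBA K (Option Y)).cobracket k q
      LinearMap.id (plain K w)) = 0 := by
  obtain ⟨k, rfl⟩ : ∃ k', k = k' + 1 := ⟨k - 1, by omega⟩
  rw [← onVectors_ι (psi ν), ι_combEnd, comb, Module.End.mul_apply]
  refine onVectors_iterBr_eq_zero (fun a b => psi_lie ν a b) k _ ?_
  set χ := (LinearMap.ker (LinearMap.mul K R - (LinearMap.mul K R).flip)).mkQ ∘ₗ psi ν with hχ
  rw [Module.End.mul_apply, map_perm, Module.End.mul_apply]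
  have h1 := mapT_cobr_plain χ (fun u hu => by
    rw [hχ, LinearMap.comp_apply, psi_plain_of_ne ν hu, map_zero]) (y := y) (by
    rw [hχ, LinearMap.comp_apply, psi_plain, hy, ← LinearMap.mem_ker, Submodule.ker_mkQ,
      LinearMap.mem_ker]
    exact LinearMap.ext fun a => by simp) (k + 1) hw hyw
  rw [map_shift χ (F := head LinearMap.id) (F' := head LinearMap.id), h1]
  · simp
  · intro t
    have : (mapT χ).toLinearMap ∘ₗ head LinearMap.id = head LinearMap.id ∘ₗ (mapT χ).toLinearMap :=
      ext_head (by simp) fun a t => by simp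
    exact LinearMap.congr_fun this t

/-- This is the derivation property at `⁅plain K w, starred K v⁆`, read through the corner entry.
When `v` is empty, the unit letter in `w` removes the one term that would survive. -/
theorem IsTest.splitSum (h : IsTest k q) (hk : 1 ≤ k) {w v : List Y} (hw : 2 ≤ w.length)
    (hwv : w.length + v.length = k + 1) (hv : v ≠ [] ∨ ∃ y ∈ w, ν y = 1)
    (hbr : ∀ α x β v' y v'', w = α ++ x :: β → v = v' ++ y :: v'' → ∀ l₁ l₂ : List Y,
      (l₁ ++ l₂).Perm (α ++ β ++ v' ++ v'') →
      mulT K R (perm q (word ν l₁ * (TensorAlgebra.ι K (ν x * ν y - ν y * ν x) * word ν l₂))) = 0) :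
    splitSum (fun x t => permWord (K := K) ν q t * ν x) w v = 0 := by
  have h1 := h.mulT_tens_lie ν (w := w) (v := v) (by omega) ?_
  · have h2 := map_tens_lie ν k ((mulT K R).toLinearMap ∘ₗ perm q) w v hwv ?_
    · rw [LinearMap.comp_apply, AlgHom.toLinearMap_apply, h1] at h2
      rw [h2]
      refine congrArg List.sum (List.map_congr_left fun s hs => ?_)
      have hl : w.length = s.1.length + (s.2.2.length + 1) := by
        conv_lhs => rw [eq_of_mem_splits hs]
        simp
      refine congrArg _ (sh_congr fun t ht => sh_congr fun t' ht' => ?_)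
      have e1 := ht.length_eq
      have e2 := ht'.length_eq
      rw [List.length_append] at e1 e2
      rw [List.length_reverse] at e1
      change permWord ν q t' * ν s.2.1
        = mulT K R (perm q (word ν t' * TensorAlgebra.ι K (ν s.2.1)))
      rw [mulT_perm_word ν h.mem (by omega), mulT_ι]
    · intro α x β v' y v'' hw' hv' l₁ l₂ hl
      have h3 := hbr α x β v' y v'' hw' hv' l₁ l₂ hl
      have e1 := hl.length_eq
      have e2 := congrArg List.length hw'
      have e3 := congrArg List.length hv'
      simp only [List.length_append, List.length_cons] at e1 e2 e3
      -- The commutator need not be a value of `ν`, so the tensor is reread as a word over the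
      -- alphabet `R`.
      have h4 : (word ν l₁ * (TensorAlgebra.ι K (ν x * ν y - ν y * ν x) * word ν l₂) :
          TensorAlgebra K R) = word id (l₁.map ν ++ (ν x * ν y - ν y * ν x) :: l₂.map ν) := by
        simp [word, Function.comp_def]
      rw [h4] at h3
      rw [LinearMap.comp_apply, AlgHom.toLinearMap_apply, ← mul_assoc (TensorAlgebra.ι K _),
        ← mul_assoc, h4, mulT_perm_word id h.mem (by simp; omega), permWord, h3, zero_mul]
  · rcases hv with hv | ⟨y, hyw, hy⟩
    · exact Or.inl hv
    · by_cases hv : v = []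
      · subst hv
        exact Or.inr (psi_combEnd_plain ν hk hy (by simpa using hwv) hyw)
      · exact Or.inl hv

end

end WordLBA

end

end LieBialg

/-! ### Words in transpositions that pass the tests act by zero. -/

namespace LieBialg

noncomputable section

open Tens

namespace WordLBA

open Shuffle

variable {K : Type u} [Field K]

/-- Shuffling one letter among units is the Leibniz rule for the derivation that replaces one factor
`1` by `ν y`. -/
theorem sh_singleton {Y R V : Type u} [Ring R] [Algebra K R] [AddCommGroup V] [Module K V]
    (ν : Y → R) (f : TensorAlgebra K R →ₗ[K] V) (y e : Y) (he : ν e = 1) (n : ℕ) :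
    sh (fun t => f (word ν t)) [y] (List.replicate n e)
      = f (der (LinearMap.mulLeft K (ν y)) (TensorAlgebra.ι K 1 ^ (n + 1))) := by
  have hw : ∀ n, (word ν (List.replicate n e) : TensorAlgebra K R) = TensorAlgebra.ι K 1 ^ n := by
    intro n
    simp [word, he]
  induction n generalizing f with
  | zero => simp
  | succ n ih =>
    have := ih (f ∘ₗ LinearMap.mulLeft K (TensorAlgebra.ι K 1))
    rw [List.replicate_succ, sh_cons_cons, sh_nil_left, pow_succ', der_cons, map_add,
      ← List.replicate_succ, word_cons, hw]
    simp only [word_cons, he]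
    simp only [LinearMap.comp_apply, LinearMap.mulLeft_apply, mul_one] at this ⊢
    rw [this]

variable [CharZero K] {k : ℕ} {q : FreeAlgebra K ℕ}

/-- Take `w = [b, a]` and `k - 1` units for `v`, which is non-empty as `k ≥ 2`. The shuffles are
symmetric, so `q` acts on them by its augmentation, and the relation becomes `k` times the
augmentation times `a * b - b * a`, equal to zero. Two matrices do not commute. -/
theorem IsTest.permAug_eq_zero (h : IsTest k q) (hk : 2 ≤ k) : permAug q = 0 := by
  have key : ∀ a b : Matrix (Fin 2) (Fin 2) K, permAug q • (a * b - b * a) = 0 := by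
    intro a b
    have h1 := h.splitSum (id : Matrix (Fin 2) (Fin 2) K → _) (by omega) (w := [b, a]) (v := List.replicate (k - 1) 1)
      (by simp) (by simp; omega) (Or.inl (by
        intro h0
        have := congrArg List.length h0
        simp only [List.length_replicate, List.length_nil] at this
        omega)) ?_
    · have hF : ∀ x y : Matrix (Fin 2) (Fin 2) K, sh (fun t => permWord (K := K) id q t * x) [y] (List.replicate (k - 1) 1)
          = (k : K) • permAug q • (y * x) := by
        intro x y
        have h2 := sh_singleton (K := K) id (LinearMap.mulRight K x ∘ₗ (mulT K _).toLinearMap ∘ₗ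
          perm q) y 1 rfl (k - 1)
        refine h2.trans ?_
        rw [show k - 1 + 1 = k by omega]
        simp only [LinearMap.comp_apply, AlgHom.toLinearMap_apply, LinearMap.mulRight_apply, id]
        rw [perm_der, perm_pow h.mem, map_smul, map_smul, mulT_der_pow, smul_mul_assoc,
          smul_mul_assoc, smul_comm]
      simp only [Shuffle.splitSum, splits, List.map_cons, List.map_nil, List.sum_cons,
        List.sum_nil, List.reverse_nil, List.reverse_cons, List.nil_append, sh_nil_left,
        sh_nil_right, List.length_cons, List.length_nil, zero_add, pow_one, pow_zero, one_smul,
        add_zero, id, hF, neg_smul] at h1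
      have h3 : (k : K) • permAug q • (a * b - b * a) = 0 := by
        rw [smul_sub, smul_sub, sub_eq_zero]
        exact neg_add_eq_zero.1 h1
      exact (smul_eq_zero.1 h3).resolve_left (Nat.cast_ne_zero.2 (by omega))
    · intro α x β v' y v'' hw hv l₁ l₂ hl
      have hy : y ∈ List.replicate (k - 1) (1 : Matrix (Fin 2) (Fin 2) K) := by rw [hv]; simp
      rw [List.eq_of_mem_replicate hy]
      simp
  have h2 := congrFun (congrFun (key !![0, 1; 0, 0] !![0, 0; 1, 0]) 0) 0
  simpa [Matrix.mul_apply, Fin.sum_univ_two] using h2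

theorem IsTest.relations (h : IsTest k q) (hk : 2 ≤ k) (R : Type u) [Ring R] [Algebra K R] :
    Relations (fun t : List (R × ℕ) => permWord (K := K) Prod.fst q t) k where
  zero := by
    rintro t ⟨x, hx, hx0⟩
    have : (word Prod.fst t : TensorAlgebra K R) = 0 :=
      List.prod_eq_zero (List.mem_map.2 ⟨x, hx, by rw [hx0, map_zero]⟩)
    simp only [permWord, this, map_zero]
  ones := by
    intro t ht hl
    have : (word Prod.fst t : TensorAlgebra K R) = TensorAlgebra.ι K 1 ^ k := by
      rw [word, List.map_congr_left (g := fun _ => TensorAlgebra.ι K (1 : R))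
        (fun x hx => by rw [ht x hx]), List.map_const', List.prod_replicate, hl]
    simp only [permWord, this, perm_pow h.mem, h.permAug_eq_zero hk, zero_smul, map_zero]
  rel := by
    intro w v hw hwv hone hbr
    refine h.splitSum Prod.fst (by omega) hw hwv (Or.inr hone) ?_
    intro α x β v' y v'' hw hv l₁ l₂ hl
    have := hbr α x β v' y v'' hw hv (l₁ ++ (x.1 * y.1 - y.1 * x.1, x.2) :: l₂)
      (List.perm_middle.trans ((List.Perm.cons _ hl).trans List.perm_middle.symm))
    simpa [permWord, word] using this

/-- The words in transpositions which pass the tests act by zero. -/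
theorem IsTest.perm_eq_zero (h : IsTest k q) (hk : 2 ≤ k) {G : Type u} [AddCommGroup G]
    [Module K G] (t : TensorAlgebra K G) : perm q (proj k t) = 0 := by
  have h1 : ((mulT K (TensorAlgebra K G)).toLinearMap ∘ₗ perm q ∘ₗ
      (mapT (TensorAlgebra.ι K)).toLinearMap) ∘ₗ proj k = 0 := by
    refine proj_eq_zero_of_forall k _ fun l hl => ?_
    -- All letters have the same colour, so the commutation hypothesis is vacuous for the words of
    -- interest; further colours enter only inside the induction.
    have := (h.relations hk (TensorAlgebra K G)).eq_zero (by omega)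
      (l.map fun a => (TensorAlgebra.ι K a, 0)) (by simpa using hl) (by
        intro x hx y hy hxy
        obtain ⟨a, _, rfl⟩ := List.mem_map.1 hx
        obtain ⟨b, _, rfl⟩ := List.mem_map.1 hy
        exact absurd rfl hxy)
    simpa [permWord, word, map_list_prod, Function.comp_def] using this
  have h2 := LinearMap.congr_fun h1 t
  simp only [LinearMap.comp_apply, AlgHom.toLinearMap_apply] at h2
  rw [← map_perm, mulT_mapT_ι] at h2
  exact h2

end WordLBA

namespace Tens

variable {K : Type u} [Field K] {G : Type u} [AddCommGroup G] [Module K G]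

theorem proj_succ_eq_zero {M : Type u} [AddCommGroup M] [Module K M] (k : ℕ)
    (F : TensorAlgebra K G →ₗ[K] M) (h : ∀ s b, F (proj k s * b) = 0) (n : ℕ) :
    F ∘ₗ proj (k + n) = 0 := by
  induction k generalizing F with
  | zero =>
    refine LinearMap.ext fun t => ?_
    have := h 1 (proj (0 + n) t)
    simpa using this
  | succ k ih =>
    refine ext_head (by simp [show k + 1 + n = (k + n) + 1 by omega]) fun a t => ?_
    have := ih (F ∘ₗ LinearMap.mulLeft K (TensorAlgebra.ι K a)) fun s b => by
      simpa [mul_assoc] using h (TensorAlgebra.ι K a * s) b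
    have := LinearMap.congr_fun this t
    simpa [show k + 1 + n = (k + n) + 1 by omega] using this

theorem combEnd_eq_zero {k : ℕ} {q : FreeAlgebra K ℕ} (hq : q ∈ permAlg K k)
    (h : ∀ t : TensorAlgebra K G, perm q (proj k t) = 0) (β : G →ₗ[K] G →ₗ[K] G)
    (d : G →ₗ[K] G ⊗[K] G) (E : Module.End K G) : combEnd β d k q E = 0 := by
  refine LinearMap.ext fun a => (TensorAlgebra.ι_leftInverse (R := K) (M := G)).injective ?_
  have h1 : (iterBr β k ∘ₗ perm q ∘ₗ shift k (head E)) ∘ₗ proj (k + 1) = 0 := by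
    refine LinearMap.ext fun t => ?_
    have h2 := proj_succ_eq_zero k (iterBr β k ∘ₗ perm q) (fun s b => by
      rw [LinearMap.comp_apply, perm_mul_of_mem hq, h, zero_mul, map_zero]) 1
    have h3 := LinearMap.congr_fun (shift_head_proj E k (k + 1)) t
    simp only [Module.End.mul_apply] at h3
    rw [LinearMap.comp_apply, LinearMap.comp_apply, LinearMap.comp_apply, h3]
    exact LinearMap.congr_fun h2 _
  have h4 : LegRelations.cobr (del d) k (TensorAlgebra.ι K a)
      = proj (k + 1) (LegRelations.cobr (del d) k (TensorAlgebra.ι K a)) := by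
    have := LinearMap.congr_fun (cobr_proj d k 1) (TensorAlgebra.ι K a)
    simp only [Module.End.mul_apply, proj_succ_ι, proj_zero_one, mul_one] at this
    rw [add_comm k 1, ← this]
  rw [ι_combEnd, comb, Module.End.mul_apply, Module.End.mul_apply, Module.End.mul_apply, h4]
  simpa using LinearMap.congr_fun h1 (LegRelations.cobr (del d) k (TensorAlgebra.ι K a))

end Tens

end

end LieBialg

/-! ### Separation of homogeneous components by rescaling the cobracket. -/

namespace LieBialg

noncomputable section

open Tens

namespace Tens

variable {K : Type u} [Field K] {G : Type u} [AddCommGroup G] [Module K G]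

theorem shift_smul (r : K) (i : ℕ) (f : Module.End K (TensorAlgebra K G)) :
    shift i (r • f) = r • shift i f := by
  induction i with
  | zero => rfl
  | succ i ih => rw [shift_succ, ih, lift_smul]; rfl

theorem del_smul (r : K) (d : G →ₗ[K] G ⊗[K] G) (i : ℕ) : del (r • d) i = r • del d i := by
  rw [del, del, ← shift_smul]
  congr 1
  exact ext_head (by simp) fun a t => by simp

theorem cobr_smul (r : K) (d : G →ₗ[K] G ⊗[K] G) (k : ℕ) :
    LegRelations.cobr (del (r • d)) k = r ^ k • LegRelations.cobr (del d) k := by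
  induction k with
  | zero => simp [LegRelations.cobr]
  | succ k ih =>
    rw [LegRelations.cobr, LegRelations.cobr, ih, del_smul, smul_mul_assoc, mul_smul_comm,
      smul_smul, pow_succ']

theorem combEnd_smul (r : K) (β : G →ₗ[K] G →ₗ[K] G) (d : G →ₗ[K] G ⊗[K] G) (k : ℕ)
    (q : FreeAlgebra K ℕ) (E : Module.End K G) (a : G) :
    combEnd β (r • d) k q E a = r ^ k • combEnd β d k q E a := by
  refine (TensorAlgebra.ι_leftInverse (R := K) (M := G)).injective ?_
  rw [map_smul, ι_combEnd, ι_combEnd, comb, comb, cobr_smul, mul_smul_comm, mul_smul_comm,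
    mul_smul_comm, LinearMap.smul_apply]

theorem der_iterBr {β : G →ₗ[K] G →ₗ[K] G} {E : Module.End K G}
    (hE : ∀ a b, E (β a b) = β (E a) b + β a (E b)) (k : ℕ) :
    der E * iterBr β k = iterBr β k * der E := by
  induction k with
  | zero => rfl
  | succ k ih => rw [iterBr, ← mul_assoc, ih, mul_assoc, mu, der_shift E (der_mu₀ hE), ← mul_assoc]

theorem der_cobr {d : G →ₗ[K] G ⊗[K] G} {E : Module.End K G}
    (hE : d ∘ₗ E = (TensorProduct.map E LinearMap.id + TensorProduct.map LinearMap.id E) ∘ₗ d)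
    (k : ℕ) : der E * LegRelations.cobr (del d) k = LegRelations.cobr (del d) k * der E := by
  induction k with
  | zero => rfl
  | succ k ih =>
    rw [LegRelations.cobr, ← mul_assoc, del, der_shift E (der_del₀ hE), mul_assoc, ih, mul_assoc]

theorem combEnd_comm {β : G →ₗ[K] G →ₗ[K] G} {d : G →ₗ[K] G ⊗[K] G} {E : Module.End K G}
    (h1 : ∀ a b, E (β a b) = β (E a) b + β a (E b))
    (h2 : d ∘ₗ E = (TensorProduct.map E LinearMap.id + TensorProduct.map LinearMap.id E) ∘ₗ d)
    (k : ℕ) (q : FreeAlgebra K ℕ) (a : G) :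
    E (combEnd β d k q LinearMap.id a) = combEnd β d k q LinearMap.id (E a) := by
  refine (TensorAlgebra.ι_leftInverse (R := K) (M := G)).injective ?_
  have h3 : der E * shift k (head LinearMap.id) = shift k (head LinearMap.id) * der E :=
    der_shift E (ext_head (by simp) fun a t => by simp) k
  have h4 : der E * comb β d k q LinearMap.id = comb β d k q LinearMap.id * der E := by
    rw [comb, ← mul_assoc, der_iterBr h1, mul_assoc, ← mul_assoc (der E),
      perm_comm (fun i => der_shift E (der_tau₀ E) i), mul_assoc (perm q), ← mul_assoc (der E), h3,
      mul_assoc (shift k _), der_cobr h2]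
    simp only [mul_assoc]
  rw [← der_ι, ι_combEnd, ι_combEnd, ← der_ι]
  exact LinearMap.congr_fun h4 _

theorem permAlg_le_bot {k : ℕ} (hk : k ≤ 1) {q : FreeAlgebra K ℕ} (hq : q ∈ permAlg K k) :
    ∃ r : K, q = algebraMap K _ r := by
  have : permAlg K k = ⊥ := by
    rw [permAlg, ← Algebra.adjoin_empty]
    congr 1
    ext x
    simp only [Set.mem_ofPred_eq, Set.mem_empty_iff_false, iff_false]
    rintro ⟨i, hi, -⟩
    omega
  rw [this] at hq
  obtain ⟨r, hr⟩ := Algebra.mem_bot.1 hq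
  exact ⟨r, hr.symm⟩

theorem combEnd_zero (β : G →ₗ[K] G →ₗ[K] G) (d : G →ₗ[K] G ⊗[K] G) (r : K) (a : G) :
    combEnd β d 0 (algebraMap K _ r) LinearMap.id a = r • a := by
  refine (TensorAlgebra.ι_leftInverse (R := K) (M := G)).injective ?_
  rw [ι_combEnd, comb, AlgHom.commutes, map_smul]
  simp [iterBr, LegRelations.cobr, Module.algebraMap_end_apply]

theorem combEnd_one (β : G →ₗ[K] G →ₗ[K] G) (d : G →ₗ[K] G ⊗[K] G) (r : K) (a : G) :
    combEnd β d 1 (algebraMap K _ r) LinearMap.id a = r • TensorProduct.lift β (d a) := by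
  refine (TensorAlgebra.ι_leftInverse (R := K) (M := G)).injective ?_
  rw [ι_combEnd, comb, AlgHom.commutes, map_smul]
  have : ∀ s : G ⊗[K] G, mu₀ β (lift (head LinearMap.id) (mul₂ s))
      = TensorAlgebra.ι K (TensorProduct.lift β s) := by
    intro s
    induction s with
    | zero => simp
    | add s s' h h' => simp only [map_add, h, h']
    | tmul a b => simp
  have h2 := this (d a)
  simp only [iterBr, LegRelations.cobr, mu, del, shift_zero, one_mul, mul_one,
    Module.End.mul_apply, Module.algebraMap_end_apply, del₀_ι, map_smul, shift_succ]
  rw [← h2]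

end Tens

/-- Every linear form turns the sum into a polynomial vanishing on an infinite field. -/
theorem eq_zero_of_sum_pow {K : Type*} [Field K] [Infinite K] {V : Type*} [AddCommGroup V]
    [Module K V] {n : ℕ} {v : ℕ → V} (h : ∀ t : K, ∑ k ∈ Finset.range n, t ^ k • v k = 0) {k : ℕ}
    (hk : k < n) : v k = 0 := by
  rw [← Module.forall_dual_apply_eq_zero_iff K]
  intro φ
  let p : Polynomial K := ∑ k ∈ Finset.range n, Polynomial.monomial k (φ (v k))
  have hp : p = 0 := Polynomial.funext fun t => by
    have := congrArg φ (h t)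
    simp only [map_sum, map_smul, map_zero, smul_eq_mul] at this
    simp only [p, Polynomial.eval_finsetSum, Polynomial.eval_monomial, Polynomial.eval_zero]
    rw [← this]
    exact Finset.sum_congr rfl fun k _ => mul_comm _ _
  have := congrArg (fun p => Polynomial.coeff p k) hp
  simpa [p, Polynomial.finsetSum_coeff, Polynomial.coeff_monomial, hk] using this

/-- The Lie bialgebra with the same bracket and a multiple of the cobracket. -/
def LBA.scale {K : Type u} [Field K] (A : LBA K) (t : K) : LBA K where
  carrier := A
  cobracket := t • A.cobracket
  antisymm x := by rw [LinearMap.smul_apply, map_smul, A.antisymm, smul_neg]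
  coJacobi x := by
    rw [LinearMap.lTensor_smul, LinearMap.smul_apply, LinearMap.smul_apply, map_smul, map_smul,
      map_smul, map_smul, map_smul, ← smul_add, ← smul_add, ← smul_add, ← smul_add, A.coJacobi,
      smul_zero, smul_zero]
  cocycle x y := by
    rw [LinearMap.smul_apply, LinearMap.smul_apply, LinearMap.smul_apply, lie_smul, lie_smul,
      A.cocycle, smul_sub]

variable {K : Type u} [Field K]

theorem sum_combEnd_scale (A : LBA K) (t : K) (n : ℕ) (q : ℕ → FreeAlgebra K ℕ) (a : A) :
    (∑ k ∈ Finset.range n, (k + 1 : K)⁻¹ •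
      combEnd (A.scale t).br (A.scale t).cobracket k (q k) LinearMap.id (a : A.scale t) : A)
      = ∑ k ∈ Finset.range n, t ^ k • ((k + 1 : K)⁻¹ •
        combEnd A.br A.cobracket k (q k) LinearMap.id a) := by
  refine Finset.sum_congr rfl fun k _ => ?_
  rw [smul_comm (t ^ k)]
  exact congrArg _ (combEnd_smul t A.br A.cobracket k (q k) LinearMap.id a)

variable [CharZero K]

/-- The homogeneous components of a universal derivation are derivations. -/
theorem isDerivation_component {n : ℕ} {q : ℕ → FreeAlgebra K ℕ} {l : EndFamily K}
    (hl : ∀ A a, l A a = ∑ k ∈ Finset.range n, (k + 1 : K)⁻¹ •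
      combEnd A.br A.cobracket k (q k) LinearMap.id a)
    (hd : ∀ A, IsDerivation A (l A)) {k : ℕ} (hk : k < n) (A : LBA K) :
    IsDerivation A (combEnd A.br A.cobracket k (q k) LinearMap.id) := by
  intro x y
  let g : ℕ → A →ₗ[K] A := fun k => (k + 1 : K)⁻¹ •
    combEnd A.br A.cobracket k (q k) LinearMap.id
  have key : ∀ t : K, ∑ k ∈ Finset.range n,
      t ^ k • (g k ⁅x, y⁆ - ⁅g k x, y⁆ - ⁅x, g k y⁆) = 0 := by
    -- The derivation rule is applied to the Lie bialgebra with cobracket multiplied by `t`, where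
    -- the component with `k` cobrackets is multiplied by `t ^ k`.
    intro t
    let L : A →ₗ[K] A := l (A.scale t)
    have h1 : ∀ a : A, L a = ∑ k ∈ Finset.range n, t ^ k • g k a :=
      fun a => (hl (A.scale t) a).trans (sum_combEnd_scale A t n q a)
    have h2 : L ⁅x, y⁆ = ⁅L x, y⁆ + ⁅x, L y⁆ := hd (A.scale t) x y
    rw [h1, h1, h1, sum_lie, lie_sum] at h2
    simp only [smul_sub, Finset.sum_sub_distrib, h2, smul_lie, lie_smul]
    abel
  have := eq_zero_of_sum_pow key hk
  simp only [g, LinearMap.smul_apply, smul_lie, lie_smul, ← smul_sub] at this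
  have := (smul_eq_zero.1 this).resolve_left (inv_ne_zero (Nat.cast_add_one_ne_zero k))
  rw [sub_sub, sub_eq_zero] at this
  exact this

/-- The homogeneous components of a universal coderivation are coderivations. -/
theorem isCoderivation_component {n : ℕ} {q : ℕ → FreeAlgebra K ℕ} {l : EndFamily K}
    (hl : ∀ A a, l A a = ∑ k ∈ Finset.range n, (k + 1 : K)⁻¹ •
      combEnd A.br A.cobracket k (q k) LinearMap.id a)
    (hd : ∀ A, IsCoderivation A (l A)) {k : ℕ} (hk : k < n) (A : LBA K) :
    IsCoderivation A (combEnd A.br A.cobracket k (q k) LinearMap.id) := by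
  refine LinearMap.ext fun x => ?_
  let g : ℕ → A →ₗ[K] A := fun k => (k + 1 : K)⁻¹ •
    combEnd A.br A.cobracket k (q k) LinearMap.id
  let D : (A →ₗ[K] A) →ₗ[K] (A ⊗[K] A →ₗ[K] A ⊗[K] A) :=
    (TensorProduct.mapBilinear (RingHom.id K) A A A A).flip LinearMap.id
      + TensorProduct.mapBilinear (RingHom.id K) A A A A LinearMap.id
  have hD : ∀ f, D f = TensorProduct.map f LinearMap.id + TensorProduct.map LinearMap.id f :=
    fun f => rfl
  -- The coderivation rule contains the rescaled cobracket once on each side, so exponents move up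
  -- by one; the coefficient of `t ^ 0` is filled in as zero.
  have key : ∀ t : K, ∑ k ∈ Finset.range (n + 1),
      t ^ k • (if k = 0 then 0 else
        A.cobracket (g (k - 1) x) - D (g (k - 1)) (A.cobracket x)) = 0 := by
    intro t
    let L : A →ₗ[K] A := l (A.scale t)
    have h1 : L = ∑ k ∈ Finset.range n, t ^ k • g k := by
      refine LinearMap.ext fun a => ((hl (A.scale t) a).trans (sum_combEnd_scale A t n q a)).trans ?_
      simp only [LinearMap.sum_apply]
      rfl
    have h2 : t • A.cobracket (L x) = D L (t • A.cobracket x) :=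
      LinearMap.congr_fun (hd (A.scale t)) x
    rw [h1] at h2
    simp only [map_sum, map_smul, LinearMap.sum_apply, LinearMap.smul_apply, Finset.smul_sum] at h2
    rw [Finset.sum_range_succ']
    simp only [Nat.add_sub_cancel, if_true, smul_zero, add_zero, Nat.add_eq_zero_iff, one_ne_zero,
      and_false, if_false, pow_succ', mul_smul, smul_sub, Finset.sum_sub_distrib, h2, sub_self]
  have := eq_zero_of_sum_pow key (Nat.succ_lt_succ hk)
  simp only [Nat.succ_eq_add_one, Nat.add_eq_zero_iff, one_ne_zero, and_false, if_false,
    Nat.add_sub_cancel, g, LinearMap.smul_apply, map_smul, ← smul_sub] at this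
  have := (smul_eq_zero.1 this).resolve_left (inv_ne_zero (Nat.cast_add_one_ne_zero k))
  exact sub_eq_zero.1 this

end

end LieBialg

/-! ### The composite of bracket and cobracket, and the theorem for derivations. -/

namespace LieBialg

noncomputable section

open Tens

section Converse

variable {K : Type u} [Field K]

theorem bracket_tmul (A : LBA K) (a b : A) : bracket K A (a ⊗ₜ b) = ⁅a, b⁆ := rfl

theorem bracket_lie (A : LBA K) (x : A) (t : A ⊗[K] A) : bracket K A ⁅x, t⁆ = ⁅x, bracket K A t⁆ :=
  LieModuleHom.map_lie (LieModule.toModuleHom K A A) x t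

theorem lift_br (A : LBA K) (t : A ⊗[K] A) : TensorProduct.lift A.br t = bracket K A t := by
  have : TensorProduct.lift A.br = bracket K A := TensorProduct.ext' fun a b => rfl
  rw [this]

theorem isFunctorial_bracketCobracket : IsFunctorial (bracketCobracket K) := by
  intro A B f hf x
  have h1 : ∀ t : A ⊗[K] A, f (bracket K A t)
      = bracket K B (TensorProduct.map (f : A →ₗ[K] B) (f : A →ₗ[K] B) t) := by
    intro t
    induction t with
    | zero => simp
    | add t t' h h' => simp only [map_add, h, h']
    | tmul a b => simp [bracket_tmul]
  exact (h1 _).trans (congrArg _ (LinearMap.congr_fun hf x))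

theorem isUniversal_bracketCobracket : IsUniversal (bracketCobracket K) := by
  have h := Universal.comp (Universal.bracket (K := K)) Universal.cobracket
  have e : (fun A : LBA K => (powOne A).symm.toLinearMap ∘ₗ bracketCobracket K A ∘ₗ
      (powOne A).toLinearMap) = fun A => ((powOne A).symm.toLinearMap ∘ₗ LieBialg.bracket K A ∘ₗ
        (powTwo A).toLinearMap) ∘ₗ ((powTwo A).symm.toLinearMap ∘ₗ A.cobracket ∘ₗ
          (powOne A).toLinearMap) := by
    funext A
    ext x
    simp [bracketCobracket]
  rw [IsUniversal, e]
  exact h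

theorem isDerivation_bracketCobracket (A : LBA K) : IsDerivation A (bracketCobracket K A) := by
  intro x y
  change bracket K A (A.cobracket ⁅x, y⁆) = ⁅bracket K A (A.cobracket x), y⁆
    + ⁅x, bracket K A (A.cobracket y)⁆
  rw [A.cocycle, map_sub, bracket_lie, bracket_lie, ← lie_skew _ y]
  abel

/-- Let `T` be the cobracket iterated on the second factor, and let `m₁`, `m₂`, `n` bracket the
factors 1 and 2, 2 and 3, 1 and 3. Co-Jacobi pushed through `m₁` and `m₂` gives `m₁ (cyc T) = -2 m₁
T` and `m₂ T = 2 n T`. By the cocycle identity the left side is `2 (m₁ T + n T)`, and the right side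
is `-m₁ (cyc T) + m₂ T`. -/
theorem isCoderivation_bracketCobracket (A : LBA K) :
    IsCoderivation A (bracketCobracket K A) := by
  let m₁ : A ⊗[K] (A ⊗[K] A) →ₗ[K] A ⊗[K] A :=
    (bracket K A).rTensor A ∘ₗ (TensorProduct.assoc K A A A).symm.toLinearMap
  let m₂ : A ⊗[K] (A ⊗[K] A) →ₗ[K] A ⊗[K] A := (bracket K A).lTensor A
  let fl : A ⊗[K] (A ⊗[K] A) →ₗ[K] A ⊗[K] (A ⊗[K] A) :=
    (TensorProduct.comm K A A).toLinearMap.lTensor A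
  let act : A ⊗[K] (A ⊗[K] A) →ₗ[K] A ⊗[K] A := LieModule.toModuleHom K A (A ⊗[K] A)
  let n : A ⊗[K] (A ⊗[K] A) →ₗ[K] A ⊗[K] A := act - m₁
  have hact : ∀ a s, act (a ⊗ₜ s) = ⁅a, s⁆ := fun a s => rfl
  have hm₁ : ∀ a b c, m₁ (a ⊗ₜ (b ⊗ₜ c)) = ⁅a, b⁆ ⊗ₜ c := fun a b c => rfl
  have hm₂ : ∀ a b c, m₂ (a ⊗ₜ (b ⊗ₜ c)) = a ⊗ₜ ⁅b, c⁆ := fun a b c => rfl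
  have hfl : ∀ a b c, fl (a ⊗ₜ (b ⊗ₜ c)) = a ⊗ₜ (c ⊗ₜ b) := fun a b c => rfl
  have hn : ∀ a b c, n (a ⊗ₜ (b ⊗ₜ c)) = b ⊗ₜ ⁅a, c⁆ := fun a b c => by
    change act _ - m₁ _ = _
    rw [hact, hm₁, TensorProduct.LieModule.lie_tmul_right, add_sub_cancel_left]
  have ext3 : ∀ {f g : A ⊗[K] (A ⊗[K] A) →ₗ[K] A ⊗[K] A},
      (∀ a b c, f (a ⊗ₜ (b ⊗ₜ c)) = g (a ⊗ₜ (b ⊗ₜ c))) → ∀ t, f t = g t := by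
    intro f g h t
    have : f = g := by
      ext a b c
      exact h a b c
    rw [this]
  have e1 : ∀ t, m₁ (cyc K A (cyc K A t)) = -m₁ (fl t) :=
    ext3 (f := m₁ ∘ₗ cyc K A ∘ₗ cyc K A) (g := -(m₁ ∘ₗ fl)) fun a b c => by
      simp only [LinearMap.comp_apply, LinearMap.neg_apply, FreeLie.cyc_tmul, hm₁, hfl]
      rw [← lie_skew, TensorProduct.neg_tmul]
  have e2 : ∀ t, m₂ (cyc K A t) = -n t :=
    ext3 (f := m₂ ∘ₗ cyc K A) (g := -n) fun a b c => by
      simp only [LinearMap.comp_apply, LinearMap.neg_apply, FreeLie.cyc_tmul, hm₂, hn]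
      rw [← lie_skew, TensorProduct.tmul_neg]
  have e3 : ∀ t, m₂ (cyc K A (cyc K A t)) = n (fl t) :=
    ext3 (f := m₂ ∘ₗ cyc K A ∘ₗ cyc K A) (g := n ∘ₗ fl) fun a b c => by
      simp only [LinearMap.comp_apply, FreeLie.cyc_tmul, hm₂, hfl, hn]
  have e4 : ∀ s : A ⊗[K] A, A.cobracket (bracket K A s) = act (A.cobracket.lTensor A s)
      - act (A.cobracket.lTensor A (TensorProduct.comm K A A s)) := by
    intro s
    induction s with
    | zero => simp
    | add s s' h h' => simp only [map_add, h, h']; abel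
    | tmul a b =>
      simp only [bracket_tmul, TensorProduct.comm_tmul, LinearMap.lTensor_tmul, hact, A.cocycle]
  have e5 : ∀ s : A ⊗[K] A, TensorProduct.map (bracketCobracket K A) LinearMap.id s
      = m₁ (cyc K A (A.cobracket.lTensor A (TensorProduct.comm K A A s))) := by
    intro s
    induction s with
    | zero => simp
    | add s s' h h' => simp only [map_add, h, h']
    | tmul a b =>
      rw [TensorProduct.comm_tmul, LinearMap.lTensor_tmul, TensorProduct.map_tmul]
      change (bracket K A (A.cobracket a)) ⊗ₜ b = _
      generalize A.cobracket a = s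
      induction s with
      | zero => simp
      | add s s' h h' => simp only [map_add, TensorProduct.add_tmul, TensorProduct.tmul_add, h, h']
      | tmul c d => rw [FreeLie.cyc_tmul, hm₁, bracket_tmul]
  have e6 : ∀ s : A ⊗[K] A, TensorProduct.map LinearMap.id (bracketCobracket K A) s
      = m₂ (A.cobracket.lTensor A s) := by
    intro s
    induction s with
    | zero => simp
    | add s s' h h' => simp only [map_add, h, h']
    | tmul a b => rfl
  refine LinearMap.ext fun x => ?_
  set T := A.cobracket.lTensor A (A.cobracket x) with hT
  have hfT : fl T = -T := by
    have h1 : ∀ s : A ⊗[K] A, fl (A.cobracket.lTensor A s) = -A.cobracket.lTensor A s := by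
      intro s
      induction s with
      | zero => simp
      | add s s' h h' => simp only [map_add, h, h']; abel
      | tmul a b =>
        rw [LinearMap.lTensor_tmul]
        change a ⊗ₜ (TensorProduct.comm K A A (A.cobracket b)) = _
        rw [A.antisymm, TensorProduct.tmul_neg]
    exact h1 _
  have j1 := congrArg m₁ (A.coJacobi x)
  have j2 := congrArg m₂ (A.coJacobi x)
  rw [← hT, map_add, map_add, map_zero] at j1 j2
  rw [e1, hfT, map_neg, neg_neg] at j1
  rw [e2, e3, hfT, map_neg] at j2
  rw [LinearMap.comp_apply, LinearMap.comp_apply, LinearMap.add_apply, e5, e6, A.antisymm, map_neg,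
    ← hT, map_neg, map_neg]
  change A.cobracket (bracket K A (A.cobracket x)) = _
  rw [e4, A.antisymm, map_neg, map_neg, ← hT]
  have hs : act T = m₁ T + n T := (add_sub_cancel (m₁ T) (act T)).symm
  have j1' : m₁ (cyc K A T) = -(m₁ T + m₁ T) := by
    rw [eq_neg_iff_add_eq_zero, ← j1]; abel
  have j2' : m₂ T = n T + n T := by
    rw [← sub_eq_zero, ← j2]; abel
  rw [hs, j1', j2']
  abel

/-- A universal family whose components of degree different from one vanish is a multiple of the
composite of the bracket and of the cobracket. -/
theorem exists_eq_smul {n : ℕ} {q : ℕ → FreeAlgebra K ℕ} (hq : ∀ k, q k ∈ permAlg K k)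
    {l : EndFamily K} (hl : ∀ A a, l A a = ∑ k ∈ Finset.range n, (k + 1 : K)⁻¹ •
      combEnd A.br A.cobracket k (q k) LinearMap.id a)
    (h : ∀ k < n, k ≠ 1 → ∀ A : LBA K, combEnd A.br A.cobracket k (q k) LinearMap.id = 0) :
    l ∈ Submodule.span K {bracketCobracket K} := by
  obtain ⟨r, hr⟩ := permAlg_le_bot le_rfl (hq 1)
  -- If `n ≤ 1`, the sum has no term of degree one and the multiple is zero.
  refine Submodule.mem_span_singleton.2 ⟨if 1 < n then ((1 : ℕ) + 1 : K)⁻¹ * r else 0, ?_⟩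
  funext A
  refine LinearMap.ext fun a => ?_
  rw [hl]
  split_ifs with hn
  · rw [Finset.sum_eq_single_of_mem 1 (Finset.mem_range.2 hn), hr, combEnd_one, lift_br, smul_smul]
    · rfl
    · intro k hk hk1
      rw [h k (Finset.mem_range.1 hk) hk1, LinearMap.zero_apply, smul_zero]
  · rw [Finset.sum_eq_zero]
    · simp
    · intro k hk
      have := Finset.mem_range.1 hk
      rw [h k this (by omega), LinearMap.zero_apply, smul_zero]

end Converse

variable {K : Type u} [Field K] [CharZero K]

open WordLBA

theorem corner_lie_plain_starred :
    corner (fun _ : PUnit.{u + 1} => (1 : K)) ⁅plain K [PUnit.unit], starred K []⁆ = 1 := by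
  rw [corner_lie, psi_starred, psi_plain, corner_starred]
  simp

/-- For a single letter `y` followed by `none`, the parts with an empty word are invisible to `psi`
and to the corner, and the two orders of the remaining deconcatenation both give the bracket of `y`
with `none`. -/
theorem corner_bracketCobracket :
    corner (fun _ : PUnit.{u + 1} => (1 : K)) (bracketCobracket K _ (starred K [PUnit.unit])) = 2 := by
  have h := map_cobracket_starred (corner (fun _ : PUnit.{u + 1} => (1 : K)) ∘ₗ
    bracket K (wordLBA K (Option PUnit.{u + 1}))) [PUnit.unit]
  refine h.trans ?_
  simp only [deconc, LinearMap.comp_apply, bracket_tmul, corner_lie, psi_starred, corner_plain,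
    psi_plain, psi_plain_of_ne (fun _ : PUnit.{u + 1} => (1 : K)) (w := []) (by simp),
    corner_starred]
  norm_num

theorem bracketCobracket_ne_zero : bracketCobracket K ≠ 0 := by
  intro h
  have := corner_bracketCobracket (K := K)
  rw [h] at this
  simp at this

theorem isTest_of_isDerivation {k : ℕ} {q : FreeAlgebra K ℕ} (hq : q ∈ permAlg K k)
    (hc : ∀ (A : LBA K) (E : A →ₗ[K] A), IsBiderivation A E → ∀ a,
      combEnd A.br A.cobracket k q LinearMap.id (E a)
        = (k + 1 : K) • combEnd A.br A.cobracket k q E a)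
    (hd : ∀ A : LBA K, IsDerivation A (combEnd A.br A.cobracket k q LinearMap.id)) :
    IsTest k q where
  mem := hq
  count Y x := by
    rw [combEnd_comm (fun a b => isBiderivation_countNone.1 a b) isBiderivation_countNone.2,
      hc _ _ isBiderivation_countNone, map_smul]
  lie Y x y := by rw [hd]

theorem universalDerivations_eq :
    universalDerivations K = Submodule.span K {bracketCobracket K} := by
  refine le_antisymm ?_ ?_
  · rintro l ⟨-, hu, hd⟩
    obtain ⟨n, q, hq, hc, hl⟩ := hu.exists_combEnd
    refine exists_eq_smul hq hl fun k hk hk1 A => ?_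
    have hD := isDerivation_component hl hd hk
    rcases Nat.lt_or_ge k 2 with h2 | h2
    · obtain rfl : k = 0 := by omega
      obtain ⟨r, hr⟩ := permAlg_le_bot (Nat.zero_le _) (hq 0)
      -- A scalar `r` that is a derivation satisfies `r = r + r` after taking the corner of a
      -- bracket whose corner is 1.
      have h1 := hD (wordLBA K (Option PUnit.{u + 1})) (plain K [PUnit.unit]) (starred K [])
      rw [hr, combEnd_zero, combEnd_zero, combEnd_zero, smul_lie, lie_smul] at h1
      have h3 := congrArg (corner fun _ : PUnit.{u + 1} => (1 : K)) h1
      rw [map_add, map_smul, corner_lie_plain_starred, left_eq_add, smul_eq_mul, mul_one] at h3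
      refine LinearMap.ext fun a => ?_
      rw [hr, combEnd_zero, h3, zero_smul]
      rfl
    · have := isTest_of_isDerivation (hq k) (fun A => hc A k) hD
      exact combEnd_eq_zero (hq k) (this.perm_eq_zero h2) _ _ _
  · rw [Submodule.span_singleton_le_iff_mem]
    exact ⟨isFunctorial_bracketCobracket, isUniversal_bracketCobracket,
      isDerivation_bracketCobracket⟩

end

end LieBialg

/-! ### Pairings of tensor algebras and adjoint operators. -/

namespace LieBialg

noncomputable section

namespace Tens

variable {K : Type u} [Field K] {G : Type u} [AddCommGroup G] [Module K G]
  {H : Type u} [AddCommGroup H] [Module K H] (p : G →ₗ[K] Module.Dual K H)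

local notation "𝐓" => TensorAlgebra K

/-- The pairing of tensor algebras induced by a pairing of vector spaces. -/
def pairT : 𝐓 G →ₗ[K] Module.Dual K (𝐓 H) :=
  LinearMap.applyₗ (TensorAlgebra.algebraMapInv (R := K) (M := H)).toLinearMap ∘ₗ
    (TensorAlgebra.lift K (LinearMap.compr₂ (LinearMap.smulRightₗ ∘ₗ p) headRecₗ :
      G →ₗ[K] Module.End K (Module.Dual K (𝐓 H)))).toLinearMap

@[simp] theorem pairT_one_one : pairT p 1 1 = 1 := by simp [pairT]
@[simp] theorem pairT_one_cons (b : H) (t : 𝐓 H) : pairT p 1 (TensorAlgebra.ι K b * t) = 0 := by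
  simp [pairT, TensorAlgebra.algebraMapInv]
@[simp] theorem pairT_cons_one (a : G) (s : 𝐓 G) : pairT p (TensorAlgebra.ι K a * s) 1 = 0 := by
  simp only [pairT, LinearMap.comp_apply, AlgHom.toLinearMap_apply, map_mul,
    TensorAlgebra.lift_ι_apply]
  exact headRec_one _
@[simp] theorem pairT_cons_cons (a : G) (s : 𝐓 G) (b : H) (t : 𝐓 H) :
    pairT p (TensorAlgebra.ι K a * s) (TensorAlgebra.ι K b * t) = p a b * pairT p s t := by
  simp only [pairT, LinearMap.comp_apply, AlgHom.toLinearMap_apply, map_mul,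
    TensorAlgebra.lift_ι_apply]
  exact headRec_cons _ _ _
@[simp] theorem pairT_ι_cons (a : G) (b : H) (t : 𝐓 H) :
    pairT p (TensorAlgebra.ι K a) (TensorAlgebra.ι K b * t) = p a b * pairT p 1 t := by
  rw [← mul_one (TensorAlgebra.ι K a), pairT_cons_cons]
@[simp] theorem pairT_cons_ι (a : G) (s : 𝐓 G) (b : H) :
    pairT p (TensorAlgebra.ι K a * s) (TensorAlgebra.ι K b) = p a b * pairT p s 1 := by
  rw [← mul_one (TensorAlgebra.ι K b), pairT_cons_cons]
@[simp] theorem pairT_ι_ι (a : G) (b : H) :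
    pairT p (TensorAlgebra.ι K a) (TensorAlgebra.ι K b) = p a b := by
  rw [← mul_one (TensorAlgebra.ι K b), pairT_ι_cons, pairT_one_one, mul_one]

/-- The pairing of tensor squares induced by a pairing of vector spaces. -/
def pairTwo : G ⊗[K] G →ₗ[K] Module.Dual K (H ⊗[K] H) :=
  TensorProduct.dualDistrib K H H ∘ₗ TensorProduct.map p p

@[simp] theorem pairTwo_tmul (a a' : G) (b b' : H) :
    pairTwo p (a ⊗ₜ a') (b ⊗ₜ b') = p a b * p a' b' := by simp [pairTwo]

theorem pairT_mul₂_right (a a' : G) (s : 𝐓 G) (y : H ⊗[K] H) (t : 𝐓 H) :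
    pairT p (TensorAlgebra.ι K a * (TensorAlgebra.ι K a' * s)) (mul₂ y * t)
      = pairTwo p (a ⊗ₜ a') y * pairT p s t := by
  induction y with
  | zero => simp
  | add y y' h h' => simp only [map_add, add_mul, h, h']
  | tmul b b' => simp [mul_assoc]

theorem pairT_mul₂_left (x : G ⊗[K] G) (s : 𝐓 G) (b b' : H) (t : 𝐓 H) :
    pairT p (mul₂ x * s) (TensorAlgebra.ι K b * (TensorAlgebra.ι K b' * t))
      = pairTwo p x (b ⊗ₜ b') * pairT p s t := by
  induction x with
  | zero => simp
  | add y y' h h' => simp only [map_add, add_mul, LinearMap.add_apply, h, h']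
  | tmul b b' => simp [mul_assoc]

/-- Adjointness for the pairing of tensor algebras. -/
def Adj (F : Module.End K (𝐓 G)) (F' : Module.End K (𝐓 H)) : Prop :=
  ∀ s t, pairT p (F s) t = pairT p s (F' t)

variable {p}

theorem Adj.of_eq {F : Module.End K (𝐓 G)} {F' : Module.End K (𝐓 H)}
    (h : pairT p ∘ₗ F = F'.dualMap ∘ₗ pairT p) : Adj p F F' :=
  fun s t => LinearMap.congr_fun (LinearMap.congr_fun h s) t

theorem Adj.mul {F₁ F₂ : Module.End K (𝐓 G)} {F₁' F₂' : Module.End K (𝐓 H)} (h₁ : Adj p F₁ F₁')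
    (h₂ : Adj p F₂ F₂') : Adj p (F₁ * F₂) (F₂' * F₁') := fun s t => by
  rw [Module.End.mul_apply, Module.End.mul_apply, h₁, h₂]

theorem Adj.add {F₁ F₂ : Module.End K (𝐓 G)} {F₁' F₂' : Module.End K (𝐓 H)} (h₁ : Adj p F₁ F₁')
    (h₂ : Adj p F₂ F₂') : Adj p (F₁ + F₂) (F₁' + F₂') := fun s t => by
  rw [LinearMap.add_apply, LinearMap.add_apply, map_add, map_add, LinearMap.add_apply, h₁, h₂]

theorem Adj.algebraMap (r : K) : Adj p (algebraMap K _ r) (algebraMap K _ r) := fun s t => by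
  simp [Module.algebraMap_end_apply]

theorem Adj.one : Adj p 1 1 := fun _ _ => rfl

theorem Adj.lift {F : Module.End K (𝐓 G)} {F' : Module.End K (𝐓 H)} (h : Adj p F F') :
    Adj p (lift F) (lift F') := by
  refine Adj.of_eq (ext_head ?_ fun a s => ?_)
  · exact ext_head (by simp) fun b t => by simp
  · exact ext_head (by simp) fun b t => by simp [h s t]

theorem Adj.shift {F : Module.End K (𝐓 G)} {F' : Module.End K (𝐓 H)} (h : Adj p F F') (i : ℕ) :
    Adj p (shift i F) (shift i F') := by
  induction i with
  | zero => exact h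
  | succ i ih => exact ih.lift

theorem adj_head {E : Module.End K G} {E' : Module.End K H} (h : ∀ a b, p (E a) b = p a (E' b)) :
    Adj p (head E) (head E') := by
  refine Adj.of_eq (ext_head ?_ fun a s => ?_)
  · exact ext_head (by simp) fun b t => by simp
  · exact ext_head (by simp) fun b t => by simp [h a b]

theorem adj_tau₀ : Adj p tau₀ tau₀ := by
  refine Adj.of_eq (ext_head2 ?_ (fun a => ?_) fun a a' s => ?_)
  · exact ext_head2 (by simp) (by simp) (by simp)
  · exact ext_head2 (by simp) (by simp) (by simp)
  · exact ext_head2 (by simp) (by simp) fun b b' t => by simp; ring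

theorem adj_proj (k : ℕ) : Adj p (proj k) (proj k) := by
  induction k with
  | zero =>
    refine Adj.of_eq (ext_head ?_ fun a s => ?_)
    · exact ext_head (by simp) fun b t => by simp
    · exact ext_head (by simp) fun b t => by simp
  | succ k ih => exact ih.lift

/-- Transpositions are self-adjoint and adjunction reverses products, which on the free algebra is
`star`. -/
theorem adj_perm (q : FreeAlgebra K ℕ) : Adj p (perm (star q)) (perm q) := by
  induction q using FreeAlgebra.induction with
  | grade0 r => rw [FreeAlgebra.star_algebraMap, AlgHom.commutes, AlgHom.commutes]; exact .algebraMap r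
  | grade1 i => rw [FreeAlgebra.star_ι, perm_ι, perm_ι]; exact adj_tau₀.shift i
  | mul q q' h h' => rw [star_mul, map_mul perm, map_mul perm]; exact h'.mul h
  | add q q' h h' => rw [star_add, map_add, map_add]; exact h.add h'

theorem star_mem_permAlg {k : ℕ} {q : FreeAlgebra K ℕ} (hq : q ∈ permAlg K k) :
    star q ∈ permAlg K k := by
  refine Algebra.adjoin_induction ?_ ?_ ?_ ?_ hq
  · rintro _ ⟨i, hi, rfl⟩
    rw [FreeAlgebra.star_ι]
    exact Algebra.subset_adjoin ⟨i, hi, rfl⟩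
  · intro r
    rw [FreeAlgebra.star_algebraMap]
    exact Subalgebra.algebraMap_mem _ r
  · intro x y _ _ hx hy
    rw [star_add]
    exact add_mem hx hy
  · intro x y _ _ hx hy
    rw [star_mul]
    exact mul_mem hy hx

section

variable {β : G →ₗ[K] G →ₗ[K] G} {d : H →ₗ[K] H ⊗[K] H}

theorem adj_mu₀ (h : ∀ a a' b, p (β a a') b = pairTwo p (a ⊗ₜ a') (d b)) :
    Adj p (mu₀ β) (del₀ d) := by
  have h0 : ∀ (y : H ⊗[K] H) t, pairT p 1 (mul₂ y * t) = 0 := by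
    intro y t
    induction y with
    | zero => simp
    | add y y' h h' => simp only [map_add, add_mul, h, h', add_zero]
    | tmul b b' => simp [mul_assoc]
  have h1 : ∀ a (y : H ⊗[K] H) t, pairT p (TensorAlgebra.ι K a) (mul₂ y * t) = 0 := by
    intro a y t
    induction y with
    | zero => simp
    | add y y' h h' => simp only [map_add, add_mul, h, h', add_zero]
    | tmul b b' => simp [mul_assoc]
  refine Adj.of_eq (ext_head2 ?_ (fun a => ?_) fun a a' s => ?_)
  · exact ext_head (by simp) fun b t => by simp [h0]
  · exact ext_head (by simp) fun b t => by simp [h1]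
  · exact ext_head (by simp) fun b t => by simp [pairT_mul₂_right, h]

end

section

variable {d : G →ₗ[K] G ⊗[K] G} {β : H →ₗ[K] H →ₗ[K] H}

theorem adj_del₀ (h : ∀ a b b', pairTwo p (d a) (b ⊗ₜ b') = p a (β b b')) :
    Adj p (del₀ d) (mu₀ β) := by
  have h0 : ∀ (x : G ⊗[K] G) s, pairT p (mul₂ x * s) 1 = 0 := by
    intro x s
    induction x with
    | zero => simp
    | add y y' h h' => simp only [map_add, add_mul, LinearMap.add_apply, h, h', add_zero]
    | tmul b b' => simp [mul_assoc]
  have h1 : ∀ (x : G ⊗[K] G) s b, pairT p (mul₂ x * s) (TensorAlgebra.ι K b) = 0 := by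
    intro x s b
    induction x with
    | zero => simp
    | add y y' h h' => simp only [map_add, add_mul, LinearMap.add_apply, h, h', add_zero]
    | tmul b b' => simp [mul_assoc]
  refine Adj.of_eq (ext_head ?_ fun a s => ?_)
  · exact ext_head2 (by simp) (by simp) (by simp)
  · exact ext_head2 (by simp [h0]) (by simp [h1]) fun b b' t => by simp [pairT_mul₂_left, h]

end

theorem adj_iterBr {β : G →ₗ[K] G →ₗ[K] G} {d : H →ₗ[K] H ⊗[K] H} (h : Adj p (mu₀ β) (del₀ d))
    (k : ℕ) : Adj p (iterBr β k) (LegRelations.cobr (del d) k) := by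
  induction k with
  | zero => exact .one
  | succ k ih => exact ih.mul (h.shift k)

theorem adj_cobr {d : G →ₗ[K] G ⊗[K] G} {β : H →ₗ[K] H →ₗ[K] H} (h : Adj p (del₀ d) (mu₀ β))
    (k : ℕ) : Adj p (LegRelations.cobr (del d) k) (iterBr β k) := by
  induction k with
  | zero => exact .one
  | succ k ih => exact (h.shift k).mul ih

/-- The adjoint of `combEnd` for a pairing under which bracket and cobracket are adjoint. -/
theorem combEnd_adj {β : G →ₗ[K] G →ₗ[K] G} {d : G →ₗ[K] G ⊗[K] G} {β' : H →ₗ[K] H →ₗ[K] H}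
    {d' : H →ₗ[K] H ⊗[K] H} (hβ : Adj p (mu₀ β) (del₀ d')) (hd : Adj p (del₀ d) (mu₀ β'))
    {E : Module.End K G} {E' : Module.End K H} (hE : ∀ a b, p (E a) b = p a (E' b)) {k : ℕ}
    {q : FreeAlgebra K ℕ} (hq : q ∈ permAlg K k) (a : G) (b : H) :
    p (combEnd β d k (star q) E a) b = p a (combEnd β' d' k q E' b) := by
  have h : Adj p (comb β d k (star q) E) (comb β' d' k q E') := by
    have := (adj_iterBr hβ k).mul ((adj_perm q).mul (((adj_head hE).shift k).mul (adj_cobr hd k)))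
    rw [mul_assoc (iterBr β' k), shift_perm hq, mul_assoc, mul_assoc] at this
    exact this
  have := h (TensorAlgebra.ι K a) (TensorAlgebra.ι K b)
  rwa [← ι_combEnd, ← ι_combEnd, pairT_ι_ι, pairT_ι_ι] at this

end Tens

end

end LieBialg

/-! ### Coefficients of words, and separation of tensors by linear forms. -/

namespace LieBialg

noncomputable section

section Coef

variable {K X : Type u} [Field K]

/-- The coefficient of a word in an element of the free algebra. -/
def coef (u : List X) : FreeAlgebra K X →ₗ[K] K :=
  (FreeAlgebra.basisFreeMonoid K X).coord (FreeMonoid.ofList u)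

theorem coef_apply (u : List X) (a : FreeAlgebra K X) : coef u a
    = (FreeAlgebra.equivMonoidAlgebraFreeMonoid a).coeff (FreeMonoid.ofList u) := rfl

theorem eq_zero_of_coef {a : FreeAlgebra K X} (h : ∀ u, coef u a = 0) : a = 0 :=
  (FreeAlgebra.basisFreeMonoid K X).forall_coord_eq_zero_iff.1 fun u => h u

theorem equiv_ι (x : X) : FreeAlgebra.equivMonoidAlgebraFreeMonoid (FreeAlgebra.ι K x)
    = MonoidAlgebra.single (FreeMonoid.of x) 1 := by
  simp [FreeAlgebra.equivMonoidAlgebraFreeMonoid]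

@[simp] theorem coef_nil_one : coef [] (1 : FreeAlgebra K X) = 1 := by
  rw [coef_apply, map_one]
  exact MonoidAlgebra.coeff_one_one

@[simp] theorem coef_cons_one (x : X) (u : List X) : coef (x :: u) (1 : FreeAlgebra K X) = 0 := by
  rw [coef_apply, map_one, MonoidAlgebra.one_def, MonoidAlgebra.coeff_single]
  exact Finsupp.single_eq_of_ne (by simp)

@[simp] theorem coef_nil_cons (x : X) (b : FreeAlgebra K X) :
    coef [] (FreeAlgebra.ι K x * b) = 0 := by
  rw [coef_apply, map_mul, equiv_ι]
  exact MonoidAlgebra.coeff_single_mul_of_forall_mul_ne _ _ fun d h =>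
    List.cons_ne_nil x _ (congrArg FreeMonoid.toList h)

theorem coef_cons_self (x : X) (u : List X) (b : FreeAlgebra K X) :
    coef (x :: u) (FreeAlgebra.ι K x * b) = coef u b := by
  rw [coef_apply, map_mul, equiv_ι, MonoidAlgebra.coeff_single_mul_eq_mul_coeff
    (FreeMonoid.ofList u), one_mul]
  · rfl
  · intro m _
    exact ⟨fun h => (List.cons.inj h).2, fun h => by rw [h]; rfl⟩

theorem coef_cons_of_ne {x y : X} (h : x ≠ y) (u : List X) (b : FreeAlgebra K X) :
    coef (x :: u) (FreeAlgebra.ι K y * b) = 0 := by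
  rw [coef_apply, map_mul, equiv_ι]
  exact MonoidAlgebra.coeff_single_mul_of_forall_mul_ne _ _ fun d hd =>
    h (List.cons.inj hd).1.symm

/-- Concatenation and deconcatenation are dual; the self-pairing of the Lie bialgebra of words rests
on this. -/
theorem coef_mul (u : List X) (a b : FreeAlgebra K X) :
    coef u (a * b) = deconc (fun u₁ u₂ => coef u₁ a * coef u₂ b) u := by
  induction a using FreeAlgebra.induction generalizing u b with
  | grade0 r =>
    rw [← Algebra.smul_def, map_smul, Algebra.algebraMap_eq_smul_one]
    cases u with
    | nil => simp [deconc]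
    | cons x u => simp [deconc, deconc_zero]
  | grade1 y =>
    have h0 : coef [] (FreeAlgebra.ι K y) = 0 := by
      rw [← mul_one (FreeAlgebra.ι K y), coef_nil_cons]
    cases u with
    | nil => simp [deconc, h0]
    | cons x u =>
      rw [deconc, h0, zero_mul, zero_add]
      have h2 : ∀ u', coef (x :: u') (FreeAlgebra.ι K y) = coef (x :: u') (FreeAlgebra.ι K y * 1) :=
        fun u' => by rw [mul_one]
      by_cases h : x = y
      · subst h
        simp only [h2, coef_cons_self]
        cases u with
        | nil => simp [deconc]
        | cons z u => simp [deconc, deconc_zero]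
      · simp only [h2, coef_cons_of_ne h, zero_mul, deconc_zero]
  | mul a a' h h' =>
    rw [mul_assoc, h]
    simp only [h, h']
    have e1 : ∀ (u v : List X), coef u a * deconc (fun v₁ v₂ => coef v₁ a' * coef v₂ b) v
        = deconc (fun v₁ v₂ => coef u a * (coef v₁ a' * coef v₂ b)) v := fun u v =>
      (deconc_map (AddMonoidHom.mulLeft (coef u a)) _ v).symm
    have e2 : ∀ (u v : List X), deconc (fun u₁ u₂ => coef u₁ a * coef u₂ a') u * coef v b
        = deconc (fun u₁ u₂ => coef u₁ a * coef u₂ a' * coef v b) u := fun u v =>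
      (deconc_map (AddMonoidHom.mulRight (coef v b)) _ u).symm
    simp only [e1, e2]
    rw [deconc_assoc (fun u₁ u₂ v => coef u₁ a * coef u₂ a' * coef v b)]
    simp only [mul_assoc]
  | add a a' h h' => simp only [add_mul, map_add, h, h', deconc_add]

end Coef

namespace Tens

variable {K : Type u} [Field K] {G : Type u} [AddCommGroup G] [Module K G]

/-- In a basis, coefficients are pairings with products of coordinate forms, so these forms detect
every tensor, whatever the dimension. -/
theorem coef_equivFreeAlgebra {κ : Type u} (b : Module.Basis κ K G) (u : List κ)
    (t : TensorAlgebra K G) : coef u (TensorAlgebra.equivFreeAlgebra b t)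
      = pairT LinearMap.id (u.map fun i => TensorAlgebra.ι K (b.coord i)).prod t := by
  induction u generalizing t with
  | nil =>
    refine LinearMap.congr_fun (f := coef [] ∘ₗ (TensorAlgebra.equivFreeAlgebra b).toLinearMap)
      (ext_head (by simp) fun a t => ?_) t
    have : coef [] ∘ₗ LinearMap.mulRight K (TensorAlgebra.equivFreeAlgebra b t) ∘ₗ
        (TensorAlgebra.equivFreeAlgebra b).toLinearMap ∘ₗ TensorAlgebra.ι K = 0 :=
      b.ext fun i => by simp
    simpa using LinearMap.congr_fun this a
  | cons j u ih =>
    refine LinearMap.congr_fun (f := coef (j :: u) ∘ₗ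
      (TensorAlgebra.equivFreeAlgebra b).toLinearMap) (ext_head (by simp) fun a t => ?_) t
    have : coef (j :: u) ∘ₗ LinearMap.mulRight K (TensorAlgebra.equivFreeAlgebra b t) ∘ₗ
        (TensorAlgebra.equivFreeAlgebra b).toLinearMap ∘ₗ TensorAlgebra.ι K
        = coef u (TensorAlgebra.equivFreeAlgebra b t) • b.coord j := by
      refine b.ext fun i => ?_
      by_cases h : j = i
      · subst h
        simp [coef_cons_self]
      · simp [coef_cons_of_ne h, Finsupp.single_eq_of_ne h]
    have := LinearMap.congr_fun this a
    simp only [LinearMap.comp_apply, AlgEquiv.toLinearMap_apply, map_mul, List.map_cons,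
      List.prod_cons, pairT_cons_cons, ← ih, LinearMap.mulRight_apply, LinearMap.smul_apply,
      smul_eq_mul, LinearMap.id_apply] at this ⊢
    rw [this, mul_comm]

theorem eq_zero_of_pairT {t : TensorAlgebra K G}
    (h : ∀ s, pairT (LinearMap.id : Module.Dual K G →ₗ[K] _) s t = 0) : t = 0 := by
  let b := Module.Free.chooseBasis K G
  refine (TensorAlgebra.equivFreeAlgebra b).injective ?_
  rw [map_zero]
  exact eq_zero_of_coef fun u => by rw [coef_equivFreeAlgebra, h]

theorem perm_eq_zero_of_star {k : ℕ} {q : FreeAlgebra K ℕ}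
    (h : ∀ s : TensorAlgebra K (Module.Dual K G), perm (star q) (proj k s) = 0)
    (t : TensorAlgebra K G) : perm q (proj k t) = 0 := by
  refine eq_zero_of_pairT fun s => ?_
  rw [← adj_perm, ← adj_proj, proj_perm, h, map_zero, LinearMap.zero_apply]

end Tens

end

end LieBialg

/-! ### The dual Lie algebra and the self-pairing of the Lie bialgebra of words. -/

namespace LieBialg

noncomputable section

open Tens

section Dual

variable {K : Type u} [Field K] (A : LBA K)

/-- The bracket on the dual of a Lie bialgebra. -/
def dualBr : Module.Dual K A →ₗ[K] Module.Dual K A →ₗ[K] Module.Dual K A :=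
  LinearMap.compr₂ (TensorProduct.mk K _ _) (LinearMap.lcomp K K A.cobracket ∘ₗ
    TensorProduct.dualDistrib K A A)

theorem dualBr_apply (f g : Module.Dual K A) (x : A) :
    dualBr A f g x = TensorProduct.dualDistrib K A A (f ⊗ₜ g) (A.cobracket x) := rfl

theorem dualBr_swap (f g : Module.Dual K A) : dualBr A g f = -dualBr A f g := by
  refine LinearMap.ext fun x => ?_
  have h : ∀ t : A ⊗[K] A, TensorProduct.dualDistrib K A A (g ⊗ₜ f) t
      = TensorProduct.dualDistrib K A A (f ⊗ₜ g) (TensorProduct.comm K A A t) := by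
    intro t
    induction t with
    | zero => simp
    | add t t' h h' => simp only [map_add, h, h']
    | tmul a b => simp [mul_comm]
  rw [LinearMap.neg_apply, dualBr_apply, dualBr_apply, h, A.antisymm, map_neg]

theorem dualBr_jacobi (f g h : Module.Dual K A) :
    dualBr A f (dualBr A g h) + dualBr A h (dualBr A f g) + dualBr A g (dualBr A h f) = 0 := by
  refine LinearMap.ext fun x => ?_
  let D : Module.Dual K A → Module.Dual K A → Module.Dual K A → Module.Dual K (A ⊗[K] (A ⊗[K] A)) :=
    fun f g h => TensorProduct.dualDistrib K A (A ⊗[K] A)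
      (f ⊗ₜ TensorProduct.dualDistrib K A A (g ⊗ₜ h))
  have h1 : ∀ f g h, dualBr A f (dualBr A g h) x
      = D f g h (A.cobracket.lTensor A (A.cobracket x)) := by
    intro f g h
    rw [dualBr_apply]
    induction A.cobracket x with
    | zero => simp
    | add t t' h h' => simp only [map_add, h, h']
    | tmul a b => simp [D, dualBr_apply]
  have h2 : ∀ f g h t, D h f g t = D f g h (cyc K A t) := by
    intro f g h t
    have : D h f g = D f g h ∘ₗ cyc K A := by
      ext a b c
      simp [D, FreeLie.cyc_tmul]
      ring
    rw [this, LinearMap.comp_apply]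
  simp only [LinearMap.add_apply, h1]
  rw [h2 f g h, h2 h f g, h2 f g h, ← map_add, ← map_add, A.coJacobi, map_zero, LinearMap.zero_apply]

variable [CharZero K]

/-- The Lie ring structure on the dual of a Lie bialgebra. -/
@[reducible] def dualLieRing : LieRing (Module.Dual K A) where
  bracket f g := dualBr A f g
  add_lie f g h := by
    change dualBr A (f + g) h = dualBr A f h + dualBr A g h
    rw [map_add, LinearMap.add_apply]
  lie_add f g h := map_add (dualBr A f) g h
  lie_self f := LinearMap.ext fun x => by
    have := LinearMap.congr_fun (dualBr_swap A f f) x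
    rw [LinearMap.neg_apply] at this
    -- Antisymmetry only shows that the value is its own negative; characteristic zero makes it
    -- vanish.
    exact self_eq_neg.1 this
  leibniz_lie f g h := by
    change dualBr A f (dualBr A g h) = dualBr A (dualBr A f g) h + dualBr A g (dualBr A f h)
    rw [dualBr_swap A h (dualBr A f g), dualBr_swap A h f, map_neg, ← sub_eq_zero,
      ← dualBr_jacobi A f g h]
    abel

attribute [local instance] dualLieRing

/-- The Lie algebra structure on the dual of a Lie bialgebra. -/
@[reducible] def dualLieAlgebra : LieAlgebra K (Module.Dual K A) where
  toModule := inferInstance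
  lie_smul r f g := map_smul (dualBr A f) r g

end Dual

section Adjoint

variable {K : Type u} [Field K] {A B : LBA K} {p : A →ₗ[K] Module.Dual K B}

variable (p) in
/-- The contraction of the first factor with a vector. -/
def contr (b : B) : A ⊗[K] A →ₗ[K] A :=
  TensorProduct.lift (LinearMap.lsmul K A ∘ₗ p.flip b)

theorem contr_tmul (b : B) (x y : A) : contr p b (x ⊗ₜ y) = p x b • y := rfl

theorem pairTwo_contr (s : A ⊗[K] A) (b c : B) :
    pairTwo p s (b ⊗ₜ c) = p (contr p b s) c := by
  induction s with
  | zero => simp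
  | add s s' h h' => simp only [map_add, LinearMap.add_apply, h, h']
  | tmul x y => simp [contr_tmul]

theorem pairTwo_comm (s : A ⊗[K] A) (b c : B) :
    pairTwo p (TensorProduct.comm K A A s) (b ⊗ₜ c) = pairTwo p s (c ⊗ₜ b) := by
  induction s with
  | zero => simp
  | add s s' h h' => simp only [map_add, LinearMap.add_apply, h, h']
  | tmul x y => simp [mul_comm]

theorem contr_lie (a : A) (s : A ⊗[K] A) (b b' : B) :
    p ⁅a, contr p b s⁆ b' = pairTwo p ((A.br a).lTensor A s) (b ⊗ₜ b') := by
  rw [pairTwo_contr]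
  congr 2
  induction s with
  | zero => simp
  | add s s' h h' => simp only [map_add, lie_add, h, h']
  | tmul x y => simp [contr_tmul]

/-- If the bracket of `A` is adjoint to the cobracket of `B`, then the vectors for which the
cobracket of `A` is adjoint to the bracket of `B` are stable under the bracket. -/
theorem pair_cobracket_lie (hp : ∀ a a' b, p ⁅a, a'⁆ b = pairTwo p (a ⊗ₜ a') (B.cobracket b))
    {a a' : A} (ha : ∀ b c, pairTwo p (A.cobracket a) (b ⊗ₜ c) = p a ⁅b, c⁆)
    (ha' : ∀ b c, pairTwo p (A.cobracket a') (b ⊗ₜ c) = p a' ⁅b, c⁆) (b c : B) :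
    pairTwo p (A.cobracket ⁅a, a'⁆) (b ⊗ₜ c) = p ⁅a, a'⁆ ⁅b, c⁆ := by
  set Q := (A.br a).lTensor A (A.cobracket a') - (A.br a').lTensor A (A.cobracket a) with hQ
  have h1 : ∀ (b : B) (t : B ⊗[K] B), pairTwo p (a ⊗ₜ a') ⁅b, t⁆
      = pairTwo p (contr p b (A.cobracket a) ⊗ₜ a' + a ⊗ₜ contr p b (A.cobracket a')) t := by
    intro b t
    induction t with
    | zero => simp
    | add t t' h h' => simp only [map_add, lie_add, h, h']
    | tmul c c' =>
      rw [TensorProduct.LieModule.lie_tmul_right, map_add, map_add, LinearMap.add_apply,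
        pairTwo_tmul, pairTwo_tmul, pairTwo_tmul, pairTwo_tmul, ← ha, ← ha', pairTwo_contr,
        pairTwo_contr]
  -- `Q` expresses the action of `B` on its cobracket through the cobrackets of `a` and `a'`;
  -- antisymmetrized, it gives the cocycle identity of `B`.
  have h2 : ∀ b c : B, pairTwo p (a ⊗ₜ a') ⁅b, B.cobracket c⁆ = pairTwo p Q (b ⊗ₜ c) := by
    intro b c
    rw [h1, map_add, LinearMap.add_apply, ← hp, ← hp, ← lie_skew, map_neg, LinearMap.neg_apply,
      contr_lie, contr_lie, hQ, map_sub, LinearMap.sub_apply]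
    abel
  -- Since the cobrackets of `a` and `a'` are antisymmetric, the cocycle identity of `A` is the
  -- antisymmetrization of the same `Q`.
  have h3 : A.cobracket ⁅a, a'⁆ = Q - TensorProduct.comm K A A Q := by
    have h4 : ∀ (x : A) (s : A ⊗[K] A),
        ⁅x, s⁆ = (A.br x).lTensor A s + (A.br x).rTensor A s := by
      intro x s
      induction s with
      | zero => simp
      | add s s' h h' => simp only [map_add, lie_add, h, h']; abel
      | tmul c d =>
        rw [TensorProduct.LieModule.lie_tmul_right, add_comm]
        rfl
    have h5 : ∀ (x : A) (s : A ⊗[K] A), TensorProduct.comm K A A ((A.br x).lTensor A s)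
        = (A.br x).rTensor A (TensorProduct.comm K A A s) := by
      intro x s
      induction s with
      | zero => simp
      | add s s' h h' => simp only [map_add, h, h']
      | tmul c d => simp
    rw [A.cocycle, h4, h4, hQ, map_sub, h5, h5, A.antisymm, A.antisymm, map_neg, map_neg]
    abel
  rw [h3, map_sub, LinearMap.sub_apply, pairTwo_comm, ← h2, ← h2, ← map_sub, ← B.cocycle, hp]

end Adjoint

namespace WordLBA

variable {K X : Type u} [Field K] [CharZero K]

section

attribute [local instance] dualLieRing dualLieAlgebra

/-- The pairing of the Lie bialgebra of words with itself which sends a word and an element to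
the coefficient of the word in the associative image of the element. -/
def pair : wordLBA K X →ₗ[K] Module.Dual K (wordLBA K X) :=
  (FreeLieAlgebra.lift K (fun u : List X => (coef u ∘ₗ letters : Module.Dual K (wordLBA K X))) :
    FreeLieAlgebra K (List X) →ₗ⁅K⁆ Module.Dual K (wordLBA K X)).toLinearMap

theorem pair_gen (u : List X) (b : wordLBA K X) : pair (gen u) b = coef u (letters b) :=
  LinearMap.congr_fun (FreeLieAlgebra.lift_of_apply
    (fun u : List X => (coef u ∘ₗ letters : Module.Dual K (wordLBA K X))) u) b

theorem pair_lie (a a' b : wordLBA K X) :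
    pair ⁅a, a'⁆ b = pairTwo pair (a ⊗ₜ a') ((wordLBA K X).cobracket b) :=
  LinearMap.congr_fun (LieHom.map_lie (FreeLieAlgebra.lift K
    (fun u : List X => (coef u ∘ₗ letters : Module.Dual K (wordLBA K X))) :
      FreeLieAlgebra K (List X) →ₗ⁅K⁆ Module.Dual K (wordLBA K X)) a a') b

end

/-- In the first argument, adjointness of the bracket holds by construction. Adjointness of the
cobracket is, on generators, the duality between antisymmetrized deconcatenation and the commutator,
and `pair_cobracket_lie` extends it to brackets. -/
theorem pair_cobracket (a b c : wordLBA K X) :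
    pairTwo pair ((wordLBA K X).cobracket a) (b ⊗ₜ c) = pair a ⁅b, c⁆ := by
  let N : Submodule K (wordLBA K X) :=
    { carrier := {a | ∀ b c, pairTwo pair ((wordLBA K X).cobracket a) (b ⊗ₜ c) = pair a ⁅b, c⁆}
      zero_mem' := fun b c => by simp
      add_mem' := fun {x y} hx hy b c => by
        rw [map_add, map_add, map_add, LinearMap.add_apply, LinearMap.add_apply, hx, hy]
      smul_mem' := fun r x hx b c => by
        rw [map_smul, map_smul, map_smul, LinearMap.smul_apply, LinearMap.smul_apply, hx] }
  have h : N = ⊤ := by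
    refine eq_top N (fun w b c => ?_) fun x hx y hy b c => pair_cobracket_lie pair_lie hx hy b c
    refine (map_cobracket_gen ((pairTwo pair).flip (b ⊗ₜ c)) w).trans ?_
    rw [pair_gen, letters_lie, map_sub, coef_mul, coef_mul, ← deconc_sub]
    refine deconc_congr fun u v _ => ?_
    rw [LinearMap.flip_apply, LinearMap.flip_apply, pairTwo_tmul, pairTwo_tmul, pair_gen, pair_gen,
      pair_gen, pair_gen]
    ring
  exact (h ▸ Submodule.mem_top : a ∈ N) b c

theorem adj_mu₀_pair : Adj pair (mu₀ (wordLBA K X).br) (del₀ (wordLBA K X).cobracket) :=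
  adj_mu₀ pair_lie

theorem adj_del₀_pair : Adj pair (del₀ (wordLBA K X).cobracket) (mu₀ (wordLBA K X).br) :=
  adj_del₀ pair_cobracket

theorem pairTwo_map {E E' : wordLBA K X →ₗ[K] wordLBA K X} (h : ∀ a b, pair (E a) b = pair a (E' b))
    (s t : (wordLBA K X) ⊗[K] (wordLBA K X)) :
    pairTwo pair ((TensorProduct.map E LinearMap.id + TensorProduct.map LinearMap.id E :
        (wordLBA K X) ⊗[K] (wordLBA K X) →ₗ[K] (wordLBA K X) ⊗[K] (wordLBA K X)) s) t
      = pairTwo pair s ((TensorProduct.map E' LinearMap.id + TensorProduct.map LinearMap.id E' :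
        (wordLBA K X) ⊗[K] (wordLBA K X) →ₗ[K] (wordLBA K X) ⊗[K] (wordLBA K X)) t) := by
  induction s with
  | zero => simp
  | add s s' h h' => simp only [map_add, LinearMap.add_apply] at h h' ⊢; rw [h, h']; abel
  | tmul a a' =>
    induction t with
    | zero => simp
    | add t t' h h' => simp only [map_add, LinearMap.add_apply] at h h' ⊢; rw [h, h']
    | tmul b b' => simp [h]

/-- `letters` respects the grading by an additive weight; this is what makes `countNone`
self-adjoint for the pairing. -/
theorem coef_letters_weight {n : List X → ℕ} (hn : ∀ u v, n (u ++ v) = n u + n v) (u : List X)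
    (b : wordLBA K X) : coef u (letters (weight n b)) = n u * coef u (letters b) := by
  let N : Submodule K (wordLBA K X) :=
    { carrier := {b | ∀ u, coef u (letters (weight n b)) = n u * coef u (letters b)}
      zero_mem' := fun u => by simp
      add_mem' := fun {x y} hx hy u => by simp only [map_add, mul_add, hx u, hy u]
      smul_mem' := fun r x hx u => by
        simp only [map_smul, hx u, smul_eq_mul]
        ring }
  have h : N = ⊤ := by
    refine eq_top N (fun w u => ?_) fun x hx y hy u => ?_
    · rw [weight_gen, map_smul, map_smul, smul_eq_mul]
      by_cases hw : w.length = 1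
      · obtain ⟨x, rfl⟩ := List.length_eq_one_iff.1 hw
        rw [letters_gen, ← mul_one (FreeAlgebra.ι K x)]
        rcases u with _ | ⟨y, _ | ⟨z, u⟩⟩
        · rw [coef_nil_cons, mul_zero, mul_zero]
        · by_cases h : y = x
          · rw [h]
          · rw [coef_cons_of_ne h, mul_zero, mul_zero]
        · by_cases h : y = x
          · rw [h, coef_cons_self, coef_cons_one, mul_zero, mul_zero]
          · rw [coef_cons_of_ne h, mul_zero, mul_zero]
      · rw [letters_gen_of_ne hw, map_zero, mul_zero, mul_zero]
    · have e : ∀ x y : wordLBA K X, deconc (fun u₁ u₂ => (n u : K) * (coef u₁ (letters x) *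
          coef u₂ (letters y))) u = n u * coef u (letters x * letters y) := fun x y => by
        rw [coef_mul]
        exact deconc_map (AddMonoidHom.mulLeft (n u : K)) _ u
      rw [isDerivation_weight n x y, map_add, letters_lie, letters_lie, letters_lie, map_add,
        map_sub, map_sub, map_sub, mul_sub, ← e x y, ← e y x, coef_mul, coef_mul, coef_mul,
        coef_mul, ← deconc_sub, ← deconc_sub, ← deconc_sub, ← deconc_add]
      refine deconc_congr fun u₁ u₂ hu => ?_
      rw [hx, hy, hx, hy, ← hu, hn]
      push_cast
      ring
  exact (h ▸ Submodule.mem_top : b ∈ N) u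

theorem pair_weight {n : List X → ℕ} (hn : ∀ u v, n (u ++ v) = n u + n v) (a b : wordLBA K X) :
    pair (weight n a) b = pair a (weight n b) := by
  let N : Submodule K (wordLBA K X) :=
    { carrier := {a | ∀ b, pair (weight n a) b = pair a (weight n b)}
      zero_mem' := fun b => by simp
      add_mem' := fun {x y} hx hy b => by simp only [map_add, LinearMap.add_apply, hx b, hy b]
      smul_mem' := fun r x hx b => by simp only [map_smul, LinearMap.smul_apply, hx b] }
  have h : N = ⊤ := by
    refine eq_top N (fun w b => ?_) fun x hx y hy b => ?_
    · rw [weight_gen, map_smul, LinearMap.smul_apply, pair_gen, pair_gen, coef_letters_weight hn,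
        smul_eq_mul]
    · have h1 := LinearMap.congr_fun (isBiderivation_weight (K := K) hn).2 b
      simp only [LinearMap.comp_apply, LinearMap.add_apply] at h1
      rw [isDerivation_weight n x y, map_add, LinearMap.add_apply, pair_lie, pair_lie, pair_lie,
        h1, map_add]
      induction (wordLBA K X).cobracket b with
      | zero => simp
      | add t t' h h' => simp only [map_add] at h h' ⊢; rw [add_add_add_comm, h, h']; abel
      | tmul c c' =>
        have hx' : pair (weight n x) c = pair x (weight n c) := hx c
        have hy' : pair (weight n y) c' = pair y (weight n c') := hy c'
        simp [hx', hy']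
  exact (h ▸ Submodule.mem_top : a ∈ N) b

end WordLBA

end

end LieBialg

/-! ### The theorem for coderivations. -/

namespace LieBialg

noncomputable section

open Tens WordLBA

variable {K : Type u} [Field K] [CharZero K]

namespace WordLBA

/-- The generators on the left detect the second argument only through its image under `letters`;
this is why the conditions of `IsTest` are stated after `letters`. -/
theorem letters_eq_of_pair {X : Type u} {a b : wordLBA K X}
    (h : ∀ u, pair (gen u : wordLBA K X) a = pair (gen u) b) : letters a = letters b := by
  rw [← sub_eq_zero]
  refine eq_zero_of_coef fun u => ?_
  rw [map_sub, ← pair_gen, ← pair_gen, h, sub_self]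

theorem pair_combEnd {X : Type u} {E E' : wordLBA K X →ₗ[K] wordLBA K X}
    (h : ∀ a b, pair (E a) b = pair a (E' b)) {k : ℕ} {q : FreeAlgebra K ℕ} (hq : q ∈ permAlg K k)
    (a b : wordLBA K X) :
    pair a (combEnd (wordLBA K X).br (wordLBA K X).cobracket k (star q) E' b)
      = pair (combEnd (wordLBA K X).br (wordLBA K X).cobracket k q E a) b := by
  have := combEnd_adj (adj_mu₀_pair (K := K) (X := X)) adj_del₀_pair h (star_mem_permAlg hq) a b
  rw [star_star] at this
  exact this.symm

end WordLBA

/-- Under the pairing, the endomorphism of `star q` is the transpose of that of `q`, `countNone` is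
its own transpose, and the coderivation rule transposes to the derivation rule. -/
theorem isTest_star_of_isCoderivation {k : ℕ} {q : FreeAlgebra K ℕ} (hq : q ∈ permAlg K k)
    (hc : ∀ (A : LBA K) (E : A →ₗ[K] A), IsBiderivation A E → ∀ a,
      combEnd A.br A.cobracket k q LinearMap.id (E a)
        = (k + 1 : K) • combEnd A.br A.cobracket k q E a)
    (hd : ∀ A : LBA K, IsCoderivation A (combEnd A.br A.cobracket k q LinearMap.id)) :
    IsTest k (star q) where
  mem := star_mem_permAlg hq
  count Y x := by
    have hE : ∀ a b : wordLBA K (Option Y), pair (countNone K a) b = pair a (countNone K b) :=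
      pair_weight fun u v => List.countP_append
    rw [← map_smul]
    refine letters_eq_of_pair fun u => ?_
    rw [← hE, pair_combEnd (E := LinearMap.id) (fun _ _ => rfl) hq, hc _ _ isBiderivation_countNone,
      map_smul, map_smul, LinearMap.smul_apply, pair_combEnd hE hq]
  lie Y x y := by
    refine letters_eq_of_pair fun u => ?_
    have hG := pair_combEnd (K := K) (X := Option Y) (E := LinearMap.id) (E' := LinearMap.id)
      (fun _ _ => rfl) hq
    have h1 := LinearMap.congr_fun (hd (wordLBA K (Option Y))) (gen u)
    rw [LinearMap.comp_apply, LinearMap.comp_apply] at h1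
    rw [hG, ← pair_cobracket, h1, pairTwo_map (fun a b => (hG a b).symm), LinearMap.add_apply,
      TensorProduct.map_tmul, TensorProduct.map_tmul, map_add, map_add, pair_cobracket,
      pair_cobracket]
    rfl

theorem universalCoderivations_eq :
    universalCoderivations K = Submodule.span K {bracketCobracket K} := by
  refine le_antisymm ?_ ?_
  · rintro l ⟨-, hu, hd⟩
    obtain ⟨n, q, hq, hc, hl⟩ := hu.exists_combEnd
    refine exists_eq_smul hq hl fun k hk hk1 A => ?_
    have hD := isCoderivation_component hl hd hk
    rcases Nat.lt_or_ge k 2 with h2 | h2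
    · obtain rfl : k = 0 := by omega
      obtain ⟨r, hr⟩ := permAlg_le_bot (Nat.zero_le _) (hq 0)
      have h0 : ∀ A : LBA K, combEnd A.br A.cobracket 0 (q 0) LinearMap.id
          = r • (LinearMap.id : A →ₗ[K] A) := fun A => LinearMap.ext fun a => by
        rw [hr, combEnd_zero]
        rfl
      have h1 := hD (wordLBA K (Option PUnit.{u + 1}))
      rw [h0] at h1
      -- Applying the bracket and then the corner to the coderivation rule for the scalar `r` gives
      -- `2 r = 2 r + 2 r`.
      have h3 := congrArg (fun x => corner (fun _ : PUnit.{u + 1} => (1 : K)) (bracket K _ x))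
        (LinearMap.congr_fun h1 (starred K [PUnit.unit]))
      have h4 := corner_bracketCobracket (K := K)
      change corner _ (bracket K _ (LBA.cobracket _ _)) = 2 at h4
      simp only [LinearMap.comp_apply, LinearMap.smul_apply, LinearMap.id_apply, map_smul,
        TensorProduct.map_smul_left, TensorProduct.map_smul_right, TensorProduct.map_id,
        LinearMap.add_apply, map_add, h4, smul_eq_mul, left_eq_add, mul_eq_zero,
        OfNat.ofNat_ne_zero, or_false] at h3
      rw [h0, h3, zero_smul]
    · have := isTest_star_of_isCoderivation (hq k) (fun A => hc A k) hD
      exact combEnd_eq_zero (hq k) (perm_eq_zero_of_star (this.perm_eq_zero h2)) _ _ _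
  · rw [Submodule.span_singleton_le_iff_mem]
    exact ⟨isFunctorial_bracketCobracket, isUniversal_bracketCobracket,
      isCoderivation_bracketCobracket⟩

end

end LieBialg

theorem theorem1p2 (K : Type u) [Field K] [CharZero K] :
    LieBialg.universalDerivations K = Submodule.span K {LieBialg.bracketCobracket K} ∧
      LieBialg.universalCoderivations K = Submodule.span K {LieBialg.bracketCobracket K} ∧
      Module.finrank K (Submodule.span K {LieBialg.bracketCobracket K}) = 1 :=
  ⟨LieBialg.universalDerivations_eq, LieBialg.universalCoderivations_eq,
    finrank_span_singleton LieBialg.bracketCobracket_ne_zero⟩
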